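/- **Model.** The half-space TASEP with entrance rate $\alpha\ge 0$ is the continuous-time Markov chain $(X_t)_{t\ge 0}$ on finite subsets of $\{1,2,3,\dots\}$ (the occupied sites) in which each particle at a site $s$ jumps to $s+1$ at rate $1$ if $s+1$ is empty, and a new particle enters at site $1$ at rate $\alpha$ whenever site $1$ is empty (no left jumps and no exits, i.e. $q=\gamma=0$). A configuration is written $x=(x_1,\dots,x_N)$ with $x_1>\dots>x_N\ge 1$, and $\mathbb P_t(y\to x)=\mathbb P(X_t=x\mid X_0=y)$. **Kernels.** Let $t\ge 0$. Let $R_1,R_2>\max(1,\alpha)$ with $|R_1-R_2|>1$ and let $r>1$; all contours are positively oriented circles centred at $0$. (Thus the contours of radius $R_1,R_2$ surround $0,1,\alpha,1-\alpha$, and $u+w\ne 1$ for $|w|=R_1$, $|u|=R_2$.) For $i,j\ge 1$ and $a,b\in\mathbb Z$ put $$Q_{i,j}(a,b)=\alpha^2\oint_{|u|=R_2}\frac{du}{2\pi \mathrm i}\oint_{|w|=R_1}\frac{dw}{2\pi \mathrm i}\,\frac{u-w}{1-u-w}\,\frac{w^{i-a}e^{t(w-1)}}{(w-\alpha)(w-1)^i}\,\frac{u^{j-b}e^{t(u-1)}}{(u-\alpha)(u-1)^j},$$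 $$p_i(a)=\alpha\oint_{|w|=R_1}\frac{dw}{2\pi \mathrm i}\,\frac{w^{i-a}e^{t(w-1)}}{(w-\alpha)(w-1)^i},$$ and, for integers $N\ge M\ge 0$ and $k,z\in\mathbb Z$, $$U_k(z)=\oint_{|w|=r}\frac{dw}{2\pi \mathrm i}\,\frac{(w-1)^{N-M-k}e^{t(w-1)}}{w^{z-k+N-M+1}}.$$ For a configuration $x=(x_1,\dots,x_N)$ and a configuration $y=(y_1,\dots,y_M)$ define, for $1\le i,j\le N$ and $1\le k\le M$, $$[\mathsf Q]_{i,j}=Q_{i,j}(x_{N-i+1},x_{N-j+1}),\qquad [\mathsf p]_i=p_i(x_{N-i+1}),\qquad [\mathsf U]_{i,k}=U_{i-k}(x_{N-i+1}-y_{M-k+1}).$$ The Pfaffian of a skew-symmetric $2n\times 2n$ matrix $A$ is $\operatorname{Pf}A=\frac1{2^n n!}\sum_{\sigma\in S_{2n}}\operatorname{sgn}(\sigma)\prod_{i=1}^n A_{\sigma(2i-1),\sigma(2i)}$ (equal to $1$ for $n=0$). **Theorem.** The matrix $\mathsf Q$ is skew-symmetric. Let $N\ge M\ge 0$, let $x$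 be a configuration of $N$ particles and $y$ one of $M$ particles, with $y_M>N-M+1$ if $M\ge 1$. Then, if $N+M$ is even, $$\mathbb P_t(y\to x)=(-1)^{\binom N2}e^{-\alpha t}\operatorname{Pf}\begin{bmatrix}\mathsf Q&\mathsf U\\-\mathsf U^T&0\end{bmatrix},$$ and, if $N+M$ is odd, $$\mathbb P_t(y\to x)=(-1)^{\binom N2}e^{-\alpha t}\operatorname{Pf}\begin{bmatrix}\mathsf Q&\mathsf p&\mathsf U\\-\mathsf p^T&0&0\\-\mathsf U^T&0&0\end{bmatrix}.$$ In particular, for $y=\emptyset$: $\mathbb P_t(\emptyset\to x)=(-1)^{\binom N2}e^{-\alpha t}\operatorname{Pf}[\mathsf Q]$ if $N$ is even, and $\mathbb P_t(\emptyset\to x)=(-1)^{\binom N2}e^{-\alpha t}\operatorname{Pf}\begin{bmatrix}\mathsf Q&\mathsf p\\-\mathsf p^T&0\end{bmatrix}$ if $N$ is odd. -/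

import Mathlib

namespace HalfTASEP

/-! ### The half-space TASEP and its transition probabilities -/

/-- Half-space configurations: finite sets of occupied sites in `{1, 2, 3, …}`. -/
abbrev Config : Type := Finset ℕ+

/-- The configuration obtained when the particle at site `s` jumps to site `s + 1`. -/
def hop (y : Config) (s : ℕ+) : Config := insert (s + 1) (y.erase s)

/-- `∑_{z ≠ y} (rate of the jump y → z) * f z`: a particle enters at site `1` at rate `α` if site `1`
is empty, and every particle with an empty site on its right jumps there at rate `1`.
The generator of the process is `(L f) y = jumpSum α f y - exitRate α y * f y`. -/
noncomputable def jumpSum (α : ℝ) (f : Config → ℝ) (y : Config) : ℝ :=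
  (if 1 ∈ y then 0 else α * f (insert 1 y)) + ∑ s ∈ y with s + 1 ∉ y, f (hop y s)

/-- The total rate at which the process leaves the configuration `y`. -/
noncomputable def exitRate (α : ℝ) (y : Config) : ℝ := jumpSum α (fun _ => 1) y

/-- `ℙ(X_t = x and the process has made exactly n jumps up to time t | X_0 = y)` for the
continuous-time jump Markov process with the above rates, by decomposition at the first jump:
the process waits at `y` for an exponential time of parameter `exitRate α y` and then jumps to
`z` with probability (rate of `y → z`) / `exitRate α y`. -/
noncomputable def jumpProb (α : ℝ) : ℕ → ℝ → Config → Config → ℝ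
  | 0, t, y, x => if y = x then Real.exp (-(exitRate α y * t)) else 0
  | n + 1, t, y, x => ∫ s in (0 : ℝ)..t,
      Real.exp (-(exitRate α y * s)) * jumpSum α (fun z => jumpProb α n (t - s) z x) y

/-- The transition probability `ℙ_t(y → x) = ℙ(X_t = x | X_0 = y)` of the half-space TASEP with
entrance rate `α` (the process makes finitely many jumps in finite time). -/
noncomputable def transProb (α t : ℝ) (y x : Config) : ℝ := ∑' n : ℕ, jumpProb α n t y x

/-- The configuration with (ordered) particle coordinates `x 0 > x 1 > ⋯`. -/
def ofCoords {N : ℕ} (x : Fin N → ℕ+) : Config := Finset.univ.image x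

/-! ### Pfaffians and block matrices -/

/-- The Pfaffian of an `m × m` matrix, for `m` even:
`1 / (2^n n!) * ∑_{σ ∈ S_{2n}} sgn σ ∏_{i=1}^{n} A_{σ(2i-1), σ(2i)}` with `n = m / 2`. -/
noncomputable def pfaffian {m : ℕ} (A : Matrix (Fin m) (Fin m) ℂ) : ℂ :=
  1 / ((2 : ℂ) ^ (m / 2) * ((m / 2).factorial : ℂ)) *
    ∑ σ : Equiv.Perm (Fin m), ((Equiv.Perm.sign σ : ℤ) : ℂ) *
      ∏ i : Fin (m / 2), A (σ ⟨2 * (i : ℕ), by omega⟩) (σ ⟨2 * (i : ℕ) + 1, by omega⟩)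

/-- The matrix `[[Q, U], [-Uᵀ, 0]]`. -/
def blockEven {N M : ℕ} (Q : Matrix (Fin N) (Fin N) ℂ) (U : Matrix (Fin N) (Fin M) ℂ) :
    Matrix (Fin (N + M)) (Fin (N + M)) ℂ :=
  Matrix.reindex finSumFinEquiv finSumFinEquiv (Matrix.fromBlocks Q U (-U.transpose) 0)

/-- The matrix `[[Q, p], [-pᵀ, 0]]`. -/
def blockBorder {N : ℕ} (Q : Matrix (Fin N) (Fin N) ℂ) (p : Fin N → ℂ) :
    Matrix (Fin (N + 1)) (Fin (N + 1)) ℂ :=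
  blockEven Q (Matrix.of fun i (_ : Fin 1) => p i)

/-- The matrix `[[Q, p, U], [-pᵀ, 0, 0], [-Uᵀ, 0, 0]]`. -/
def blockOdd {N M : ℕ} (Q : Matrix (Fin N) (Fin N) ℂ) (p : Fin N → ℂ)
    (U : Matrix (Fin N) (Fin M) ℂ) : Matrix (Fin (N + 1 + M)) (Fin (N + 1 + M)) ℂ :=
  blockEven (blockBorder Q p)
    (Matrix.of fun i k => Fin.lastCases (motive := fun _ => ℂ) 0 (fun i' => U i' k) i)

/-! ### The kernels -/

/-- `∮ dz / (2 π i) f z` over the positively oriented circle of radius `R` around the origin. -/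
noncomputable def contour (R : ℝ) (f : ℂ → ℂ) : ℂ :=
  (2 * (Real.pi : ℂ) * Complex.I)⁻¹ * ∮ z in C(0, R), f z

/-- `w^{i-x} e^{t(w-1)} / ((w-α) (w-1)^i)`. -/
noncomputable def weight (α t : ℝ) (i : ℕ) (x : ℤ) (w : ℂ) : ℂ :=
  w ^ ((i : ℤ) - x) * Complex.exp (t * (w - 1)) / ((w - α) * (w - 1) ^ i)

/-- The kernel `Q_{i,j}(x,y)`, with `w` on the circle of radius `R₁` and `u` on the circle of
radius `R₂`. -/
noncomputable def Qker (α t R₁ R₂ : ℝ) (i j : ℕ) (x y : ℤ) : ℂ :=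
  (α : ℂ) ^ 2 * contour R₂ fun u => contour R₁ fun w =>
    (u - w) / (1 - u - w) * weight α t i x w * weight α t j y u

/-- The kernel `p_i(x)`. -/
noncomputable def pker (α t R : ℝ) (i : ℕ) (x : ℤ) : ℂ :=
  (α : ℂ) * contour R fun w => weight α t i x w

/-- The kernel `U_k(z)`. -/
noncomputable def Uker (t r : ℝ) (N M : ℕ) (k z : ℤ) : ℂ :=
  contour r fun w => (w - 1) ^ ((N : ℤ) - M - k) * Complex.exp (t * (w - 1)) /
    w ^ (z - k + N - M + 1)

/-! In the matrices the index `i : Fin N` stands for `i + 1 ∈ {1, …, N}`, and `x i.rev` is the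
coordinate `x_{N-(i+1)+1}`. -/

/-- `[Q]_{i,j} = Q_{i,j}(x_{N-i+1}, x_{N-j+1})`. -/
noncomputable def Qmat (α t R₁ R₂ : ℝ) {N : ℕ} (x : Fin N → ℕ+) : Matrix (Fin N) (Fin N) ℂ :=
  Matrix.of fun i j => Qker α t R₁ R₂ (i + 1) (j + 1) (x i.rev : ℕ) (x j.rev : ℕ)

/-- `[p]_i = p_i(x_{N-i+1})`. -/
noncomputable def pvec (α t R : ℝ) {N : ℕ} (x : Fin N → ℕ+) : Fin N → ℂ :=
  fun i => pker α t R (i + 1) (x i.rev : ℕ)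

/-- `[U]_{i,k} = U_{i-k}(x_{N-i+1} - y_{M-k+1})`. -/
noncomputable def Umat (t r : ℝ) {N M : ℕ} (x : Fin N → ℕ+) (y : Fin M → ℕ+) :
    Matrix (Fin N) (Fin M) ℂ :=
  Matrix.of fun i k => Uker t r N M ((i : ℤ) - (k : ℤ))
    (((x i.rev : ℕ) : ℤ) - ((y k.rev : ℕ) : ℤ))

end HalfTASEP

/-! Fix y and regard both sides as functions of t and x. The first-jump definition of the process
yields the forward equation (`hasDerivAt_transProb`), and there the inflow into x comes only from
configurations whose `height`, the sum of the positions, is smaller by one. `transProb_coordSet`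
therefore inducts on the height: once the inflow terms of the two sides agree, the difference f of
the sides satisfies f' = -(exit rate) f and f(0) = 0, so f = 0. No uniqueness theorem for an
infinite system is needed.

It remains that the Pfaffian obeys the same equation. Differentiation in t multiplies a weight by w
- 1, which turns weight_a into weight_{a-1} - weight_a; hence the Pfaffian evolves as if every
particle jumped freely (`hasDerivAt_pfRow`). Two boundary identities encode the interaction.
Exclusion: if a_{j+1} = a_j + 1, pulling particle j+1 back changes its row by exactly row j, which
an alternating form does not see (`pfRow_update_of_eq`). Entrance: if a_0 = 1, pulling this particle
back to 0 produces α times the Pfaffian plus a signed α times the Pfaffian without the particle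
(`transPf_update_wall`). Together with the factor e^{-αt} this is the forward equation.

The entrance identity is the heart of the matter. The row at 0 minus α times the row at 1 is
e^{t(w-1)}/(w-1), with the pole at α gone. Against this wall row, Q collapses to the residue at w =
1 and leaves α² times the contour integral that defines p; that integral of the wall row itself is
1; and U vanishes, which is where the lower bound on y is used. Removing a particle also shifts all
row indices by one, and this changes Q by a rank-two term, because uw - (u-1)(w-1) cancels the
denominator 1-u-w (`Qker_succ_succ`). Row operations absorb that term and either turn the wall row
into the border p (`pfRow_cons_eq_of_shift`) or eliminate it together with p
(`pfRow_cons_cons_eq_of_shift`). This is why the border appears according to the parity of N+M.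

At t = 0 the entries of Q and p vanish, since the contours can be pushed to infinity. For N > M too
many rows are then mutually orthogonal; for N = M the Pfaffian is evaluated by peeling off the
rightmost particle (`pfRow_time_zero`). For N < M both sides are identically zero, which stops the
induction.

Throughout, the matrices are Gram matrices of vectors in F × F* under a skew form, F being the space
of boundary values on the two circles, so that row operations become operations on vectors. -/

namespace HalfTASEP
-- Pfaffians as alternating forms
section PfaffianForm

variable {V : Type*} [AddCommGroup V] [Module ℂ V]

/-- The multilinear map `v ↦ ∏ i, ω (v (2 i)) (v (2 i + 1))`. -/
noncomputable def pairProd (ω : V →ₗ[ℂ] V →ₗ[ℂ] ℂ) (n : ℕ) :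
    MultilinearMap ℂ (fun _ : Fin (2 * n) => V) ℂ :=
  MultilinearMap.mk' (fun v => ∏ i : Fin n, ω (v ⟨2 * i, by omega⟩) (v ⟨2 * i + 1, by omega⟩))
    (by
      intro v k x y
      -- The k-th argument enters only the factor of the pair numbered k / 2; all other factors are
      -- untouched by an update at k.
      have hk : (k : ℕ) / 2 < n := by omega
      rw [← Finset.mul_prod_erase _ _ (Finset.mem_univ ⟨(k : ℕ) / 2, hk⟩),
        ← Finset.mul_prod_erase _ _ (Finset.mem_univ ⟨(k : ℕ) / 2, hk⟩),
        ← Finset.mul_prod_erase _ _ (Finset.mem_univ ⟨(k : ℕ) / 2, hk⟩)]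
      have key : ∀ z : V, ∏ i ∈ Finset.univ.erase (⟨(k : ℕ) / 2, hk⟩ : Fin n),
          ω (Function.update v k z ⟨2 * i, by omega⟩)
            (Function.update v k z ⟨2 * i + 1, by omega⟩) =
          ∏ i ∈ Finset.univ.erase (⟨(k : ℕ) / 2, hk⟩ : Fin n),
            ω (v ⟨2 * i, by omega⟩) (v ⟨2 * i + 1, by omega⟩) := by
        intro z
        refine Finset.prod_congr rfl fun i hi => ?_
        have hi' : (i : ℕ) ≠ k / 2 := fun h => (Finset.mem_erase.1 hi).1 (Fin.ext h)
        rw [Function.update_of_ne (by rw [Ne, Fin.ext_iff]; simp; omega),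
          Function.update_of_ne (by rw [Ne, Fin.ext_iff]; simp; omega)]
      rw [key, key, key, ← add_mul]
      congr 1
      obtain h | h := Nat.mod_two_eq_zero_or_one k
      · have e1 : (⟨2 * ((k : ℕ) / 2), by omega⟩ : Fin (2 * n)) = k := Fin.ext (by simp; omega)
        have e2 : (⟨2 * ((k : ℕ) / 2) + 1, by omega⟩ : Fin (2 * n)) ≠ k := by
          rw [Ne, Fin.ext_iff]; simp; omega
        simp [e1, Function.update_of_ne e2]
      · have e1 : (⟨2 * ((k : ℕ) / 2) + 1, by omega⟩ : Fin (2 * n)) = k := Fin.ext (by simp; omega)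
        have e2 : (⟨2 * ((k : ℕ) / 2), by omega⟩ : Fin (2 * n)) ≠ k := by
          rw [Ne, Fin.ext_iff]; simp; omega
        simp [e1, Function.update_of_ne e2])
    (by
      intro v k c x
      have hk : (k : ℕ) / 2 < n := by omega
      rw [← Finset.mul_prod_erase _ _ (Finset.mem_univ ⟨(k : ℕ) / 2, hk⟩),
        ← Finset.mul_prod_erase _ _ (Finset.mem_univ ⟨(k : ℕ) / 2, hk⟩)]
      have key : ∀ z : V, ∏ i ∈ Finset.univ.erase (⟨(k : ℕ) / 2, hk⟩ : Fin n),
          ω (Function.update v k z ⟨2 * i, by omega⟩)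
            (Function.update v k z ⟨2 * i + 1, by omega⟩) =
          ∏ i ∈ Finset.univ.erase (⟨(k : ℕ) / 2, hk⟩ : Fin n),
            ω (v ⟨2 * i, by omega⟩) (v ⟨2 * i + 1, by omega⟩) := by
        intro z
        refine Finset.prod_congr rfl fun i hi => ?_
        have hi' : (i : ℕ) ≠ k / 2 := fun h => (Finset.mem_erase.1 hi).1 (Fin.ext h)
        rw [Function.update_of_ne (by rw [Ne, Fin.ext_iff]; simp; omega),
          Function.update_of_ne (by rw [Ne, Fin.ext_iff]; simp; omega)]
      rw [key, key, smul_eq_mul, ← mul_assoc]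
      congr 1
      obtain h | h := Nat.mod_two_eq_zero_or_one k
      · have e1 : (⟨2 * ((k : ℕ) / 2), by omega⟩ : Fin (2 * n)) = k := Fin.ext (by simp; omega)
        have e2 : (⟨2 * ((k : ℕ) / 2) + 1, by omega⟩ : Fin (2 * n)) ≠ k := by
          rw [Ne, Fin.ext_iff]; simp; omega
        simp [e1, Function.update_of_ne e2]
      · have e1 : (⟨2 * ((k : ℕ) / 2) + 1, by omega⟩ : Fin (2 * n)) = k := Fin.ext (by simp; omega)
        have e2 : (⟨2 * ((k : ℕ) / 2), by omega⟩ : Fin (2 * n)) ≠ k := by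
          rw [Ne, Fin.ext_iff]; simp; omega
        simp [e1, Function.update_of_ne e2])

/-- The alternating form `v ↦ Pf (ω (v i) (v j))`. -/
noncomputable def pfForm (ω : V →ₗ[ℂ] V →ₗ[ℂ] ℂ) (n : ℕ) : V [⋀^Fin (2 * n)]→ₗ[ℂ] ℂ :=
  (1 / ((2 : ℂ) ^ n * (n.factorial : ℂ))) • MultilinearMap.alternatization (pairProd ω n)

/-- `Pf (ω (u i) (u j))` for the first `2 n` terms of a sequence `u`. -/
noncomputable def pfSeq (ω : V →ₗ[ℂ] V →ₗ[ℂ] ℂ) (n : ℕ) (u : ℕ → V) : ℂ :=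
  pfForm ω n fun i => u i

lemma pfSeq_eq (ω : V →ₗ[ℂ] V →ₗ[ℂ] ℂ) (n : ℕ) (u : ℕ → V) :
    pfSeq ω n u = 1 / ((2 : ℂ) ^ n * (n.factorial : ℂ)) *
      ∑ σ : Equiv.Perm (Fin (2 * n)), ((Equiv.Perm.sign σ : ℤ) : ℂ) *
        ∏ i : Fin n, ω (u (σ ⟨2 * i, by omega⟩)) (u (σ ⟨2 * i + 1, by omega⟩)) := by
  simp only [pfSeq, pfForm, AlternatingMap.smul_apply, smul_eq_mul]
  rw [MultilinearMap.alternatization_apply]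
  congr 1
  refine Finset.sum_congr rfl fun σ _ => ?_
  simp [pairProd, Units.smul_def]

/-- Writing a matrix as a Gram matrix makes its Pfaffian alternating and multilinear in vectors: a
simultaneous row and column operation becomes an operation on one vector. -/
lemma pfaffian_eq_pfSeq (ω : V →ₗ[ℂ] V →ₗ[ℂ] ℂ) {m n : ℕ} (h : m = 2 * n)
    (A : Matrix (Fin m) (Fin m) ℂ) (u : ℕ → V) (hA : ∀ i j, A i j = ω (u i) (u j)) :
    pfaffian A = pfSeq ω n u := by
  subst h
  have hn : 2 * n / 2 = n := by omega
  rw [pfSeq_eq, pfaffian]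
  simp only [hn, hA]
  congr 1
  refine Finset.sum_congr rfl fun σ _ => ?_
  congr 1
  exact Fintype.prod_equiv (finCongr hn) _ _ fun i => by simp

/-- By skewness the entries above the diagonal determine the Pfaffian. The diagonal is never used,
since a permutation does not send both members of a pair to one index. -/
lemma pfSeq_congr {V' : Type*} [AddCommGroup V'] [Module ℂ V'] {ω : V →ₗ[ℂ] V →ₗ[ℂ] ℂ}
    {ω' : V' →ₗ[ℂ] V' →ₗ[ℂ] ℂ} (hω : ∀ x y, ω x y = -ω y x) (hω' : ∀ x y, ω' x y = -ω' y x)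
    {n : ℕ} {u : ℕ → V} {u' : ℕ → V'}
    (h : ∀ i j, i < j → j < 2 * n → ω (u i) (u j) = ω' (u' i) (u' j)) :
    pfSeq ω n u = pfSeq ω' n u' := by
  rw [pfSeq_eq, pfSeq_eq]
  congr 1
  refine Finset.sum_congr rfl fun σ _ => ?_
  congr 1
  refine Finset.prod_congr rfl fun i _ => ?_
  obtain hlt | heq | hgt := lt_trichotomy (σ ⟨2 * i, by omega⟩) (σ ⟨2 * i + 1, by omega⟩)
  · exact h _ _ hlt (Fin.is_lt _)
  · have := σ.injective heq
    rw [Fin.ext_iff] at this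
    simp at this
  · rw [hω, hω', h _ _ hgt (Fin.is_lt _)]

lemma pfSeq_update_add (ω : V →ₗ[ℂ] V →ₗ[ℂ] ℂ) (n : ℕ) (u : ℕ → V) {k : ℕ} (hk : k < 2 * n)
    (x y : V) : pfSeq ω n (Function.update u k (x + y)) =
      pfSeq ω n (Function.update u k x) + pfSeq ω n (Function.update u k y) := by
  have key : ∀ z, (fun i : Fin (2 * n) => Function.update u k z i) =
      Function.update (fun i : Fin (2 * n) => u i) ⟨k, hk⟩ z := by
    intro z; funext i
    by_cases hi : (i : ℕ) = k
    · have : i = ⟨k, hk⟩ := Fin.ext hi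
      subst this; simp
    · rw [Function.update_of_ne hi, Function.update_of_ne (by rwa [Ne, Fin.ext_iff])]
  simp only [pfSeq, key, AlternatingMap.map_update_add]

lemma pfSeq_update_smul (ω : V →ₗ[ℂ] V →ₗ[ℂ] ℂ) (n : ℕ) (u : ℕ → V) {k : ℕ} (hk : k < 2 * n)
    (c : ℂ) (x : V) : pfSeq ω n (Function.update u k (c • x)) =
      c * pfSeq ω n (Function.update u k x) := by
  have key : ∀ z, (fun i : Fin (2 * n) => Function.update u k z i) =
      Function.update (fun i : Fin (2 * n) => u i) ⟨k, hk⟩ z := by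
    intro z; funext i
    by_cases hi : (i : ℕ) = k
    · have : i = ⟨k, hk⟩ := Fin.ext hi
      subst this; simp
    · rw [Function.update_of_ne hi, Function.update_of_ne (by rwa [Ne, Fin.ext_iff])]
  simp only [pfSeq, key, AlternatingMap.map_update_smul, smul_eq_mul]

lemma pfSeq_eq_zero_of_eq (ω : V →ₗ[ℂ] V →ₗ[ℂ] ℂ) {n : ℕ} {u : ℕ → V} {i j : ℕ} (hij : i ≠ j)
    (hi : i < 2 * n) (hj : j < 2 * n) (h : u i = u j) : pfSeq ω n u = 0 :=
  AlternatingMap.map_eq_zero_of_eq _ _ (i := ⟨i, hi⟩) (j := ⟨j, hj⟩) h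
    (by rwa [Ne, Fin.ext_iff])

lemma pfSeq_congr_seq (ω : V →ₗ[ℂ] V →ₗ[ℂ] ℂ) {n : ℕ} {u u' : ℕ → V}
    (h : ∀ i < 2 * n, u i = u' i) : pfSeq ω n u = pfSeq ω n u' := by
  unfold pfSeq
  congr 1
  funext i
  exact h i i.2

lemma pfSeq_swap (ω : V →ₗ[ℂ] V →ₗ[ℂ] ℂ) {n : ℕ} {u : ℕ → V} {i j : ℕ} (hij : i ≠ j)
    (hi : i < 2 * n) (hj : j < 2 * n) : pfSeq ω n (u ∘ Equiv.swap i j) = -pfSeq ω n u := by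
  have := AlternatingMap.map_swap (pfForm ω n) (v := fun k : Fin (2 * n) => u k)
    (i := ⟨i, hi⟩) (j := ⟨j, hj⟩) (by rwa [Ne, Fin.ext_iff])
  rw [pfSeq, pfSeq, ← this]
  congr 1
  funext k
  simp only [Function.comp, Equiv.swap_apply_def, Fin.ext_iff]
  split_ifs <;> simp

/-- Move the term at position `q` to position `q + d`. -/
def moveTerm {X : Type*} (q d : ℕ) (u : ℕ → X) : ℕ → X := fun i =>
  if i < q then u i else if i < q + d then u (i + 1) else if i = q + d then u q else u i

/-- The move is a product of d adjacent transpositions. -/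
lemma pfSeq_moveTerm (ω : V →ₗ[ℂ] V →ₗ[ℂ] ℂ) {n : ℕ} (q : ℕ) :
    ∀ (d : ℕ) (u : ℕ → V), q + d < 2 * n → pfSeq ω n (moveTerm q d u) = (-1) ^ d * pfSeq ω n u
  | 0, u, _ => by
    rw [pow_zero, one_mul]
    congr 1
    funext i
    simp only [moveTerm]
    split_ifs with h1 h2 h3
    · rfl
    · omega
    · rw [h3]; rfl
    · rfl
  | d + 1, u, h => by
    have := pfSeq_moveTerm ω (n := n) q d u (by omega)
    rw [pow_succ, mul_comm ((-1 : ℂ) ^ d), mul_assoc, ← this, neg_one_mul,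
      ← pfSeq_swap ω (u := moveTerm q d u) (i := q + d) (j := q + d + 1) (by omega) (by omega) (by omega)]
    congr 1
    funext i
    simp only [moveTerm, Function.comp, Equiv.swap_apply_def]
    by_cases h1 : i = q + d
    · simp [h1]
    · by_cases h2 : i = q + d + 1
      · subst h2
        simp only [h1, if_false, if_true]
        have e3 : q + d + 1 = q + (d + 1) := by omega
        simp [e3]
      · simp only [h1, h2, if_false]
        by_cases h3 : i < q
        · simp [h3]
        · by_cases h4 : i < q + d
          · simp [h3, h4]; intro; omega
          · have h5 : ¬ i < q + (d + 1) := by omega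
            have h6 : ¬ i = q + (d + 1) := by omega
            simp [h3, h4, h5, h6]

/-- Gaussian elimination with pivot u k. The terms are modified one after another; c k = 0 keeps the
pivot intact, so each correction contains u k twice and drops out. -/
lemma pfSeq_add_multiples (ω : V →ₗ[ℂ] V →ₗ[ℂ] ℂ) {n : ℕ} {k : ℕ} (hk : k < 2 * n) (u : ℕ → V)
    (c : ℕ → ℂ) (hc : c k = 0) : pfSeq ω n (fun i => u i + c i • u k) = pfSeq ω n u := by
  have key : ∀ m, pfSeq ω n (fun i => if i < m then u i + c i • u k else u i) = pfSeq ω n u := by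
    intro m
    induction m with
    | zero => simp
    | succ m ih =>
      rw [← ih]
      set v : ℕ → V := fun i => if i < m then u i + c i • u k else u i with hv
      have hvk : v k = u k := by simp [hv, hc]
      by_cases hm : m < 2 * n
      · have e : (fun i => if i < m + 1 then u i + c i • u k else u i) =
            Function.update v m (u m + c m • u k) := by
          funext i
          by_cases him : i = m
          · simp [him]
          · rw [Function.update_of_ne him]
            have : i < m + 1 ↔ i < m := by omega
            simp [hv, this]
        have e' : Function.update v m (u m) = v := by
          conv_rhs => rw [← Function.update_eq_self m v]
          simp [hv]
        rw [e, pfSeq_update_add _ _ _ hm, pfSeq_update_smul _ _ _ hm, e']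
        by_cases hmk : m = k
        · rw [hmk, hc]; simp
        · rw [pfSeq_eq_zero_of_eq ω (u := Function.update v m (u k)) hmk hm hk, mul_zero, add_zero]
          rw [Function.update_self, Function.update_of_ne (Ne.symm hmk), hvk]
      · refine pfSeq_congr_seq ω fun i hi => ?_
        have h1 : i < m := by omega
        have h2 : i < m + 1 := by omega
        simp [hv, h1, h2]
  rw [← key (2 * n)]
  refine pfSeq_congr_seq ω fun i hi => ?_
  simp [hi]

end PfaffianForm
end HalfTASEP

namespace HalfTASEP
-- Expansion, vanishing and differentiation of Pfaffians
section PfaffianExpansion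

variable {V : Type*} [AddCommGroup V] [Module ℂ V]

/-- The summand of the Pfaffian of `ω (u i) (u j)` at the permutation `σ`. -/
noncomputable def pfTerm (ω : V →ₗ[ℂ] V →ₗ[ℂ] ℂ) (n : ℕ) (u : ℕ → V)
    (σ : Equiv.Perm (Fin (2 * n))) : ℂ :=
  ((Equiv.Perm.sign σ : ℤ) : ℂ) *
    ∏ i : Fin n, ω (u (σ ⟨2 * i, by omega⟩)) (u (σ ⟨2 * i + 1, by omega⟩))

lemma pfSeq_eq_sum_pfTerm (ω : V →ₗ[ℂ] V →ₗ[ℂ] ℂ) (n : ℕ) (u : ℕ → V) :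
    pfSeq ω n u = 1 / ((2 : ℂ) ^ n * (n.factorial : ℂ)) * ∑ σ, pfTerm ω n u σ :=
  pfSeq_eq ω n u

/-- Exchanging the two members of a pair changes both the sign of the permutation and, by skewness,
the sign of one factor. -/
lemma pfTerm_mul_swap {ω : V →ₗ[ℂ] V →ₗ[ℂ] ℂ} (hω : ∀ x y, ω x y = -ω y x) {n : ℕ} (u : ℕ → V)
    (σ : Equiv.Perm (Fin (2 * n))) (i : Fin n) :
    pfTerm ω n u (σ * Equiv.swap ⟨2 * i, by omega⟩ ⟨2 * i + 1, by omega⟩) = pfTerm ω n u σ := by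
  unfold pfTerm
  rw [Equiv.Perm.sign_mul, Equiv.Perm.sign_swap (by rw [Ne, Fin.ext_iff]; simp),
    ← Finset.mul_prod_erase _ _ (Finset.mem_univ i),
    ← Finset.mul_prod_erase Finset.univ (fun j : Fin n =>
      ω (u (σ ⟨2 * j, by omega⟩)) (u (σ ⟨2 * j + 1, by omega⟩))) (Finset.mem_univ i)]
  have : ∀ j ∈ Finset.univ.erase i,
      ω (u ((σ * Equiv.swap (⟨2 * i, by omega⟩ : Fin (2 * n)) ⟨2 * i + 1, by omega⟩)
        ⟨2 * j, by omega⟩))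
        (u ((σ * Equiv.swap (⟨2 * i, by omega⟩ : Fin (2 * n)) ⟨2 * i + 1, by omega⟩)
          ⟨2 * j + 1, by omega⟩)) =
      ω (u (σ ⟨2 * j, by omega⟩)) (u (σ ⟨2 * j + 1, by omega⟩)) := by
    intro j hj
    have hj' : (j : ℕ) ≠ i := fun h => (Finset.mem_erase.1 hj).1 (Fin.ext h)
    rw [Equiv.Perm.mul_apply, Equiv.Perm.mul_apply,
      Equiv.swap_apply_of_ne_of_ne (by rw [Ne, Fin.ext_iff]; simp; omega)
        (by rw [Ne, Fin.ext_iff]; simp; omega),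
      Equiv.swap_apply_of_ne_of_ne (by rw [Ne, Fin.ext_iff]; simp; omega)
        (by rw [Ne, Fin.ext_iff]; simp; omega)]
  rw [Finset.prod_congr rfl this, Equiv.Perm.mul_apply, Equiv.Perm.mul_apply,
    Equiv.swap_apply_left, Equiv.swap_apply_right, hω]
  push_cast
  ring

/-- The permutation exchanging the pairs `{0, 1}` and `{2 i, 2 i + 1}`. -/
def pairSwap {n : ℕ} (i j : Fin n) : Equiv.Perm (Fin (2 * n)) :=
  Equiv.swap ⟨2 * i, by omega⟩ ⟨2 * j, by omega⟩ *
    Equiv.swap ⟨2 * i + 1, by omega⟩ ⟨2 * j + 1, by omega⟩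

lemma pairSwap_even {n : ℕ} (i j l : Fin n) : pairSwap i j ⟨2 * l, by omega⟩ =
    ⟨2 * (Equiv.swap i j l : Fin n), by omega⟩ := by
  simp only [pairSwap, Equiv.Perm.mul_apply, Equiv.swap_apply_def, Fin.ext_iff]
  split_ifs <;> simp_all <;> omega

lemma pairSwap_odd {n : ℕ} (i j l : Fin n) : pairSwap i j ⟨2 * l + 1, by omega⟩ =
    ⟨2 * (Equiv.swap i j l : Fin n) + 1, by omega⟩ := by
  simp only [pairSwap, Equiv.Perm.mul_apply, Equiv.swap_apply_def, Fin.ext_iff]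
  split_ifs <;> simp_all <;> omega

lemma sign_pairSwap {n : ℕ} (i j : Fin n) : Equiv.Perm.sign (pairSwap i j) = 1 := by
  rw [pairSwap, Equiv.Perm.sign_mul]
  by_cases h : i = j
  · subst h; simp
  · have h' : (i : ℕ) ≠ j := fun e => h (Fin.ext e)
    rw [Equiv.Perm.sign_swap (by rw [Ne, Fin.ext_iff]; simp; omega),
      Equiv.Perm.sign_swap (by rw [Ne, Fin.ext_iff]; simp; omega)]
    rfl

lemma pfTerm_mul_pairSwap (ω : V →ₗ[ℂ] V →ₗ[ℂ] ℂ) {n : ℕ} (u : ℕ → V)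
    (σ : Equiv.Perm (Fin (2 * n))) (i j : Fin n) :
    pfTerm ω n u (σ * pairSwap i j) = pfTerm ω n u σ := by
  unfold pfTerm
  rw [Equiv.Perm.sign_mul, sign_pairSwap, mul_one]
  congr 1
  refine Fintype.prod_equiv (Equiv.swap i j) _ _ fun l => ?_
  rw [Equiv.Perm.mul_apply, Equiv.Perm.mul_apply, pairSwap_even, pairSwap_odd]

/-- Sort the permutations by the position k with σ k = 0. Right translation by τ carries the class
of k onto the class of 0 without changing T, so all m + 1 classes contribute equally. -/
lemma sum_perm_eq_card_mul_sum_fix {m : ℕ} (T : Equiv.Perm (Fin (m + 1)) → ℂ)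
    (h : ∀ k, ∃ τ : Equiv.Perm (Fin (m + 1)), τ 0 = k ∧ ∀ σ, T (σ * τ) = T σ) :
    ∑ σ, T σ = (m + 1 : ℕ) * ∑ σ, if σ 0 = 0 then T σ else 0 := by
  have h1 : ∀ σ : Equiv.Perm (Fin (m + 1)), T σ = ∑ k, if σ k = 0 then T σ else 0 := by
    intro σ
    rw [Finset.sum_eq_single (σ.symm 0)]
    · simp
    · intro k _ hk
      rw [if_neg]
      rintro h
      exact hk (by rw [← h]; simp)
    · simp
  calc ∑ σ, T σ = ∑ σ : Equiv.Perm (Fin (m + 1)), ∑ k, if σ k = 0 then T σ else 0 :=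
        Finset.sum_congr rfl fun σ _ => h1 σ
    _ = ∑ k : Fin (m + 1), ∑ σ : Equiv.Perm (Fin (m + 1)), if σ k = 0 then T σ else 0 :=
        Finset.sum_comm
    _ = ∑ k : Fin (m + 1), ∑ σ : Equiv.Perm (Fin (m + 1)), if σ 0 = 0 then T σ else 0 := by
        refine Finset.sum_congr rfl fun k _ => ?_
        obtain ⟨τ, hτ, hT⟩ := h k
        refine Fintype.sum_equiv (Equiv.mulRight τ) _ _ fun σ => ?_
        simp [hτ, hT]
    _ = _ := by simp

lemma sum_perm_fix_fix {m : ℕ} (T : Equiv.Perm (Fin (m + 2)) → ℂ)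
    (hT : ∀ σ, σ 0 = 0 → σ 1 ≠ 1 → T σ = 0) :
    (∑ σ : Equiv.Perm (Fin (m + 2)), if σ 0 = 0 then T σ else 0) =
      ∑ e : Equiv.Perm (Fin m),
        T (Equiv.Perm.decomposeFin.symm (0, Equiv.Perm.decomposeFin.symm (0, e))) := by
  rw [← Equiv.sum_comp Equiv.Perm.decomposeFin.symm, Fintype.sum_prod_type,
    Finset.sum_eq_single 0 _ (by simp)]
  · rw [← Equiv.sum_comp Equiv.Perm.decomposeFin.symm, Fintype.sum_prod_type,
      Finset.sum_eq_single 0 _ (by simp)]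
    · simp
    · intro p _ hp
      refine Finset.sum_eq_zero fun e _ => ?_
      split_ifs with h
      · refine hT _ h ?_
        rw [Equiv.Perm.decomposeFin_symm_apply_one]
        rw [Equiv.swap_self, Equiv.Perm.decomposeFin_symm_apply_zero, Equiv.refl_apply,
          ← Fin.succ_zero_eq_one]
        exact fun e => hp (Fin.succ_injective _ e)
      · rfl
  · intro p _ hp
    refine Finset.sum_eq_zero fun e _ => ?_
    rw [if_neg]
    simpa using hp

/-- The symmetries of the summands allow σ 0 = 0 at the cost of a factor 2n + 2, the ratio of the
normalizations 2^(n+1) (n+1)! and 2^n n!. The hypothesis then kills every term with σ 1 ≠ 1. -/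
lemma pfSeq_succ {ω : V →ₗ[ℂ] V →ₗ[ℂ] ℂ} (hω : ∀ x y, ω x y = -ω y x) {n : ℕ} (u : ℕ → V)
    (h : ∀ i, 2 ≤ i → i < 2 * (n + 1) → ω (u 0) (u i) = 0) :
    pfSeq ω (n + 1) u = ω (u 0) (u 1) * pfSeq ω n fun i => u (i + 2) := by
  rw [pfSeq_eq_sum_pfTerm, pfSeq_eq_sum_pfTerm]
  have h1 := sum_perm_eq_card_mul_sum_fix (m := 2 * n + 1) (pfTerm ω (n + 1) u) (by
    intro k
    obtain hk | hk := Nat.mod_two_eq_zero_or_one k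
    · refine ⟨pairSwap (n := n + 1) 0 ⟨k / 2, by omega⟩, ?_, fun σ => pfTerm_mul_pairSwap _ _ _ _ _⟩
      refine (pairSwap_even (n := n + 1) 0 ⟨k / 2, by omega⟩ 0).trans ?_
      exact Fin.ext (by simp [Equiv.swap_apply_left]; omega)
    · refine ⟨pairSwap (n := n + 1) 0 ⟨k / 2, by omega⟩ * Equiv.swap 0 1, ?_, fun σ => ?_⟩
      · rw [Equiv.Perm.mul_apply, Equiv.swap_apply_left]
        refine (pairSwap_odd (n := n + 1) 0 ⟨k / 2, by omega⟩ 0).trans ?_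
        exact Fin.ext (by simp [Equiv.swap_apply_left]; omega)
      · rw [← mul_assoc]
        exact (pfTerm_mul_swap hω u (n := n + 1) _ 0).trans (pfTerm_mul_pairSwap _ _ _ _ _))
  have h2 := sum_perm_fix_fix (m := 2 * n) (pfTerm ω (n + 1) u) (by
    intro σ h0 h1
    unfold pfTerm
    rw [Finset.prod_eq_zero (Finset.mem_univ (0 : Fin (n + 1))), mul_zero]
    have e0 : σ (⟨2 * ((0 : Fin (n + 1)) : ℕ), by simp⟩ : Fin (2 * n + 2)) = 0 := h0
    have e1 : σ (⟨2 * ((0 : Fin (n + 1)) : ℕ) + 1, by simp⟩ : Fin (2 * n + 2)) = σ 1 := rfl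
    have h0' : σ 1 ≠ 0 := fun e => by
      have := σ.injective (e.trans h0.symm)
      simp at this
    refine Eq.trans (congrArg₂ (fun a b : Fin (2 * n + 2) => ω (u a) (u b)) e0 e1) ?_
    refine h _ ?_ (Fin.is_lt _)
    have a0 : ((σ 1 : Fin (2 * n + 2)) : ℕ) ≠ 0 := fun e => h0' (Fin.ext e)
    have a1 : ((σ 1 : Fin (2 * n + 2)) : ℕ) ≠ 1 := fun e => h1 (Fin.ext e)
    clear * - a0 a1
    omega)
  have h3 : ∀ e : Equiv.Perm (Fin (2 * n)), pfTerm ω (n + 1) u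
      (Equiv.Perm.decomposeFin.symm (0, Equiv.Perm.decomposeFin.symm (0, e)) :
        Equiv.Perm (Fin (2 * n + 2))) = ω (u 0) (u 1) * pfTerm ω n (fun i => u (i + 2)) e := by
    intro e
    set σ : Equiv.Perm (Fin (2 * n + 2)) :=
      Equiv.Perm.decomposeFin.symm (0, Equiv.Perm.decomposeFin.symm (0, e)) with hσ
    have hs : Equiv.Perm.sign σ = Equiv.Perm.sign e := by
      rw [hσ, Equiv.Perm.decomposeFin.symm_sign, Equiv.Perm.decomposeFin.symm_sign]; simp
    unfold pfTerm
    refine Eq.trans (b := ((Equiv.Perm.sign σ : ℤ) : ℂ) * ∏ i : Fin (n + 1),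
      ω (u (σ (⟨2 * i, by omega⟩ : Fin (2 * n + 2))))
        (u (σ (⟨2 * i + 1, by omega⟩ : Fin (2 * n + 2))))) rfl ?_
    rw [hs, Fin.prod_univ_succ, mul_left_comm]
    congr 1
  have h4 : ∑ σ, pfTerm ω (n + 1) u σ = (2 * n + 2 : ℂ) * (ω (u 0) (u 1) *
      ∑ e, pfTerm ω n (fun i => u (i + 2)) e) := by
    refine h1.trans ?_
    rw [h2, Finset.sum_congr rfl fun e _ => h3 e, ← Finset.mul_sum]
    push_cast
    ring
  rw [h4, Nat.factorial_succ, pow_succ]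
  push_cast
  have : (n : ℂ) + 1 ≠ 0 := by exact_mod_cast Nat.succ_ne_zero n
  have h5 : (n.factorial : ℂ) ≠ 0 := by exact_mod_cast n.factorial_ne_zero
  field_simp

/-- Pigeonhole: more than n indices are distributed over n pairs, so every permutation puts two
indices of Z into the same pair, and that factor is zero. -/
lemma pfSeq_eq_zero_of_isotropic (ω : V →ₗ[ℂ] V →ₗ[ℂ] ℂ) {n : ℕ} (u : ℕ → V)
    (Z : Finset (Fin (2 * n))) (hZ : n < Z.card)
    (h : ∀ i ∈ Z, ∀ j ∈ Z, ω (u i) (u j) = 0) : pfSeq ω n u = 0 := by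
  rw [pfSeq_eq_sum_pfTerm, Finset.sum_eq_zero, mul_zero]
  intro σ _
  obtain ⟨a, ha, b, hb, hab, hf⟩ := Finset.exists_ne_map_eq_of_card_lt_of_maps_to
    (s := Z.map σ.symm.toEmbedding) (t := Finset.range n) (f := fun k => (k : ℕ) / 2)
    (by simpa using hZ) (by intro k _; simp; omega)
  simp only [Finset.mem_map_equiv, Equiv.symm_symm] at ha hb
  have hab' : (a : ℕ) ≠ b := fun e => hab (Fin.ext e)
  unfold pfTerm
  rw [Finset.prod_eq_zero (Finset.mem_univ (⟨(a : ℕ) / 2, by omega⟩ : Fin n)), mul_zero]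
  have key : ∀ c : Fin (2 * n), (c : ℕ) / 2 = a / 2 → σ c ∈ Z → ∀ d : Fin (2 * n),
      (d : ℕ) = c → σ d ∈ Z := by
    rintro c - hc d hd
    rwa [Fin.ext hd]
  refine h _ ?_ _ ?_
  · obtain h1 | h1 : (a : ℕ) = 2 * (a / 2) ∨ (b : ℕ) = 2 * (a / 2) := by omega
    · exact key a rfl ha _ h1.symm
    · exact key b hf.symm hb _ h1.symm
  · obtain h1 | h1 : (a : ℕ) = 2 * (a / 2) + 1 ∨ (b : ℕ) = 2 * (a / 2) + 1 := by omega
    · exact key a rfl ha _ h1.symm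
    · exact key b hf.symm hb _ h1.symm

/-- The product rule, with D as formal derivative of the vectors. Only the pairings are
differentiated, so V needs no topology. -/
lemma hasDerivAt_pfSeq {ω : V →ₗ[ℂ] V →ₗ[ℂ] ℂ} {n : ℕ} {u : ℝ → ℕ → V} {D : ℕ → V} {t : ℝ}
    (h : ∀ j k, HasDerivAt (fun s => ω (u s j) (u s k))
      (ω (D j) (u t k) + ω (u t j) (D k)) t) :
    HasDerivAt (fun s => pfSeq ω n (u s))
      (∑ j ∈ Finset.range (2 * n), pfSeq ω n (Function.update (u t) j (D j))) t := by
  have h1 : ∀ σ : Equiv.Perm (Fin (2 * n)), HasDerivAt (fun s => pfTerm ω n (u s) σ)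
      (∑ j : Fin (2 * n), pfTerm ω n (Function.update (u t) j (D j)) σ) t := by
    intro σ
    have h2 := (HasDerivAt.fun_finsetProd (u := Finset.univ) (fun (i : Fin n) _ =>
      h (σ ⟨2 * i, by omega⟩) (σ ⟨2 * i + 1, by omega⟩))).const_mul
        ((Equiv.Perm.sign σ : ℤ) : ℂ)
    refine h2.congr_deriv ?_
    -- The updated index is written as σ of the first or second member of the i-th pair; it then
    -- affects only the i-th factor.
    rw [← Equiv.sum_comp σ, ← Equiv.sum_comp (finProdFinEquiv.trans (finCongr (mul_comm n 2))),
      Fintype.sum_prod_type, Finset.mul_sum]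
    refine Finset.sum_congr rfl fun i _ => ?_
    rw [Fin.sum_univ_two]
    have ev : ∀ j : Fin 2, finProdFinEquiv.trans (finCongr (mul_comm n 2)) (i, j) =
      (⟨2 * i + j, by omega⟩ : Fin (2 * n)) := by
      intro j; ext; simp; omega
    rw [ev, ev]
    simp only [pfTerm]
    rw [← Finset.mul_prod_erase _ _ (Finset.mem_univ i),
      ← Finset.mul_prod_erase Finset.univ (fun j : Fin n =>
        ω (Function.update (u t) _ _ (σ ⟨2 * j, by omega⟩)) _) (Finset.mem_univ i)]
    have hne : ∀ a b : Fin (2 * n), (a : ℕ) ≠ b → ((σ a : Fin (2 * n)) : ℕ) ≠ σ b := by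
      intro a b hab e
      exact hab (congrArg Fin.val (σ.injective (Fin.ext e)))
    have hP : ∀ (k : Fin 2) (z : V), ∏ j ∈ Finset.univ.erase i,
        ω (Function.update (u t) (σ ⟨2 * i + k, by omega⟩) z (σ ⟨2 * j, by omega⟩))
          (Function.update (u t) (σ ⟨2 * i + k, by omega⟩) z (σ ⟨2 * j + 1, by omega⟩)) =
        ∏ j ∈ Finset.univ.erase i,
          ω (u t (σ ⟨2 * j, by omega⟩)) (u t (σ ⟨2 * j + 1, by omega⟩)) := by
      intro k z
      refine Finset.prod_congr rfl fun j hj => ?_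
      have hj' : (j : ℕ) ≠ i := fun h => (Finset.mem_erase.1 hj).1 (Fin.ext h)
      rw [Function.update_of_ne (hne _ _ (by simp; omega)),
        Function.update_of_ne (hne _ _ (by simp; omega))]
    rw [hP, hP, smul_eq_mul]
    have e0 : (⟨2 * i + ((0 : Fin 2) : ℕ), by omega⟩ : Fin (2 * n)) = ⟨2 * i, by omega⟩ := rfl
    have e1 : (⟨2 * i + ((1 : Fin 2) : ℕ), by omega⟩ : Fin (2 * n)) =
      ⟨2 * i + 1, by omega⟩ := rfl
    rw [e0, e1, Function.update_self, Function.update_self,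
      Function.update_of_ne (hne _ _ (by simp)), Function.update_of_ne (hne _ _ (by simp))]
    ring
  simp only [pfSeq_eq_sum_pfTerm]
  have h3 := (HasDerivAt.fun_sum (u := Finset.univ) fun σ _ => h1 σ).const_mul
    (1 / ((2 : ℂ) ^ n * (n.factorial : ℂ)))
  refine h3.congr_deriv ?_
  rw [Finset.sum_range (f := fun j => 1 / ((2 : ℂ) ^ n * (n.factorial : ℂ)) *
    ∑ σ, pfTerm ω n (Function.update (u t) j (D j)) σ), ← Finset.mul_sum, Finset.sum_comm]

end PfaffianExpansion
end HalfTASEP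

namespace HalfTASEP
-- Bordered Pfaffians and the row operations at the wall
section BorderedForm

variable {F : Type*} [AddCommGroup F] [Module ℂ F]

/-- The skew form `((f, φ), (g, ψ)) ↦ B f g + ψ f - φ g` on `F × F*`. -/
noncomputable def extForm (B : F →ₗ[ℂ] F →ₗ[ℂ] ℂ) :
    (F × Module.Dual ℂ F) →ₗ[ℂ] (F × Module.Dual ℂ F) →ₗ[ℂ] ℂ :=
  LinearMap.mk₂ ℂ (fun x y => B x.1 y.1 + y.2 x.1 - x.2 y.1)
    (fun x x' y => by simp; ring) (fun c x y => by simp; ring)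
    (fun x y y' => by simp; ring) (fun c x y => by simp; ring)

lemma extForm_apply (B : F →ₗ[ℂ] F →ₗ[ℂ] ℂ) (x y : F × Module.Dual ℂ F) :
    extForm B x y = B x.1 y.1 + y.2 x.1 - x.2 y.1 := rfl

lemma extForm_skew {B : F →ₗ[ℂ] F →ₗ[ℂ] ℂ} (hB : ∀ f g, B f g = -B g f)
    (x y : F × Module.Dual ℂ F) : extForm B x y = -extForm B y x := by
  rw [extForm_apply, extForm_apply, hB]; ring

/-- Prepend a term to a sequence. -/
def consSeq {X : Type*} (a : X) (u : ℕ → X) : ℕ → X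
  | 0 => a
  | k + 1 => u k

/-- The sequence `f 0, …, f (N - 1), φ 0, φ 1, …`. -/
noncomputable def rowSeq (N : ℕ) (f : ℕ → F) (φ : ℕ → Module.Dual ℂ F) :
    ℕ → F × Module.Dual ℂ F := fun i => if i < N then (f i, 0) else (0, φ (i - N))

lemma rowSeq_of_lt {N i : ℕ} (f : ℕ → F) (φ : ℕ → Module.Dual ℂ F) (h : i < N) :
    rowSeq N f φ i = (f i, 0) := if_pos h

lemma rowSeq_of_ge {N i : ℕ} (f : ℕ → F) (φ : ℕ → Module.Dual ℂ F) (h : N ≤ i) :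
    rowSeq N f φ i = (0, φ (i - N)) := if_neg (not_lt.2 h)

/-- The Pfaffian of the block matrix with entries `B (f i) (f j)`, `φ k (f i)` and `0`. -/
noncomputable def pfRow (B : F →ₗ[ℂ] F →ₗ[ℂ] ℂ) (n N : ℕ) (f : ℕ → F)
    (φ : ℕ → Module.Dual ℂ F) : ℂ := pfSeq (extForm B) n (rowSeq N f φ)

lemma pfSeq_eq_zero_of_row {V : Type*} [AddCommGroup V] [Module ℂ V] {ω : V →ₗ[ℂ] V →ₗ[ℂ] ℂ}
    (hω : ∀ x y, ω x y = -ω y x) {n : ℕ} {u : ℕ → V} {k : ℕ} (hk : k < 2 * n)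
    (h : ∀ j < 2 * n, j ≠ k → ω (u k) (u j) = 0) : pfSeq ω n u = 0 := by
  have : pfSeq ω n u = pfSeq ω n (Function.update u k ((0 : ℂ) • (0 : V))) := by
    refine pfSeq_congr hω hω fun i j hij hj => ?_
    by_cases hi : i = k
    · subst hi; simp [h j hj (by omega)]
    · by_cases hj' : j = k
      · subst hj'
        rw [hω, h i (by omega) hi]; simp
      · rw [Function.update_of_ne hi, Function.update_of_ne hj']
  rw [this, pfSeq_update_smul _ _ _ hk, zero_mul]

/-- Replacing g i by g i - P (g i) • h removes the rank-two term from the Gram matrix and leaves B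
(g' i) (g' j). The pairing of a row with h is c² P (g' i), so h now plays the role of c times the
border functional c • P. Moving h behind the N rows costs (-1)^N. -/
lemma pfRow_cons_eq_of_shift {B : F →ₗ[ℂ] F →ₗ[ℂ] ℂ} (hB : ∀ f g, B f g = -B g f)
    {n N M : ℕ} (hn : 2 * n = N + 1 + M) {h : F} {g g' : ℕ → F} {P : Module.Dual ℂ F}
    {φ φ' : ℕ → Module.Dual ℂ F} {c : ℂ}
    (hgh : ∀ i < N, B (g i) h = c ^ 2 * P (g' i))
    (hgg : ∀ i < N, ∀ j < N, B (g i) (g j) =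
      B (g' i) (g' j) - c ^ 2 * (P (g i) * P (g' j) - P (g' i) * P (g j)))
    (hφ : ∀ k < M, ∀ i < N, φ k (g i) = φ' k (g' i)) (hφh : ∀ k < M, φ k h = 0) :
    pfRow B n (N + 1) (consSeq h g) φ = (-1) ^ N * c * pfRow B n N g' (consSeq (c • P) φ') := by
  have hω := extForm_skew hB
  have hhh : B h h = 0 := self_eq_neg.1 (hB h h)
  have hhg : ∀ i < N, B h (g i) = -(c ^ 2 * P (g' i)) := fun i hi => by rw [hB, hgh i hi]
  set u := rowSeq (N + 1) (consSeq h g) φ with hu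
  set v := moveTerm 0 N u with hv
  have hv1 : ∀ i < N, v i = (g i, 0) := fun i hi => by
    simp [hv, moveTerm, hi, hu, rowSeq, consSeq]
  have hv2 : v N = (h, 0) := by simp [hv, moveTerm, hu, rowSeq, consSeq]
  have hv3 : ∀ i, N < i → v i = (0, φ (i - (N + 1))) := fun i hi => by
    rw [hv]; unfold moveTerm
    rw [if_neg (by omega), if_neg (by omega), if_neg (by omega), hu, rowSeq_of_ge _ _ (by omega)]
  have e1 : pfSeq (extForm B) n v = (-1) ^ N * pfSeq (extForm B) n u :=
    pfSeq_moveTerm _ 0 N u (by omega)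
  have e2 : pfSeq (extForm B) n u = (-1) ^ N * pfSeq (extForm B) n v := by
    rw [e1, ← mul_assoc, ← mul_pow]; simp
  set r := rowSeq N g' (consSeq (c • P) φ') with hr
  have hr1 : ∀ i < N, r i = (g' i, 0) := fun i hi => rowSeq_of_lt _ _ hi
  have hr2 : r N = (0, c • P) := by simp [hr, rowSeq, consSeq]
  have hr3 : ∀ i, N < i → r i = (0, φ' (i - (N + 1))) := fun i hi => by
    rw [hr, rowSeq_of_ge _ _ hi.le]
    obtain ⟨k, rfl⟩ := Nat.exists_eq_add_of_lt hi
    rw [show N + k + 1 - N = k + 1 by omega, show N + k + 1 - (N + 1) = k by omega]; rfl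
  have e3 : pfSeq (extForm B) n v = c * pfSeq (extForm B) n r := by
    have hrr : r = Function.update r N (0, c • P) := by rw [← hr2, Function.update_eq_self]
    rw [hrr, ← pfSeq_update_smul _ _ _ (by omega),
      ← pfSeq_add_multiples _ (k := N) (by omega) v (fun i => if i < N then -P (g i) else 0)
        (by simp)]
    -- The entries agree block by block: rows with rows, rows with h, and the pairings with the
    -- remaining functionals, which h does not see.
    refine pfSeq_congr hω hω fun i j hij hj => ?_
    rw [hv2]
    obtain hiN | rfl | hiN := lt_trichotomy i N
    · obtain hjN | rfl | hjN := lt_trichotomy j N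
      · rw [Function.update_of_ne (by omega), Function.update_of_ne (by omega), hv1 _ hiN,
          hv1 _ hjN, hr1 _ hiN, hr1 _ hjN]
        simp [extForm_apply, hiN, hjN, hgg i hiN j hjN, hgh i hiN, hhg j hjN, hhh]
        ring
      · rw [Function.update_of_ne (by omega), Function.update_self, hv1 _ hiN, hv2, hr1 _ hiN]
        simp [extForm_apply, hiN, hgh i hiN, hhh]
        ring
      · rw [Function.update_of_ne (by omega), Function.update_of_ne (by omega), hv1 _ hiN,
          hv3 _ hjN, hr1 _ hiN, hr3 _ hjN]
        have : ¬ j < N := by omega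
        simp [extForm_apply, hiN, this, hφ (j - (N + 1)) (by omega) i hiN,
          hφh (j - (N + 1)) (by omega)]
    · rw [Function.update_self, Function.update_of_ne (by omega), hv2, hv3 _ hij, hr3 _ hij]
      have : ¬ j < i := by omega
      simp [extForm_apply, this, hφh (j - (i + 1)) (by omega)]
    · rw [Function.update_of_ne (by omega), Function.update_of_ne (by omega), hv3 _ hiN,
        hv3 _ (by omega), hr3 _ hiN, hr3 _ (by omega)]
      have h1 : ¬ j < N := by omega
      have h2 : ¬ i < N := by omega
      simp [extForm_apply, h1, h2]
  rw [pfRow, pfRow, ← hu, e2, e3, mul_assoc]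

/-- Here the border c • P is already present and pairs with h to c. Adding c P (g' i) times the
border to row i makes the row orthogonal to h and at the same time cancels the rank-two term. Then h
pairs with the border alone, and `pfSeq_succ` removes both. -/
lemma pfRow_cons_cons_eq_of_shift {B : F →ₗ[ℂ] F →ₗ[ℂ] ℂ} (hB : ∀ f g, B f g = -B g f)
    {n N M : ℕ} (hn : 2 * n = N + M) {h : F} {g g' : ℕ → F} {P : Module.Dual ℂ F}
    {φ φ' : ℕ → Module.Dual ℂ F} {c : ℂ}
    (hgh : ∀ i < N, B (g i) h = c ^ 2 * P (g' i))
    (hgg : ∀ i < N, ∀ j < N, B (g i) (g j) =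
      B (g' i) (g' j) - c ^ 2 * (P (g i) * P (g' j) - P (g' i) * P (g j)))
    (hφ : ∀ k < M, ∀ i < N, φ k (g i) = φ' k (g' i)) (hφh : ∀ k < M, φ k h = 0)
    (hPh : P h = 1) :
    pfRow B (n + 1) (N + 1) (consSeq h g) (consSeq (c • P) φ) =
      (-1) ^ N * c * pfRow B n N g' φ' := by
  have hω := extForm_skew hB
  have hhg : ∀ i < N, B h (g i) = -(c ^ 2 * P (g' i)) := fun i hi => by rw [hB, hgh i hi]
  set u := rowSeq (N + 1) (consSeq h g) (consSeq (c • P) φ) with hu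
  set w : ℕ → F × Module.Dual ℂ F := consSeq (h, 0) (consSeq (0, c • P)
    fun i => if i < N then (g i, (c * P (g' i)) • c • P) else (0, φ (i - N))) with hw
  have e1 : pfSeq (extForm B) (n + 1) u = pfSeq (extForm B) (n + 1) (moveTerm 1 N w) := by
    rw [← pfSeq_add_multiples _ (k := N + 1) (by omega) u
      (fun i => if i < N + 1 then (if i = 0 then 0 else c * P (g' (i - 1))) else 0) (by simp)]
    refine pfSeq_congr_seq _ fun i _ => ?_
    have huN : u (N + 1) = (0, c • P) := by simp [hu, rowSeq, consSeq]
    rw [huN]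
    obtain rfl | hi0 := Nat.eq_zero_or_pos i
    · simp [hu, rowSeq, consSeq, moveTerm, hw]
    · obtain ⟨k, rfl⟩ : ∃ k, i = k + 1 := ⟨i - 1, by omega⟩
      obtain hk | rfl | hk := lt_trichotomy k N
      · have h1 : k + 1 < 1 + N := by omega
        simp [hu, rowSeq, consSeq, moveTerm, hw, hk, h1]
      · have h1 : ¬ k + 1 < 1 + k := by omega
        have h2 : k + 1 = 1 + k := by omega
        simp [hu, rowSeq, consSeq, moveTerm, hw, h2]
      · obtain ⟨l, rfl⟩ := Nat.exists_eq_add_of_lt hk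
        have h1 : ¬ N + l + 1 + 1 < 1 + N := by omega
        have h2 : ¬ N + l + 1 + 1 = 1 + N := by omega
        have h3 : N + l + 1 + 1 - (N + 1) = l + 1 := by omega
        have h4 : ¬ N + l < N := by omega
        have h5 : ¬ N + l + 1 < N := by omega
        simp [hu, rowSeq, consSeq, moveTerm, hw, h1, h2, h3, h5]
  rw [pfRow, ← hu, e1, pfSeq_moveTerm _ _ _ _ (by omega), pfSeq_succ hω]
  · rw [mul_assoc]
    congr 1
    congr 1
    · simp [hw, consSeq, extForm_apply, hPh]
    · refine pfSeq_congr hω hω fun i j hij hj => ?_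
      by_cases hiN : i < N
      · by_cases hjN : j < N
        · simp [hw, consSeq, hiN, hjN, extForm_apply, rowSeq, hgg i hiN j hjN]
          ring
        · simp [hw, consSeq, hiN, hjN, extForm_apply, rowSeq, hφ (j - N) (by omega) i hiN]
      · have hjN : ¬ j < N := by omega
        simp [hw, consSeq, hiN, hjN, extForm_apply, rowSeq]
  · intro i hi hi'
    obtain ⟨k, rfl⟩ : ∃ k, i = k + 2 := ⟨i - 2, by omega⟩
    by_cases hk : k < N
    · simp [hw, consSeq, hk, extForm_apply, hhg k hk, hPh]
      ring
    · simp [hw, consSeq, hk, extForm_apply, hφh (k - N) (by omega)]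

/-- The last row pairs only with the last functional. Bringing the two to the front takes N and 2N
transpositions, whence the sign (-1)^N. -/
lemma pfRow_succ_of_isotropic {B : F →ₗ[ℂ] F →ₗ[ℂ] ℂ} (hB : ∀ f g, B f g = -B g f)
    {N : ℕ} {f : ℕ → F} {φ : ℕ → Module.Dual ℂ F}
    (hf : ∀ i < N, B (f N) (f i) = 0) (hφ : ∀ k < N, φ k (f N) = 0) :
    pfRow B (N + 1) (N + 1) f φ = (-1) ^ N * φ N (f N) * pfRow B N N f φ := by
  have hω := extForm_skew hB
  set w : ℕ → F × Module.Dual ℂ F := consSeq (f N, 0) (consSeq (0, φ N) (rowSeq N f φ)) with hw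
  have e1 : pfRow B (N + 1) (N + 1) f φ =
      pfSeq (extForm B) (N + 1) (moveTerm 0 N (moveTerm 1 (2 * N) w)) := by
    refine pfSeq_congr_seq _ fun i hi => ?_
    obtain h | rfl | h := lt_trichotomy i N
    · rw [rowSeq_of_lt _ _ (by omega)]
      simp only [moveTerm]
      rw [if_neg (by omega), if_pos (by omega), if_neg (by omega), if_pos (by omega)]
      simp [hw, consSeq, rowSeq, h]
    · simp [rowSeq, moveTerm, hw, consSeq]
    · rw [rowSeq_of_ge _ _ (by omega)]
      simp only [moveTerm]
      rw [if_neg (by omega), if_neg (by omega), if_neg (by omega), if_neg (by omega)]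
      by_cases h2 : i < 1 + 2 * N
      · rw [if_pos h2]
        obtain ⟨l, rfl⟩ := Nat.exists_eq_add_of_lt h
        have h4 : ¬ N + l < N := by omega
        have h5 : N + l + 1 - (N + 1) = l := by omega
        simp [hw, consSeq, rowSeq, h5]
      · rw [if_neg h2, if_pos (by omega)]
        have h5 : i - (N + 1) = N := by omega
        simp [hw, consSeq, h5]
  rw [e1, pfSeq_moveTerm _ _ _ _ (by omega), pfSeq_moveTerm _ _ _ _ (by omega), pfSeq_succ hω]
  · rw [pow_mul]
    simp [hw, consSeq, extForm_apply, pfRow, mul_assoc]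
  · intro i hi hi'
    obtain ⟨k, rfl⟩ : ∃ k, i = k + 2 := ⟨i - 2, by omega⟩
    by_cases hk : k < N
    · simp [hw, consSeq, rowSeq, hk, extForm_apply, hf k hk]
    · simp [hw, consSeq, rowSeq, hk, extForm_apply, hφ (k - N) (by omega)]

end BorderedForm
end HalfTASEP

namespace HalfTASEP
-- From the first-jump decomposition to the forward equation
section JumpChain

/-- The configuration obtained when the particle at site `s + 1` moves back to `s`. -/
def hopBack (x : Config) (s : ℕ+) : Config := insert s (x.erase (s + 1))

/-- `∑_{z ≠ x} f z * (rate of the jump z → x)`; the sum is over the sites `s` which are empty in `x`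
while `s + 1` is occupied. -/
noncomputable def predSum (α : ℝ) (f : Config → ℝ) (x : Config) : ℝ :=
  (if 1 ∈ x then α * f (x.erase 1) else 0) +
    ∑ s ∈ x.image (fun s => s - 1) with s + 1 ∈ x ∧ s ∉ x, f (hopBack x s)

lemma jumpSum_add (α : ℝ) (f g : Config → ℝ) (y : Config) :
    jumpSum α (fun z => f z + g z) y = jumpSum α f y + jumpSum α g y := by
  unfold jumpSum
  rw [Finset.sum_add_distrib]
  split_ifs <;> ring

lemma jumpSum_mul_left (α c : ℝ) (f : Config → ℝ) (y : Config) :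
    jumpSum α (fun z => c * f z) y = c * jumpSum α f y := by
  unfold jumpSum
  rw [mul_add, Finset.mul_sum]
  split_ifs <;> ring

lemma jumpSum_sub (α : ℝ) (f g : Config → ℝ) (y : Config) :
    jumpSum α (fun z => f z - g z) y = jumpSum α f y - jumpSum α g y := by
  unfold jumpSum
  rw [Finset.sum_sub_distrib]
  split_ifs <;> ring

lemma predSum_sub (α : ℝ) (f g : Config → ℝ) (y : Config) :
    predSum α (fun z => f z - g z) y = predSum α f y - predSum α g y := by
  unfold predSum
  rw [Finset.sum_sub_distrib]
  split_ifs <;> ring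

lemma predSum_mul_left (α c : ℝ) (f : Config → ℝ) (y : Config) :
    predSum α (fun z => c * f z) y = c * predSum α f y := by
  unfold predSum
  rw [mul_add, Finset.mul_sum]
  split_ifs <;> ring

lemma jumpSum_sum (α : ℝ) {ι : Type*} (S : Finset ι) (f : ι → Config → ℝ) (y : Config) :
    jumpSum α (fun z => ∑ i ∈ S, f i z) y = ∑ i ∈ S, jumpSum α (f i) y := by
  classical
  induction S using Finset.induction_on with
  | empty => simp [jumpSum]
  | insert a S ha ih => simp only [Finset.sum_insert ha, jumpSum_add, ih]

/-- The two operators are finite linear combinations acting on different variables, the starting and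
the final configuration. -/
lemma jumpSum_predSum_comm (α : ℝ) (f : Config → Config → ℝ) (y x : Config) :
    jumpSum α (fun z => predSum α (f z) x) y = predSum α (fun w => jumpSum α (fun z => f z w) y) x := by
  unfold predSum
  rw [jumpSum_add, jumpSum_sum]
  congr 1
  split_ifs
  · rw [jumpSum_mul_left]
  · simp [jumpSum]

lemma hasDerivAt_jumpSum {α : ℝ} {f : ℝ → Config → ℝ} {f' : Config → ℝ} {t : ℝ}
    (h : ∀ z, HasDerivAt (fun s => f s z) (f' z) t) (y : Config) :
    HasDerivAt (fun s => jumpSum α (f s) y) (jumpSum α f' y) t := by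
  unfold jumpSum
  refine HasDerivAt.add ?_ (HasDerivAt.fun_sum fun s _ => h _)
  split_ifs
  · exact hasDerivAt_const _ _
  · exact (h _).const_mul _

lemma hasDerivAt_predSum {α : ℝ} {f : ℝ → Config → ℝ} {f' : Config → ℝ} {t : ℝ}
    (h : ∀ z, HasDerivAt (fun s => f s z) (f' z) t) (y : Config) :
    HasDerivAt (fun s => predSum α (f s) y) (predSum α f' y) t := by
  unfold predSum
  refine HasDerivAt.add ?_ (HasDerivAt.fun_sum fun s _ => h _)
  split_ifs
  · exact (h _).const_mul _
  · exact hasDerivAt_const _ _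

lemma eq_hopBack_iff {x y : Config} {s : ℕ+} :
    (s ∈ y ∧ s + 1 ∉ y ∧ hop y s = x) ↔ (s + 1 ∈ x ∧ s ∉ x ∧ y = hopBack x s) := by
  have hs : s ≠ s + 1 := (PNat.lt_add_right s 1).ne
  constructor
  · rintro ⟨h1, h2, rfl⟩
    refine ⟨by simp [hop], by simp [hop, hs], ?_⟩
    ext a
    simp only [hopBack, hop, Finset.mem_insert, Finset.mem_erase]
    by_cases ha : a = s
    · subst ha; simp [h1]
    · by_cases hb : a = s + 1
      · subst hb; simp [h2, hs.symm]
      · simp [ha, hb]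
  · rintro ⟨h1, h2, rfl⟩
    refine ⟨by simp [hopBack], by simp [hopBack, hs.symm], ?_⟩
    ext a
    simp only [hopBack, hop, Finset.mem_insert, Finset.mem_erase]
    by_cases ha : a = s + 1
    · subst ha; simp [h1]
    · by_cases hb : a = s
      · subst hb; simp [h2, ha]
      · simp [ha, hb]

lemma pnat_add_sub_one (s : ℕ+) : s + 1 - 1 = s := by
  rw [← PNat.coe_inj, PNat.sub_coe, if_pos (by simp)]
  simp

/-- Adjointness of the two operators, tested on point masses: both sides carry the rate of the jump
y → x. It is the base case of `jumpProb_forward`. -/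
lemma jumpSum_single (α : ℝ) (c : Config → ℝ) (y x : Config) :
    jumpSum α (fun z => if z = x then c z else 0) y =
      c x * predSum α (fun z => if y = z then 1 else 0) x := by
  unfold jumpSum predSum
  rw [mul_add]
  congr 1
  · by_cases h1 : (1 : ℕ+) ∈ y
    · have h3 : y ≠ x.erase 1 := fun h3 => by rw [h3] at h1; simp at h1
      simp [h1, h3]
    · by_cases h : insert 1 y = x
      · subst h
        simp [h1]
        ring
      · have h3 : 1 ∈ x → y ≠ x.erase 1 := fun h2 h3 => h (by rw [h3, Finset.insert_erase h2])
        by_cases h2 : (1 : ℕ+) ∈ x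
        · simp [h1, h, h3 h2]
        · simp [h1, h, h2]
  · rw [Finset.mul_sum]
    have e1 : ∑ s ∈ y with s + 1 ∉ y, (if hop y s = x then c (hop y s) else 0) =
        ∑ s ∈ y with s + 1 ∉ y ∧ hop y s = x, c x := by
      rw [← Finset.sum_filter, Finset.filter_filter]
      refine Finset.sum_congr rfl fun s hs => ?_
      rw [(Finset.mem_filter.1 hs).2.2]
    have e2 : ∑ s ∈ x.image (fun s => s - 1) with s + 1 ∈ x ∧ s ∉ x,
        c x * (if y = hopBack x s then 1 else 0) =
        ∑ s ∈ x.image (fun s => s - 1) with (s + 1 ∈ x ∧ s ∉ x) ∧ y = hopBack x s, c x := by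
      simp only [mul_ite, mul_one, mul_zero]
      rw [← Finset.sum_filter, Finset.filter_filter]
    rw [e1, e2]
    refine Finset.sum_congr ?_ fun _ _ => rfl
    ext s
    simp only [Finset.mem_filter, Finset.mem_image, and_assoc]
    rw [eq_hopBack_iff]
    refine ⟨fun h => ⟨⟨s + 1, h.1, pnat_add_sub_one s⟩, h⟩, fun h => h.2⟩

lemma hasDerivAt_exp_neg_mul (c t : ℝ) :
    HasDerivAt (fun s => Real.exp (-(c * s))) (-(c * Real.exp (-(c * t)))) t := by
  have h : HasDerivAt (fun s => -(c * s)) (-c) t := by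
    simpa using ((hasDerivAt_id t).const_mul c).fun_neg
  exact h.exp.congr_deriv (by ring)

lemma hasDerivAt_jumpProb_zero (α t : ℝ) (y x : Config) :
    HasDerivAt (fun s => jumpProb α 0 s y x) (-(exitRate α y * jumpProb α 0 t y x)) t := by
  simp only [jumpProb]
  split_ifs
  · exact hasDerivAt_exp_neg_mul _ _
  · simpa using hasDerivAt_const t (0 : ℝ)

/-- The substitution s ↦ t - s takes t out of the integrand, so the fundamental theorem of calculus
applies. -/
lemma jumpProb_succ_eq (α : ℝ) (n : ℕ) (t : ℝ) (y x : Config) :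
    jumpProb α (n + 1) t y x = Real.exp (-(exitRate α y * t)) *
      ∫ s in (0 : ℝ)..t, Real.exp (exitRate α y * s) *
        jumpSum α (fun z => jumpProb α n s z x) y := by
  have h := intervalIntegral.integral_comp_sub_left (a := 0) (b := t)
    (fun s => Real.exp (-(exitRate α y * (t - s))) * jumpSum α (fun z => jumpProb α n s z x) y) t
  simp only [sub_sub_cancel, sub_zero, sub_self] at h
  rw [jumpProb, h, ← intervalIntegral.integral_const_mul]
  congr 1
  funext s
  rw [← mul_assoc, ← Real.exp_add]
  congr 2
  ring

lemma hasDerivAt_jumpProb_succ_of_continuous {α : ℝ} {n : ℕ} {x : Config}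
    (hc : ∀ z, Continuous fun s => jumpProb α n s z x) (t : ℝ) (y : Config) :
    HasDerivAt (fun s => jumpProb α (n + 1) s y x)
      (jumpSum α (fun z => jumpProb α n t z x) y - exitRate α y * jumpProb α (n + 1) t y x) t := by
  have hJ : Continuous fun s => Real.exp (exitRate α y * s) *
      jumpSum α (fun z => jumpProb α n s z x) y := by
    refine (by fun_prop : Continuous fun s => Real.exp (exitRate α y * s)).mul ?_
    unfold jumpSum
    refine Continuous.add ?_ (continuous_finsetSum _ fun s _ => hc _)
    split_ifs
    · exact continuous_const
    · exact (hc _).const_mul _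
  simp only [jumpProb_succ_eq α n]
  have h1 := intervalIntegral.integral_hasDerivAt_right (hJ.intervalIntegrable 0 t)
    hJ.stronglyMeasurable.stronglyMeasurableAtFilter hJ.continuousAt
  refine ((hasDerivAt_exp_neg_mul (exitRate α y) t).mul h1).congr_deriv ?_
  have : Real.exp (-(exitRate α y * t)) * Real.exp (exitRate α y * t) = 1 := by
    rw [← Real.exp_add]; simp
  linear_combination jumpSum α (fun z => jumpProb α n t z x) y * this

lemma continuous_jumpProb (α : ℝ) : ∀ (n : ℕ) (y x : Config),
    Continuous fun s => jumpProb α n s y x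
  | 0, y, x => continuous_iff_continuousAt.2 fun t => (hasDerivAt_jumpProb_zero α t y x).continuousAt
  | n + 1, y, x => continuous_iff_continuousAt.2 fun t =>
    (hasDerivAt_jumpProb_succ_of_continuous (fun z => continuous_jumpProb α n z x) t y).continuousAt

lemma hasDerivAt_jumpProb_succ (α : ℝ) (n : ℕ) (t : ℝ) (y x : Config) :
    HasDerivAt (fun s => jumpProb α (n + 1) s y x)
      (jumpSum α (fun z => jumpProb α n t z x) y - exitRate α y * jumpProb α (n + 1) t y x) t :=
  hasDerivAt_jumpProb_succ_of_continuous (fun z => continuous_jumpProb α n z x) t y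

lemma jumpProb_succ_zero (α : ℝ) (n : ℕ) (y x : Config) : jumpProb α (n + 1) 0 y x = 0 := by
  simp [jumpProb]

lemma eq_zero_of_hasDerivAt_smul {E : Type*} [NormedAddCommGroup E] [NormedSpace ℝ E] {f : ℝ → E}
    {c : ℝ} (h : ∀ t, HasDerivAt f (c • f t) t) (h0 : f 0 = 0) (t : ℝ) : f t = 0 := by
  have h1 : ∀ s, HasDerivAt (fun s => Real.exp (-(c * s)) • f s) 0 s := by
    intro s
    refine ((hasDerivAt_exp_neg_mul c s).fun_smul (h s)).congr_deriv ?_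
    module
  have h2 := is_const_of_deriv_eq_zero (fun s => (h1 s).differentiableAt) (fun s => (h1 s).deriv) t 0
  simp only [h0, smul_zero] at h2
  exact (smul_eq_zero.1 h2).resolve_left (Real.exp_pos _).ne'

/-- Decomposition at the first jump and at the last jump agree. The difference D of the two sides
satisfies D' = -(exit rate of y) D and D(0) = 0. For the inductive step, the starting-point sum is
differentiated in its forward form (known for n), the final-point sum in its backward form, and the
two operators commute. -/
lemma jumpProb_forward (α : ℝ) : ∀ (n : ℕ) (t : ℝ) (y x : Config),
    jumpSum α (fun z => jumpProb α n t z x) y - exitRate α y * jumpProb α (n + 1) t y x =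
      predSum α (fun z => jumpProb α n t y z) x - exitRate α x * jumpProb α (n + 1) t y x
  | 0, t, y, x => by
    set r := predSum α (fun z => if y = z then 1 else 0) x with hr
    have hJ : ∀ t, jumpSum α (fun z => jumpProb α 0 t z x) y = Real.exp (-(exitRate α x * t)) * r :=
      fun t => jumpSum_single α (fun z => Real.exp (-(exitRate α z * t))) y x
    have hP : ∀ t, predSum α (fun z => jumpProb α 0 t y z) x = Real.exp (-(exitRate α y * t)) * r := by
      intro t
      rw [hr, ← predSum_mul_left]
      simp [jumpProb]
    refine sub_eq_zero.1 (eq_zero_of_hasDerivAt_smul (c := -exitRate α y) (f := fun t =>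
      jumpSum α (fun z => jumpProb α 0 t z x) y - exitRate α y * jumpProb α 1 t y x -
      (predSum α (fun z => jumpProb α 0 t y z) x - exitRate α x * jumpProb α 1 t y x))
      (fun t => ?_) ?_ t)
    · have h1 := hasDerivAt_jumpProb_succ α 0 t y x
      simp only [hJ, hP, zero_add] at h1 ⊢
      refine ((((hasDerivAt_exp_neg_mul _ t).mul_const r).sub (h1.const_mul _)).sub
        (((hasDerivAt_exp_neg_mul _ t).mul_const r).sub (h1.const_mul _))).congr_deriv ?_
      ring
    · simp only [hJ, hP, jumpProb_succ_zero α 0]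
      simp
  | n + 1, t, y, x => by
    refine sub_eq_zero.1 (eq_zero_of_hasDerivAt_smul (c := -exitRate α y) (f := fun t =>
      jumpSum α (fun z => jumpProb α (n + 1) t z x) y - exitRate α y * jumpProb α (n + 1 + 1) t y x -
      (predSum α (fun z => jumpProb α (n + 1) t y z) x -
        exitRate α x * jumpProb α (n + 1 + 1) t y x)) (fun t => ?_) ?_ t)
    · have h1 := hasDerivAt_jumpProb_succ α (n + 1) t y x
      have h2 := hasDerivAt_jumpSum (α := α) (fun z => (hasDerivAt_jumpProb_succ α n t z x).congr_deriv
        (jumpProb_forward α n t z x)) y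
      have h3 := hasDerivAt_predSum (α := α) (fun z => hasDerivAt_jumpProb_succ α n t y z) x
      refine ((h2.sub (h1.const_mul _)).sub (h3.sub (h1.const_mul _))).congr_deriv ?_
      rw [jumpSum_sub, predSum_sub, jumpSum_mul_left, predSum_mul_left, jumpSum_predSum_comm]
      ring
    · simp only [jumpProb_succ_zero]
      simp [jumpSum, predSum]

/-- The sum of the particle positions. -/
def height (x : Config) : ℕ := ∑ s ∈ x, (s : ℕ)

lemma height_hop {y : Config} {s : ℕ+} (hs : s ∈ y) (hs' : s + 1 ∉ y) :
    height (hop y s) = height y + 1 := by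
  unfold height hop
  rw [Finset.sum_insert (by simp [hs']), ← Finset.add_sum_erase y _ hs]
  push_cast
  ring

lemma height_insert_one {y : Config} (h : 1 ∉ y) : height (insert 1 y) = height y + 1 := by
  unfold height
  rw [Finset.sum_insert h, add_comm]; rfl

lemma jumpSum_eq_zero {α : ℝ} {f : Config → ℝ} {y : Config}
    (h1 : 1 ∉ y → f (insert 1 y) = 0) (h2 : ∀ s ∈ y, s + 1 ∉ y → f (hop y s) = 0) :
    jumpSum α f y = 0 := by
  unfold jumpSum
  rw [Finset.sum_eq_zero fun s hs => h2 s (Finset.mem_filter.1 hs).1 (Finset.mem_filter.1 hs).2]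
  split_ifs with h
  · simp
  · simp [h1 h]

/-- Every jump raises the height by one, so the endpoints fix the number of jumps and the series
`transProb` has at most one nonzero term. -/
lemma jumpProb_eq_zero_of_height (α : ℝ) : ∀ (n : ℕ) (t : ℝ) (y x : Config),
    height x ≠ height y + n → jumpProb α n t y x = 0
  | 0, t, y, x, h => by
    rw [jumpProb, if_neg]
    rintro rfl
    exact h rfl
  | n + 1, t, y, x, h => by
    have : ∀ s, jumpSum α (fun z => jumpProb α n (t - s) z x) y = 0 := fun s =>
      jumpSum_eq_zero
        (fun h1 => jumpProb_eq_zero_of_height α n _ _ _ (by rw [height_insert_one h1]; omega))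
        (fun a ha ha' => jumpProb_eq_zero_of_height α n _ _ _ (by rw [height_hop ha ha']; omega))
    simp [jumpProb, this]

lemma card_hop {y : Config} {s : ℕ+} (hs : s ∈ y) (hs' : s + 1 ∉ y) :
    (hop y s).card = y.card := by
  unfold hop
  rw [Finset.card_insert_of_notMem (by simp [hs']), Finset.card_erase_add_one hs]

lemma jumpProb_eq_zero_of_card (α : ℝ) : ∀ (n : ℕ) (t : ℝ) (y x : Config),
    x.card < y.card → jumpProb α n t y x = 0
  | 0, t, y, x, h => by
    rw [jumpProb, if_neg]
    rintro rfl
    exact absurd h (lt_irrefl _)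
  | n + 1, t, y, x, h => by
    have : ∀ s, jumpSum α (fun z => jumpProb α n (t - s) z x) y = 0 := fun s =>
      jumpSum_eq_zero
        (fun h1 => jumpProb_eq_zero_of_card α n _ _ _
          (by rw [Finset.card_insert_of_notMem h1]; omega))
        (fun a ha ha' => jumpProb_eq_zero_of_card α n _ _ _ (by rw [card_hop ha ha']; omega))
    simp [jumpProb, this]

lemma transProb_eq_jumpProb {α t : ℝ} {n : ℕ} {y x : Config} (h : height x = height y + n) :
    transProb α t y x = jumpProb α n t y x :=
  tsum_eq_single n fun m hm => jumpProb_eq_zero_of_height α m t y x (by omega)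

lemma transProb_eq_zero_of_height {α t : ℝ} {y x : Config} (h : height x < height y) :
    transProb α t y x = 0 := by
  unfold transProb
  simp [fun n => jumpProb_eq_zero_of_height α n t y x (by omega)]

lemma transProb_eq_zero_of_card {α t : ℝ} {y x : Config} (h : x.card < y.card) :
    transProb α t y x = 0 := by
  unfold transProb
  simp [fun n => jumpProb_eq_zero_of_card α n t y x h]

lemma transProb_zero (α : ℝ) (y x : Config) : transProb α 0 y x = if y = x then 1 else 0 := by
  unfold transProb
  rw [tsum_eq_single 0]
  · simp [jumpProb]
  · intro n hn
    obtain ⟨m, rfl⟩ := Nat.exists_eq_succ_of_ne_zero hn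
    exact jumpProb_succ_zero α m y x

lemma height_hopBack {x : Config} {s : ℕ+} (hs : s + 1 ∈ x) (hs' : s ∉ x) :
    height (hopBack x s) + 1 = height x := by
  unfold height hopBack
  rw [Finset.sum_insert (by simp [hs']), ← Finset.add_sum_erase x _ hs]
  push_cast
  ring

lemma height_erase_one {x : Config} (h : 1 ∈ x) : height (x.erase 1) + 1 = height x := by
  unfold height
  rw [← Finset.sum_erase_add x _ h]; rfl

lemma predSum_congr {α : ℝ} {f g : Config → ℝ} {x : Config}
    (h : ∀ z, height z + 1 = height x → f z = g z) : predSum α f x = predSum α g x := by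
  unfold predSum
  congr 1
  · split_ifs with h1
    · rw [h _ (height_erase_one h1)]
    · rfl
  · refine Finset.sum_congr rfl fun s hs => ?_
    have := (Finset.mem_filter.1 hs).2
    exact h _ (height_hopBack this.1 this.2)

/-- The forward equation. -/
lemma hasDerivAt_transProb (α t : ℝ) (y x : Config) :
    HasDerivAt (fun s => transProb α s y x)
      (predSum α (transProb α t y) x - exitRate α x * transProb α t y x) t := by
  -- Near every t the series is the same single term, or zero, so no interchange of sum and
  -- derivative is involved.
  obtain hlt | ⟨n, hn⟩ := lt_or_ge (height x) (height y) |>.imp_right Nat.exists_eq_add_of_le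
  · simp only [transProb_eq_zero_of_height hlt]
    have : predSum α (transProb α t y) x = predSum α (fun _ => (0 : ℝ) * 0) x :=
      predSum_congr fun z hz => by rw [transProb_eq_zero_of_height (by omega), zero_mul]
    rw [this, predSum_mul_left]
    simpa using hasDerivAt_const t (0 : ℝ)
  · simp only [transProb_eq_jumpProb hn]
    cases n with
    | zero =>
      have : predSum α (transProb α t y) x = predSum α (fun _ => (0 : ℝ) * 0) x :=
        predSum_congr fun z hz => by rw [transProb_eq_zero_of_height (by omega), zero_mul]
      rw [this, predSum_mul_left]
      have h := hasDerivAt_jumpProb_zero α t y x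
      by_cases hyx : y = x
      · subst hyx; simpa using h
      · simpa [jumpProb, hyx] using hasDerivAt_const t (0 : ℝ)
    | succ n =>
      refine (hasDerivAt_jumpProb_succ α n t y x).congr_deriv ?_
      rw [jumpProb_forward]
      congr 1
      exact predSum_congr fun z hz => (transProb_eq_jumpProb (by omega)).symm

end JumpChain
end HalfTASEP

namespace HalfTASEP
-- Contour integrals on circles
section Contour

open Filter Topology

lemma contour_congr {R : ℝ} (hR : 0 ≤ R) {f g : ℂ → ℂ} (h : ∀ z, ‖z‖ = R → f z = g z) :
    contour R f = contour R g := by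
  unfold contour
  rw [circleIntegral.integral_congr hR fun z hz => h z (by simpa using hz)]

lemma contour_const_mul (R : ℝ) (c : ℂ) (f : ℂ → ℂ) :
    contour R (fun z => c * f z) = c * contour R f := by
  unfold contour
  rw [circleIntegral.integral_const_mul]; ring

lemma contour_neg (R : ℝ) (f : ℂ → ℂ) : contour R (fun z => -f z) = -contour R f := by
  simpa using contour_const_mul R (-1) f

lemma norm_circleMap_zero {R : ℝ} (hR : 0 ≤ R) (θ : ℝ) : ‖circleMap 0 R θ‖ = R := by
  simp [abs_of_nonneg hR]

lemma continuous_comp_circleMap {R : ℝ} (hR : 0 ≤ R) {f : ℂ → ℂ}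
    (hf : ∀ z, ‖z‖ = R → ContinuousAt f z) : Continuous fun θ => f (circleMap 0 R θ) :=
  continuous_iff_continuousAt.2 fun θ =>
    (hf _ (norm_circleMap_zero hR θ)).comp (continuous_circleMap 0 R).continuousAt

lemma circleIntegrable_of_continuous {R : ℝ} {f : ℂ → ℂ}
    (hf : Continuous fun θ => f (circleMap 0 R θ)) : CircleIntegrable f 0 R :=
  hf.intervalIntegrable _ _

lemma contour_sub {R : ℝ} {f g : ℂ → ℂ} (hf : Continuous fun θ => f (circleMap 0 R θ))
    (hg : Continuous fun θ => g (circleMap 0 R θ)) :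
    contour R (fun z => f z - g z) = contour R f - contour R g := by
  unfold contour
  rw [circleIntegral.integral_sub (circleIntegrable_of_continuous hf)
    (circleIntegrable_of_continuous hg)]
  ring

lemma contour_add {R : ℝ} {f g : ℂ → ℂ} (hf : Continuous fun θ => f (circleMap 0 R θ))
    (hg : Continuous fun θ => g (circleMap 0 R θ)) :
    contour R (fun z => f z + g z) = contour R f + contour R g := by
  unfold contour
  rw [circleIntegral.integral_add (circleIntegrable_of_continuous hf)
    (circleIntegrable_of_continuous hg)]
  ring

lemma contour_eq_of_annulus {r R : ℝ} (hr : 0 < r) (hrR : r ≤ R) {f : ℂ → ℂ}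
    (hf : ∀ z, r ≤ ‖z‖ → ‖z‖ ≤ R → DifferentiableAt ℂ f z) : contour R f = contour r f := by
  unfold contour
  rw [Complex.circleIntegral_eq_of_differentiable_on_annulus_off_countable hr hrR
    Set.countable_empty]
  · intro z hz
    simp only [Set.mem_sdiff, Metric.mem_closedBall, Metric.mem_ball, dist_zero_right, not_lt] at hz
    exact (hf z hz.2 hz.1).continuousAt.continuousWithinAt
  · intro z hz
    simp only [Set.mem_sdiff, Metric.mem_closedBall, Metric.mem_ball, dist_zero_right, not_le,
      Set.mem_empty_iff_false, not_false_eq_true, and_true] at hz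
    exact hf z hz.2.le hz.1.le

lemma contour_eq_zero_of_disc {R : ℝ} (hR : 0 ≤ R) {f : ℂ → ℂ}
    (hf : ∀ z, ‖z‖ ≤ R → DifferentiableAt ℂ f z) : contour R f = 0 := by
  unfold contour
  rw [Complex.circleIntegral_eq_zero_of_differentiable_on_off_countable hR Set.countable_empty,
    mul_zero]
  · intro z hz
    exact (hf z (by simpa using hz)).continuousAt.continuousWithinAt
  · intro z hz
    have : ‖z‖ < R := by simpa using hz
    exact hf z this.le

lemma contour_div_sub {R : ℝ} {c : ℂ} (hc : ‖c‖ < R) {f : ℂ → ℂ}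
    (hf : ∀ z, ‖z‖ ≤ R → DifferentiableAt ℂ f z) : contour R (fun z => f z / (z - c)) = f c := by
  unfold contour
  rw [Complex.circleIntegral_div_sub_of_differentiable_on_off_countable Set.countable_empty
    (by simpa using hc)]
  · rw [← mul_assoc, inv_mul_cancel₀ Complex.two_pi_I_ne_zero, one_mul]
  · intro z hz
    exact (hf z (by simpa using hz)).continuousAt.continuousWithinAt
  · intro z hz
    have : ‖z‖ < R := by simpa using hz
    exact hf z this.le

lemma norm_contour_le {R C : ℝ} (hR : 0 ≤ R) {f : ℂ → ℂ} (hf : ∀ z, ‖z‖ = R → ‖f z‖ ≤ C) :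
    ‖contour R f‖ ≤ R * C :=
  circleIntegral.norm_two_pi_i_inv_smul_integral_le_of_norm_le_const hR
    fun z hz => hf z (by simpa using hz)

/-- The integral does not depend on the radius, and on large circles it is bounded by the maximum of
‖z f z‖. -/
lemma contour_eq_zero_of_decay {R : ℝ} (hR : 0 < R) {f : ℂ → ℂ}
    (hf : ∀ z, R ≤ ‖z‖ → DifferentiableAt ℂ f z)
    (hd : Tendsto (fun z => z * f z) (Bornology.cobounded ℂ) (𝓝 0)) : contour R f = 0 := by
  refine norm_le_zero_iff.1 (le_of_forall_pos_le_add fun ε hε => ?_)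
  have h1 : ∀ᶠ z in Bornology.cobounded ℂ, ‖z * f z‖ < ε := by
    simpa using hd.eventually (Metric.ball_mem_nhds 0 hε)
  rw [← comap_norm_atTop, eventually_comap] at h1
  obtain ⟨R', hR'⟩ := (h1.and (eventually_ge_atTop R)).exists
  have hpos : 0 < R' := hR.trans_le hR'.2
  rw [← contour_eq_of_annulus hR hR'.2 fun z hz _ => hf z hz, zero_add]
  refine (norm_contour_le (C := ε / R') hpos.le fun z hz => ?_).trans
    (by rw [mul_div_cancel₀ _ hpos.ne'])
  have := hR'.1 z hz
  rw [norm_mul, hz] at this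
  rw [le_div_iff₀ hpos, mul_comm]
  exact this.le

/-- Residue theorem for one simple pole in an annulus: `dslope` is the part with removable
singularity and integrates equally over both circles, while 1/(z - c) integrates to 1 outside and to
0 inside. -/
lemma contour_div_sub_of_annulus {r R : ℝ} (hr : 0 < r) {c : ℂ} (hrc : r < ‖c‖) (hcR : ‖c‖ < R)
    {f : ℂ → ℂ} (hf : ∀ z, r ≤ ‖z‖ → ‖z‖ ≤ R → DifferentiableAt ℂ f z) :
    contour R (fun z => f z / (z - c)) - contour r (fun z => f z / (z - c)) = f c := by
  have hsplit : ∀ z, z ≠ c → f z / (z - c) = dslope f c z + f c * (1 / (z - c)) := by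
    intro z hz
    rw [dslope_of_ne _ hz, slope_def_field]
    ring
  have hfc := hf c hrc.le hcR.le
  have hne : ∀ ρ, ρ ≠ ‖c‖ → ∀ z, ‖z‖ = ρ → z ≠ c := by
    rintro ρ hρ z hz rfl; exact hρ hz.symm
  have hcd : ∀ z, r ≤ ‖z‖ → ‖z‖ ≤ R → ContinuousAt (dslope f c) z := by
    intro z h1 h2
    by_cases hz : z = c
    · subst hz; exact continuousAt_dslope_same.2 hfc
    · exact (continuousAt_dslope_of_ne hz).2 (hf z h1 h2).continuousAt
  have hd : contour R (dslope f c) = contour r (dslope f c) := by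
    unfold contour
    rw [Complex.circleIntegral_eq_of_differentiable_on_annulus_off_countable hr
      (hrc.trans hcR).le (Set.countable_singleton c)]
    · intro z hz
      simp only [Set.mem_sdiff, Metric.mem_closedBall, Metric.mem_ball, dist_zero_right,
        not_lt] at hz
      exact (hcd z hz.2 hz.1).continuousWithinAt
    · intro z hz
      simp only [Set.mem_sdiff, Metric.mem_closedBall, Metric.mem_ball, dist_zero_right, not_le,
        Set.mem_singleton_iff] at hz
      exact (differentiableAt_dslope_of_ne hz.2).2 (hf z hz.1.2.le hz.1.1.le)
  have hi : ∀ ρ, ρ ≠ ‖c‖ → ∀ z, ‖z‖ = ρ → ContinuousAt (fun z => f c * (1 / (z - c))) z := by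
    intro ρ hρ z hz
    have := sub_ne_zero.2 (hne ρ hρ z hz)
    fun_prop (disch := assumption)
  have e : ∀ ρ, r ≤ ρ → ρ ≤ R → ρ ≠ ‖c‖ → contour ρ (fun z => f z / (z - c)) =
      contour ρ (dslope f c) + f c * contour ρ (fun z => 1 / (z - c)) := by
    intro ρ h1 h2 h3
    rw [contour_congr (hr.le.trans h1) fun z hz => hsplit z (hne ρ h3 z hz),
      contour_add (continuous_comp_circleMap (hr.le.trans h1)
        fun z hz => hcd z (by rwa [hz]) (by rwa [hz]))
        (continuous_comp_circleMap (hr.le.trans h1) (hi ρ h3)),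
      contour_const_mul]
  have e0 : contour r (fun z => 1 / (z - c)) = 0 := by
    refine contour_eq_zero_of_disc hr.le fun z hz => ?_
    have : z - c ≠ 0 := sub_ne_zero.2 (by rintro rfl; linarith)
    fun_prop (disch := assumption)
  have e1 : contour R (fun z => 1 / (z - c)) = 1 :=
    contour_div_sub (f := fun _ => 1) hcR fun z _ => differentiableAt_const _
  rw [e R (hrc.trans hcR).le le_rfl hcR.ne', e r le_rfl (hrc.trans hcR).le hrc.ne, hd, e0, e1]
  ring

/-- The density of `dz / (2 π i)` on the circle of radius `R`. -/
noncomputable def circleDensity (R θ : ℝ) : ℂ := circleMap 0 R θ / (2 * Real.pi)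

@[fun_prop]
lemma continuous_circleDensity (R : ℝ) : Continuous (circleDensity R) := by
  unfold circleDensity; fun_prop

lemma contour_eq_intervalIntegral (R : ℝ) (f : ℂ → ℂ) :
    contour R f = ∫ θ in (0 : ℝ)..2 * Real.pi, circleDensity R θ * f (circleMap 0 R θ) := by
  unfold contour circleIntegral circleDensity
  rw [← intervalIntegral.integral_const_mul]
  congr 1
  funext θ
  rw [deriv_circleMap, smul_eq_mul]
  have : (Real.pi : ℂ) ≠ 0 := by exact_mod_cast Real.pi_ne_zero
  field_simp [Complex.I_ne_zero]

lemma intervalIntegral_swap {f : ℝ → ℝ → ℂ} (hf : Continuous f.uncurry) (a b c d : ℝ) :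
    ∫ x in a..b, ∫ y in c..d, f x y = ∫ y in c..d, ∫ x in a..b, f x y :=
  MeasureTheory.intervalIntegral_intervalIntegral_swap <|
    MeasureTheory.IntegrableOn.mono_set (hf.continuousOn.integrableOn_compact
      (isCompact_uIcc.prod isCompact_uIcc))
      (Set.prod_mono Set.uIoc_subset_uIcc Set.uIoc_subset_uIcc)

lemma contour_swap {R₁ R₂ : ℝ} {K : ℂ → ℂ → ℂ}
    (hK : Continuous fun p : ℝ × ℝ => K (circleMap 0 R₂ p.1) (circleMap 0 R₁ p.2)) :
    contour R₂ (fun u => contour R₁ fun w => K u w) =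
      contour R₁ fun w => contour R₂ fun u => K u w := by
  simp only [contour_eq_intervalIntegral, ← intervalIntegral.integral_const_mul]
  rw [intervalIntegral_swap]
  · congr 1
    funext θ
    congr 1
    funext φ
    ring
  · exact ((continuous_circleDensity R₂).comp continuous_fst).mul
      (((continuous_circleDensity R₁).comp continuous_snd).mul hK)

lemma continuous_contour {R : ℝ} {X : Type*} [TopologicalSpace X]
    [FirstCountableTopology X] [LocallyCompactSpace X] {K : X → ℂ → ℂ}
    (hK : Continuous fun p : X × ℝ => K p.1 (circleMap 0 R p.2)) :
    Continuous fun x => contour R (K x) := by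
  simp only [contour_eq_intervalIntegral]
  exact intervalIntegral.continuous_parametric_intervalIntegral_of_continuous'
    (((continuous_circleDensity R).comp continuous_snd).mul hK) _ _

lemma hasDerivAt_intervalIntegral {F F' : ℝ → ℝ → ℂ} (hF : ∀ t, Continuous (F t))
    (hF' : Continuous F'.uncurry) (h : ∀ t θ, HasDerivAt (fun s => F s θ) (F' t θ) t)
    (a b t : ℝ) :
    HasDerivAt (fun s => ∫ θ in a..b, F s θ) (∫ θ in a..b, F' t θ) t := by
  obtain ⟨C, hC⟩ := ((isCompact_closedBall t 1).prod
    (isCompact_uIcc (a := a) (b := b))).exists_bound_of_continuousOn hF'.continuousOn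
  refine (intervalIntegral.hasDerivAt_integral_of_dominated_loc_of_deriv_le (F := F) (F' := F')
    (bound := fun _ => C) (Metric.closedBall_mem_nhds t one_pos) ?_ ?_ ?_ ?_ ?_ ?_).2
  · exact Eventually.of_forall fun s => (hF s).aestronglyMeasurable
  · exact (hF t).intervalIntegrable _ _
  · exact (hF'.comp (Continuous.prodMk_right t)).aestronglyMeasurable
  · exact Eventually.of_forall fun θ hθ s hs => hC (s, θ) ⟨hs, Set.uIoc_subset_uIcc hθ⟩
  · exact continuous_const.intervalIntegrable _ _
  · exact Eventually.of_forall fun θ _ s _ => h s θ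

end Contour
end HalfTASEP

namespace HalfTASEP
-- Skew-symmetry and vanishing of the kernel Q
section Weights

open Filter Topology

lemma differentiableAt_weight (α t : ℝ) (i : ℕ) (a : ℤ) {w : ℂ} (h0 : w ≠ 0) (h1 : w ≠ 1)
    (hα : w ≠ α) : DifferentiableAt ℂ (weight α t i a) w := by
  have e1 := sub_ne_zero.2 h1
  have e2 := sub_ne_zero.2 hα
  have e3 : (w - α) * (w - 1) ^ i ≠ 0 := mul_ne_zero e2 (pow_ne_zero _ e1)
  have e4 : DifferentiableAt ℂ (fun w : ℂ => w ^ ((i : ℤ) - a)) w :=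
    differentiableAt_zpow.2 (Or.inl h0)
  unfold weight
  fun_prop (disch := assumption)

lemma ne_of_max_lt_norm {α : ℝ} (hα : 0 ≤ α) {w : ℂ} (hw : max 1 α < ‖w‖) :
    w ≠ 0 ∧ w ≠ 1 ∧ w ≠ α := by
  have h1 := (le_max_left 1 α).trans_lt hw
  have h2 := (le_max_right 1 α).trans_lt hw
  refine ⟨?_, ?_, ?_⟩ <;> rintro rfl
  · simp at h1; linarith
  · simp at h1
  · simp [abs_of_nonneg hα] at h2

lemma differentiableAt_weight_of_norm {α : ℝ} (hα : 0 ≤ α) (t : ℝ) (i : ℕ) (a : ℤ) {w : ℂ}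
    (hw : max 1 α < ‖w‖) : DifferentiableAt ℂ (weight α t i a) w :=
  differentiableAt_weight α t i a (ne_of_max_lt_norm hα hw).1 (ne_of_max_lt_norm hα hw).2.1
    (ne_of_max_lt_norm hα hw).2.2

lemma one_sub_sub_ne_zero {u w : ℂ} (h : 1 < |‖w‖ - ‖u‖|) : 1 - u - w ≠ 0 := by
  intro h0
  have e : w = 1 - u := by linear_combination -h0
  have e' : u = 1 - w := by linear_combination -h0
  have h1 : ‖w‖ ≤ 1 + ‖u‖ := by rw [e]; simpa using norm_sub_le (1 : ℂ) u
  have h2 : ‖u‖ ≤ 1 + ‖w‖ := by rw [e']; simpa using norm_sub_le (1 : ℂ) w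
  rw [lt_abs] at h
  obtain h | h := h <;> linarith

lemma differentiableAt_kernel_left {u w : ℂ} (h : 1 - u - w ≠ 0) :
    DifferentiableAt ℂ (fun u : ℂ => (u - w) / (1 - u - w)) u := by
  fun_prop (disch := assumption)

lemma differentiableAt_kernel_right {u w : ℂ} (h : 1 - u - w ≠ 0) :
    DifferentiableAt ℂ (fun w : ℂ => (u - w) / (1 - u - w)) w := by
  fun_prop (disch := assumption)

lemma continuous_kernel_circleMap {R₁ R₂ : ℝ} (h1 : 0 ≤ R₁) (h2 : 0 ≤ R₂) (h : 1 < |R₁ - R₂|) :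
    Continuous fun p : ℝ × ℝ => (circleMap 0 R₂ p.1 - circleMap 0 R₁ p.2) /
      (1 - circleMap 0 R₂ p.1 - circleMap 0 R₁ p.2) := by
  refine Continuous.div (by fun_prop) (by fun_prop) fun p => one_sub_sub_ne_zero ?_
  rwa [norm_circleMap_zero h1, norm_circleMap_zero h2]

lemma contour_kernel_swap {R₁ R₂ : ℝ} (h1 : 0 ≤ R₁) (h2 : 0 ≤ R₂) (h : 1 < |R₁ - R₂|)
    {f g : ℂ → ℂ} (hf : ∀ z, ‖z‖ = R₁ → ContinuousAt f z)
    (hg : ∀ z, ‖z‖ = R₂ → ContinuousAt g z) :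
    contour R₂ (fun u => contour R₁ fun w => (u - w) / (1 - u - w) * f w * g u) =
      contour R₁ fun w => contour R₂ fun u => (u - w) / (1 - u - w) * f w * g u :=
  contour_swap (((continuous_kernel_circleMap h1 h2 h).mul
    ((continuous_comp_circleMap h1 hf).comp continuous_snd)).mul
    ((continuous_comp_circleMap h2 hg).comp continuous_fst))

/-- Deforming the contours of the double integral across the pole `w = 1 - u`, when the residue
integrates to zero. -/
lemma contour_kernel_comm {ρ R₁ R₂ : ℝ} (hρ : 0 ≤ ρ) (h1 : ρ < R₁) (h2 : R₁ + 1 < R₂)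
    {f g : ℂ → ℂ} (hf : ∀ z, ρ < ‖z‖ → DifferentiableAt ℂ f z)
    (hg : ∀ z, ρ < ‖z‖ → DifferentiableAt ℂ g z)
    (hres : contour R₂ (fun u => (1 - 2 * u) * f (1 - u) * g u) = 0) :
    contour R₂ (fun u => contour R₁ fun w => (u - w) / (1 - u - w) * f w * g u) =
      contour R₁ fun u => contour R₂ fun w => (u - w) / (1 - u - w) * f w * g u := by
  -- For ‖u‖ = R₂ the pole 1 - u has norm at most R₂ + 1, hence lies inside this circle; the circle
  -- also stays at distance more than 1 from both given radii.
  set R₃ := R₂ + 2 with hR₃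
  have hab : ∀ {a b : ℝ}, a + 1 < b → 1 < |a - b| := fun h => by
    rw [abs_sub_comm]; exact lt_of_lt_of_le (by linarith) (le_abs_self _)
  have hab' : ∀ {a b : ℝ}, a + 1 < b → 1 < |b - a| := fun h =>
    lt_of_lt_of_le (by linarith) (le_abs_self _)
  have hdf : ∀ u w : ℂ, ρ < ‖w‖ → 1 - u - w ≠ 0 →
      DifferentiableAt ℂ (fun w => (u - w) / (1 - u - w) * f w * g u) w := fun u w hw h =>
    ((differentiableAt_kernel_right h).mul (hf w hw)).mul_const _
  have hdg : ∀ u w : ℂ, ρ < ‖u‖ → 1 - u - w ≠ 0 →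
      DifferentiableAt ℂ (fun u => (u - w) / (1 - u - w) * f w * g u) u := fun u w hu h =>
    ((differentiableAt_kernel_left h).mul_const _).mul (hg u hu)
  have hcf : ∀ {R}, ρ < R → ∀ z, ‖z‖ = R → ContinuousAt f z := fun h z hz =>
    (hf z (by rw [hz]; exact h)).continuousAt
  have hcg : ∀ {R}, ρ < R → ∀ z, ‖z‖ = R → ContinuousAt g z := fun h z hz =>
    (hg z (by rw [hz]; exact h)).continuousAt
  have hnorm : ∀ {u : ℂ}, ‖u‖ = R₂ → R₁ < ‖1 - u‖ ∧ ‖1 - u‖ < R₃ := fun {u} hu => by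
    have a1 := norm_sub_norm_le u 1
    have a2 := norm_sub_le (1 : ℂ) u
    rw [norm_sub_rev] at a1
    simp only [norm_one, hu] at a1 a2
    constructor <;> linarith
  have hc : ∀ R, ρ < R → 1 < |R - R₂| → Continuous fun θ => contour R fun w =>
      (circleMap 0 R₂ θ - w) / (1 - circleMap 0 R₂ θ - w) * f w * g (circleMap 0 R₂ θ) :=
    fun R hR hRR => continuous_contour (K := fun θ w => (circleMap 0 R₂ θ - w) /
      (1 - circleMap 0 R₂ θ - w) * f w * g (circleMap 0 R₂ θ))
      (((continuous_kernel_circleMap (by linarith) (by linarith) hRR).mul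
        ((continuous_comp_circleMap (by linarith) (hcf hR)).comp continuous_snd)).mul
        ((continuous_comp_circleMap (by linarith) (hcg (by linarith))).comp continuous_fst))
  -- Enlarging the w-circle crosses the pole w = 1 - u for every u; the residues form the integrand
  -- of `hres`.
  have s1 : contour R₂ (fun u => contour R₁ fun w => (u - w) / (1 - u - w) * f w * g u) =
      contour R₂ fun u => contour R₃ fun w => (u - w) / (1 - u - w) * f w * g u := by
    rw [eq_comm, ← sub_eq_zero, ← contour_sub (hc R₃ (by linarith) (hab' (by linarith)))
      (hc R₁ h1 (hab h2)), ← hres]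
    refine contour_congr (by linarith) fun u hu => ?_
    have key := contour_div_sub_of_annulus (r := R₁) (R := R₃) (c := 1 - u) (by linarith)
      (hnorm hu).1 (hnorm hu).2 (f := fun w => -(u - w) * f w * g u) fun z hz _ =>
        (((differentiableAt_id.const_sub u).neg.mul (hf z (by linarith))).mul_const _)
    have e : (fun w => (u - w) / (1 - u - w) * f w * g u) =
        fun w => -(u - w) * f w * g u / (w - (1 - u)) := by
      funext w
      rw [show w - (1 - u) = -(1 - u - w) by ring, div_neg]
      ring
    rw [e, key]
    ring
  rw [s1, contour_kernel_swap (by linarith) (by linarith) (hab' (by linarith))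
    (hcf (by linarith)) (hcg (by linarith))]
  -- With w on the largest circle the u-circle shrinks without meeting a pole; afterwards w can
  -- shrink to R₂.
  have s2 : contour R₃ (fun w => contour R₂ fun u => (u - w) / (1 - u - w) * f w * g u) =
      contour R₃ fun w => contour R₁ fun u => (u - w) / (1 - u - w) * f w * g u := by
    refine contour_congr (by linarith) fun w hw => ?_
    refine contour_eq_of_annulus (by linarith) (by linarith) fun u hu hu' =>
      hdg u w (by linarith) (one_sub_sub_ne_zero ?_)
    rw [hw]; exact hab' (by linarith)
  rw [s2, ← contour_kernel_swap (by linarith) (by linarith) (hab' (by linarith))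
    (hcf (by linarith)) (hcg h1)]
  refine contour_congr (by linarith) fun u hu => ?_
  refine contour_eq_of_annulus (by linarith) (by linarith) fun w hw hw' =>
    hdf u w (by linarith) (one_sub_sub_ne_zero ?_)
  rw [hu]; exact hab' (by linarith)

lemma tendsto_div_sub (c : ℂ) :
    Tendsto (fun z : ℂ => z / (z - c)) (Bornology.cobounded ℂ) (𝓝 1) := by
  have h1 : Tendsto (fun z : ℂ => (1 - c * z⁻¹)⁻¹) (Bornology.cobounded ℂ) (𝓝 1) := by
    have := ((tendsto_inv₀_cobounded (α := ℂ)).const_mul c).const_sub 1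
    simpa using this.inv₀ (by simp)
  refine h1.congr' ?_
  filter_upwards [Bornology.eventually_ne_cobounded (0 : ℂ), Bornology.eventually_ne_cobounded c] with z h0 hc
  have := sub_ne_zero.2 hc
  have h3 : 1 - c * z⁻¹ = (z - c) / z := by field_simp
  rw [h3, inv_div]

lemma tendsto_zpow_neg {n : ℤ} (hn : 0 < n) :
    Tendsto (fun z : ℂ => z ^ (-n)) (Bornology.cobounded ℂ) (𝓝 0) := by
  obtain ⟨m, rfl⟩ := Int.eq_ofNat_of_zero_le hn.le
  have hm : m ≠ 0 := by rintro rfl; simp at hn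
  have := (tendsto_inv₀_cobounded (α := ℂ)).pow m
  rw [zero_pow hm] at this
  refine this.congr fun z => ?_
  simp

lemma weight_eq_of_ne (α t : ℝ) (i : ℕ) (a : ℤ) {w : ℂ} (h0 : w ≠ 0) :
    weight α t i a w = w ^ (-a) * (w / (w - 1)) ^ i * (Complex.exp (t * (w - 1)) / (w - α)) := by
  unfold weight
  rw [sub_eq_add_neg, zpow_add₀ h0, zpow_natCast, div_pow]
  simp only [div_eq_mul_inv, mul_inv]
  ring

lemma contour_weight_zero {α R : ℝ} (hα : 0 ≤ α) (hR : max 1 α < R) (i : ℕ) {a : ℤ} (ha : 1 ≤ a) :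
    contour R (weight α 0 i a) = 0 := by
  refine contour_eq_zero_of_decay ((le_max_left 1 α).trans_lt hR |>.trans' one_pos) (fun z hz =>
    differentiableAt_weight_of_norm hα 0 i a (hR.trans_le hz)) ?_
  have h : Tendsto (fun z : ℂ => z ^ (-a) * (z / (z - 1)) ^ i * (z / (z - α)))
      (Bornology.cobounded ℂ) (𝓝 0) := by
    simpa using ((tendsto_zpow_neg (by omega : 0 < a)).mul ((tendsto_div_sub 1).pow i)).mul
      (tendsto_div_sub α)
  refine h.congr' ?_
  filter_upwards [Bornology.eventually_ne_cobounded (0 : ℂ)] with z h0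
  rw [weight_eq_of_ne α 0 i a h0]
  simp
  ring

lemma Qker_eq (α t R₁ R₂ : ℝ) (i j : ℕ) (a b : ℤ) : Qker α t R₁ R₂ i j a b =
    (α : ℂ) ^ 2 * contour R₂ fun u => contour R₁ fun w =>
      (u - w) / (1 - u - w) * weight α t i a w * weight α t j b u := rfl

lemma tendsto_one_sub_cobounded :
    Tendsto (fun z : ℂ => 1 - z) (Bornology.cobounded ℂ) (Bornology.cobounded ℂ) := by
  rw [← tendsto_norm_atTop_iff_cobounded]
  refine tendsto_atTop_mono (fun z => ?_)
    (tendsto_atTop_add_const_right _ (-1) (tendsto_norm_cobounded_atTop (E := ℂ)))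
  have := norm_sub_norm_le z 1
  rw [norm_sub_rev] at this
  simpa [sub_eq_add_neg] using this

/-- The exponentials at 1 - u and u multiply to the constant e^{-t}, so the integrand is
O(u^{-1-a-b}) and analytic outside the circle. This is where 1 ≤ a + b is needed. -/
lemma contour_residue_weight {α R : ℝ} (hα : 0 ≤ α) (hR : max 1 α + 1 < R) (t : ℝ) (i j : ℕ)
    {a b : ℤ} (hab : 1 ≤ a + b) :
    contour R (fun u => (1 - 2 * u) * weight α t i a (1 - u) * weight α t j b u) = 0 := by
  have hpos : (1 : ℝ) ≤ max 1 α := le_max_left _ _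
  have hnorm : ∀ z : ℂ, R ≤ ‖z‖ → max 1 α < ‖1 - z‖ := fun z hz => by
    have a1 := norm_sub_norm_le z 1
    rw [norm_sub_rev, norm_one] at a1
    linarith
  refine contour_eq_zero_of_decay (by linarith) (fun z hz => ?_) ?_
  · refine ((by fun_prop : DifferentiableAt ℂ (fun u : ℂ => 1 - 2 * u) z).mul ?_).mul
      (differentiableAt_weight_of_norm hα t j b (by linarith))
    exact (differentiableAt_weight_of_norm hα t i a (hnorm z hz)).comp z
      (differentiableAt_id.const_sub 1)
  have hα' := tendsto_div_sub (α : ℂ)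
  have h2 : Tendsto (fun z : ℂ => (-(z / (z - 1))) ^ a) (Bornology.cobounded ℂ)
      (𝓝 ((-1) ^ a)) := (tendsto_div_sub 1).neg.zpow₀ a (Or.inl (by simp))
  have h3 : Tendsto (fun z : ℂ => ((1 - z) / (1 - z - 1)) ^ i) (Bornology.cobounded ℂ) (𝓝 1) := by
    simpa using ((tendsto_div_sub 1).comp tendsto_one_sub_cobounded).pow i
  have h4 : Tendsto (fun z : ℂ => (1 - z) / (1 - z - α)) (Bornology.cobounded ℂ) (𝓝 1) :=
    hα'.comp tendsto_one_sub_cobounded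
  have h := (((((hα'.mul h4).mul ((tendsto_div_sub 1).const_add 1)).mul h2).mul h3).mul
    ((tendsto_div_sub 1).pow j)).mul ((tendsto_zpow_neg (by omega : 0 < a + b)).const_mul
      (Complex.exp (-t)))
  rw [mul_zero, mul_zero] at h
  refine h.congr' ?_
  filter_upwards [Bornology.eventually_ne_cobounded (0 : ℂ), Bornology.eventually_ne_cobounded (1 : ℂ)]
    with z h0 h1
  have h1' : 1 - z ≠ 0 := sub_ne_zero.2 h1.symm
  have h1'' : z - 1 ≠ 0 := sub_ne_zero.2 h1
  rw [weight_eq_of_ne α t i a h1', weight_eq_of_ne α t j b h0]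
  have e1 : -(z / (z - 1)) = z / (1 - z) := by
    rw [← neg_sub 1 z, div_neg, neg_neg]
  have e2 : Complex.exp (-t) = Complex.exp (t * (1 - z - 1)) * Complex.exp (t * (z - 1)) := by
    rw [← Complex.exp_add]; congr 1; ring
  have e3 : (1 : ℂ) + z / (z - 1) = (1 - 2 * z) / (1 - z) := by field_simp; ring
  have e4 : z ^ (-(a + b)) * (z / (1 - z)) ^ a = (1 - z) ^ (-a) * z ^ (-b) := by
    rw [div_zpow, neg_add, zpow_add₀ h0, zpow_neg, zpow_neg (1 - z)]
    have := zpow_ne_zero a h0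
    field_simp
  rw [e1, e2, e3]
  generalize ((1 - z) / (1 - z - 1)) ^ i = A
  generalize (z / (z - 1)) ^ j = B
  generalize Complex.exp (t * (1 - z - 1)) = C
  generalize Complex.exp (t * (z - 1)) = D
  calc _ = (z ^ (-(a + b)) * (z / (1 - z)) ^ a) * (A * B * C * D * (1 - 2 * z) * z / (z - α) /
        (1 - z - α) * ((1 - z) / (1 - z))) := by ring
    _ = _ := by rw [e4, div_self h1']; ring

/-- The double contour integral does not depend on which of the two contours is the larger one. -/
lemma Qker_comm_radii {α R₁ R₂ : ℝ} (hα : 0 ≤ α) (h1 : max 1 α < R₁) (h2 : R₁ + 1 < R₂) (t : ℝ)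
    (i j : ℕ) {a b : ℤ} (hab : 1 ≤ a + b) :
    Qker α t R₁ R₂ i j a b = Qker α t R₂ R₁ i j a b := by
  rw [Qker_eq, Qker_eq, contour_kernel_comm (ρ := max 1 α) (zero_le_one.trans (le_max_left _ _))
    h1 h2 (fun z hz => differentiableAt_weight_of_norm hα t i a hz)
    (fun z hz => differentiableAt_weight_of_norm hα t j b hz)
    (contour_residue_weight hα (by linarith) t i j hab)]

/-- Fubini and the antisymmetry of (u - w)/(1 - u - w). The radii are exchanged along with the
variables, so skewness of Q still requires `Qker_comm_radii`. -/
lemma Qker_swap {α R₁ R₂ : ℝ} (hα : 0 ≤ α) (h1 : max 1 α < R₁) (h2 : max 1 α < R₂)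
    (h : 1 < |R₁ - R₂|) (t : ℝ) (i j : ℕ) (a b : ℤ) :
    Qker α t R₁ R₂ j i b a = -Qker α t R₂ R₁ i j a b := by
  have hpos : (1 : ℝ) ≤ max 1 α := le_max_left _ _
  rw [Qker_eq, Qker_eq, contour_kernel_swap (by linarith) (by linarith) h
    (fun z hz => (differentiableAt_weight_of_norm hα t j b (by rwa [hz])).continuousAt)
    (fun z hz => (differentiableAt_weight_of_norm hα t i a (by rwa [hz])).continuousAt),
    ← mul_neg, ← contour_neg]
  congr 2
  funext w
  rw [← contour_neg]
  congr 1
  funext u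
  rw [sub_right_comm, ← neg_sub w u, neg_div]
  ring

lemma Qker_skew {α R₁ R₂ : ℝ} (hα : 0 ≤ α) (h1 : max 1 α < R₁) (h2 : max 1 α < R₂)
    (h : 1 < |R₁ - R₂|) (t : ℝ) (i j : ℕ) {a b : ℤ} (hab : 1 ≤ a + b) :
    Qker α t R₁ R₂ j i b a = -Qker α t R₁ R₂ i j a b := by
  rw [Qker_swap hα h1 h2 h]
  rw [lt_abs] at h
  obtain h | h := h
  · rw [Qker_comm_radii hα h2 (by linarith) t i j hab]
  · rw [Qker_comm_radii hα h1 (by linarith) t i j hab]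

lemma pker_eq_of_radii {α R R' : ℝ} (hα : 0 ≤ α) (h1 : max 1 α < R) (h2 : max 1 α < R') (t : ℝ)
    (i : ℕ) (a : ℤ) : pker α t R i a = pker α t R' i a := by
  have hpos : (1 : ℝ) ≤ max 1 α := le_max_left _ _
  unfold pker
  wlog h : R ≤ R' generalizing R R'
  · exact (this h2 h1 (le_of_not_ge h)).symm
  rw [contour_eq_of_annulus (by linarith) h fun z hz _ =>
    differentiableAt_weight_of_norm hα t i a (by linarith)]

/-- Put w on the larger circle. Then 1 - u lies inside it, and without the exponential the
w-integrand is O(w^{-1-a}) with no pole outside. -/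
lemma Qker_time_zero {α R₁ R₂ : ℝ} (hα : 0 ≤ α) (h1 : max 1 α < R₁) (h2 : R₁ + 1 < R₂)
    (i j : ℕ) {a b : ℤ} (ha : 1 ≤ a) (hb : 1 ≤ b) : Qker α 0 R₁ R₂ i j a b = 0 := by
  have hpos : (1 : ℝ) ≤ max 1 α := le_max_left _ _
  rw [Qker_comm_radii hα h1 h2 0 i j (by omega), Qker_eq]
  have : contour R₁ (fun u => contour R₂ fun w =>
      (u - w) / (1 - u - w) * weight α 0 i a w * weight α 0 j b u) =
      contour R₁ fun u => (0 : ℂ) * 0 := by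
    refine contour_congr (by linarith) fun u hu => ?_
    have hne : ∀ w : ℂ, R₂ ≤ ‖w‖ → 1 - u - w ≠ 0 := fun w hw => one_sub_sub_ne_zero (by
      rw [hu]; exact lt_of_lt_of_le (by linarith) (le_abs_self _))
    rw [zero_mul]
    refine contour_eq_zero_of_decay (by linarith) (fun w hw =>
      ((differentiableAt_kernel_right (hne w hw)).mul
        (differentiableAt_weight_of_norm hα 0 i a (by linarith))).mul_const _) ?_
    have h3 : Tendsto (fun w : ℂ => u * (w⁻¹ * (w / (w - (1 - u)))) - w / (w - (1 - u)))
        (Bornology.cobounded ℂ) (𝓝 (u * (0 * 1) - 1)) :=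
      ((tendsto_inv₀_cobounded.mul (tendsto_div_sub (1 - u))).const_mul u).sub
        (tendsto_div_sub (1 - u))
    have h := ((((tendsto_zpow_neg (by omega : 0 < a)).mul ((tendsto_div_sub 1).pow i)).mul
      (tendsto_div_sub (α : ℂ))).mul h3).mul_const (-weight α 0 j b u)
    simp only [zero_mul] at h
    refine h.congr' ?_
    filter_upwards [Bornology.eventually_ne_cobounded (0 : ℂ),
      Bornology.eventually_ne_cobounded (1 - u)] with z h0 h1
    have e : u * (z⁻¹ * (z / (z - (1 - u)))) - z / (z - (1 - u)) = -((u - z) / (1 - u - z)) := by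
      have h1' := sub_ne_zero.2 h1
      rw [show 1 - u - z = -(z - (1 - u)) by ring, div_neg, neg_neg]
      field_simp
    rw [e, weight_eq_of_ne α 0 i a h0]
    simp
    ring
  rw [this, contour_const_mul, zero_mul, mul_zero]

end Weights
end HalfTASEP

namespace HalfTASEP
-- Algebraic relations between the kernels
section FunctionSpace

open Filter Topology

/-! ### Relations between the kernels -/

lemma weight_succ_mul (α t : ℝ) (i : ℕ) (a : ℤ) {w : ℂ} (h0 : w ≠ 0) (h1 : w ≠ 1) :
    (w - 1) * weight α t (i + 1) a w = w * weight α t i a w := by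
  have := sub_ne_zero.2 h1
  unfold weight
  rw [show ((i + 1 : ℕ) : ℤ) - a = ((i : ℤ) - a) + 1 by push_cast; ring, zpow_add_one₀ h0, pow_succ,
    ← mul_assoc, div_eq_mul_inv, div_eq_mul_inv, mul_inv _ (w - 1)]
  field_simp

/-- Source of the exclusion rule: a unit shift of position in one row reproduces the row with the
preceding index. -/
lemma weight_sub_weight_succ (α t : ℝ) (i : ℕ) (a : ℤ) {w : ℂ} (h0 : w ≠ 0) (h1 : w ≠ 1) :
    weight α t (i + 1) a w - weight α t (i + 1) (a + 1) w = weight α t i a w := by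
  have := sub_ne_zero.2 h1
  unfold weight
  rw [show ((i + 1 : ℕ) : ℤ) - a = ((i : ℤ) - a) + 1 by push_cast; ring, zpow_add_one₀ h0,
    show ((i + 1 : ℕ) : ℤ) - (a + 1) = (i : ℤ) - a by push_cast; ring, pow_succ, ← mul_assoc,
    div_eq_mul_inv, div_eq_mul_inv, mul_inv _ (w - 1)]
  field_simp

/-- The factor w - 1 is also the effect of the time derivative; this identifies it with a discrete
difference in the position. -/
lemma weight_pred (α t : ℝ) (i : ℕ) (a : ℤ) {w : ℂ} (h0 : w ≠ 0) :
    weight α t i (a - 1) w - weight α t i a w = (w - 1) * weight α t i a w := by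
  unfold weight
  rw [show (i : ℤ) - (a - 1) = ((i : ℤ) - a) + 1 by ring, zpow_add_one₀ h0]
  ring

lemma weight_one_sub (α t : ℝ) {w : ℂ} (hα : w ≠ α) :
    weight α t 1 0 w - α * weight α t 1 1 w = Complex.exp (t * (w - 1)) / (w - 1) := by
  have := sub_ne_zero.2 hα
  unfold weight
  simp only [Nat.cast_one, sub_zero, zpow_one, sub_self, zpow_zero, pow_one, one_mul]
  rw [← mul_div_assoc, ← sub_div, ← mul_div_mul_left _ (w - 1) this]
  ring

lemma weight_eq_mul_exp (α t : ℝ) (i : ℕ) (a : ℤ) (w : ℂ) :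
    weight α t i a w = weight α 0 i a w * Complex.exp (t * (w - 1)) := by
  unfold weight
  simp
  ring

lemma continuous_weight_circleMap {α R : ℝ} (hα : 0 ≤ α) (hR : max 1 α < R) (t : ℝ) (i : ℕ)
    (a : ℤ) : Continuous fun θ => weight α t i a (circleMap 0 R θ) :=
  continuous_comp_circleMap (by linarith [le_max_left 1 α]) fun z hz =>
    (differentiableAt_weight_of_norm hα t i a (by rwa [hz])).continuousAt

/-- Differences of double contour integrals, as a double contour integral. -/
lemma contour_kernel_sub {R₁ R₂ : ℝ} (h1 : 0 ≤ R₁) (h2 : 0 ≤ R₂) (h : 1 < |R₁ - R₂|)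
    {f g f' g' : ℂ → ℂ} (hf : Continuous fun θ => f (circleMap 0 R₁ θ))
    (hg : Continuous fun θ => g (circleMap 0 R₂ θ)) (hf' : Continuous fun θ => f' (circleMap 0 R₁ θ))
    (hg' : Continuous fun θ => g' (circleMap 0 R₂ θ)) (c : ℂ) :
    contour R₂ (fun u => contour R₁ fun w => (u - w) / (1 - u - w) * f w * g u) -
      c * contour R₂ (fun u => contour R₁ fun w => (u - w) / (1 - u - w) * f' w * g' u) =
      contour R₂ fun u => contour R₁ fun w =>
        (u - w) / (1 - u - w) * (f w * g u - c * (f' w * g' u)) := by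
  have hker : ∀ {f g : ℂ → ℂ} (_ : Continuous fun θ => f (circleMap 0 R₁ θ))
      (_ : Continuous fun θ => g (circleMap 0 R₂ θ)),
      Continuous fun p : ℝ × ℝ => (circleMap 0 R₂ p.1 - circleMap 0 R₁ p.2) /
        (1 - circleMap 0 R₂ p.1 - circleMap 0 R₁ p.2) * f (circleMap 0 R₁ p.2) *
          g (circleMap 0 R₂ p.1) := fun hf hg =>
    ((continuous_kernel_circleMap h1 h2 h).mul (hf.comp continuous_snd)).mul
      (hg.comp continuous_fst)
  have houter : ∀ {f g : ℂ → ℂ} (_ : Continuous fun θ => f (circleMap 0 R₁ θ))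
      (_ : Continuous fun θ => g (circleMap 0 R₂ θ)),
      Continuous fun θ => contour R₁ fun w => (circleMap 0 R₂ θ - w) /
        (1 - circleMap 0 R₂ θ - w) * f w * g (circleMap 0 R₂ θ) := fun {f g} hf hg =>
    continuous_contour (K := fun θ w => (circleMap 0 R₂ θ - w) / (1 - circleMap 0 R₂ θ - w) * f w *
      g (circleMap 0 R₂ θ)) (hker hf hg)
  have hinner : ∀ {f g : ℂ → ℂ} (_ : Continuous fun θ => f (circleMap 0 R₁ θ)) (u : ℂ) (_ : ‖u‖ = R₂),
      Continuous fun θ => (u - circleMap 0 R₁ θ) / (1 - u - circleMap 0 R₁ θ) *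
        f (circleMap 0 R₁ θ) * g u := fun {f g} hf u hu => by
    refine ((Continuous.div (by fun_prop) (by fun_prop) fun θ => one_sub_sub_ne_zero ?_).mul
      hf).mul_const _
    rwa [norm_circleMap_zero h1, hu]
  rw [← contour_const_mul, ← contour_sub (houter hf hg) ((houter hf' hg').const_mul c)]
  refine contour_congr h2 fun u hu => ?_
  rw [← contour_const_mul, ← contour_sub (hinner (g := g) hf u hu)
    ((hinner (g := g') hf' u hu).const_mul c)]
  congr 1
  funext w
  ring

/-- Raising both indices multiplies the integrand by uw/((u-1)(w-1)). Subtracting 1 gives the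
numerator u + w - 1, which cancels the denominator of the kernel; what remains, (w-u)/((u-1)(w-1)),
is a difference of functions of one variable, and the integral factorizes. -/
lemma Qker_succ_succ {α R₁ R₂ : ℝ} (hα : 0 ≤ α) (h1 : max 1 α < R₁) (h2 : max 1 α < R₂)
    (h : 1 < |R₁ - R₂|) (t : ℝ) (i j : ℕ) (a b : ℤ) :
    Qker α t R₁ R₂ (i + 1) (j + 1) a b = Qker α t R₁ R₂ i j a b -
      (α : ℂ) ^ 2 * (contour R₁ (weight α t (i + 1) a) * contour R₂ (weight α t j b) -
        contour R₁ (weight α t i a) * contour R₂ (weight α t (j + 1) b)) := by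
  have hpos : (1 : ℝ) ≤ max 1 α := le_max_left _ _
  have hR₁ : 0 ≤ R₁ := by linarith
  have hR₂ : 0 ≤ R₂ := by linarith
  have hc1 := fun i a => continuous_weight_circleMap hα h1 t i a
  have hc2 := fun i a => continuous_weight_circleMap hα h2 t i a
  have key := contour_kernel_sub hR₁ hR₂ h (hc1 (i + 1) a) (hc2 (j + 1) b) (hc1 i a) (hc2 j b) 1
  have key' : contour R₂ (fun u => contour R₁ fun w => (u - w) / (1 - u - w) *
      (weight α t (i + 1) a w * weight α t (j + 1) b u -
        1 * (weight α t i a w * weight α t j b u))) =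
      contour R₁ (weight α t i a) * contour R₂ (weight α t (j + 1) b) -
        contour R₁ (weight α t (i + 1) a) * contour R₂ (weight α t j b) := by
    rw [← contour_const_mul, ← contour_const_mul,
      ← contour_sub ((hc2 _ _).const_mul _) ((hc2 _ _).const_mul _)]
    refine contour_congr hR₂ fun u hu => ?_
    obtain ⟨u0, u1, -⟩ := ne_of_max_lt_norm hα (w := u) (by rwa [hu])
    rw [mul_comm, ← contour_const_mul, mul_comm _ (weight α t j b u),
      ← contour_const_mul, ← contour_sub ((hc1 _ _).const_mul _) ((hc1 _ _).const_mul _)]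
    refine contour_congr hR₁ fun w hw => ?_
    obtain ⟨w0, w1, -⟩ := ne_of_max_lt_norm hα (w := w) (by rwa [hw])
    have hne : 1 - u - w ≠ 0 := one_sub_sub_ne_zero (by rwa [hu, hw])
    have w1' := sub_ne_zero.2 w1
    have u1' := sub_ne_zero.2 u1
    rw [eq_div_of_mul_eq w1' ((mul_comm _ _).trans (weight_succ_mul α t i a w0 w1)),
      eq_div_of_mul_eq u1' ((mul_comm _ _).trans (weight_succ_mul α t j b u0 u1))]
    field_simp
    ring
  rw [Qker_eq, Qker_eq]
  linear_combination (α : ℂ) ^ 2 * key + (α : ℂ) ^ 2 * key'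

/-- The combination removes the pole at α. Since R₁ + 1 < R₂, the pole 1 - u lies outside the
w-circle, so w = 1 is the only pole inside, and its residue -(u-1)/u lowers the index of the other
weight. -/
lemma Qker_one_sub {α R₁ R₂ : ℝ} (hα : 0 ≤ α) (h1 : max 1 α < R₁) (h2 : R₁ + 1 < R₂)
    (t : ℝ) (j : ℕ) (b : ℤ) :
    Qker α t R₁ R₂ 1 (j + 1) 0 b - α * Qker α t R₁ R₂ 1 (j + 1) 1 b =
      -((α : ℂ) ^ 2 * contour R₂ (weight α t j b)) := by
  have hpos : (1 : ℝ) ≤ max 1 α := le_max_left _ _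
  have hR₁ : 0 ≤ R₁ := by linarith
  have hR₂ : 0 ≤ R₂ := by linarith
  have h2' : max 1 α < R₂ := by linarith
  have h : 1 < |R₁ - R₂| := by
    rw [abs_sub_comm]; exact lt_of_lt_of_le (by linarith) (le_abs_self _)
  have hc1 := fun i a => continuous_weight_circleMap hα h1 t i a
  have hc2 := fun i a => continuous_weight_circleMap hα h2' t i a
  have key := contour_kernel_sub hR₁ hR₂ h (hc1 1 0) (hc2 (j + 1) b) (hc1 1 1) (hc2 (j + 1) b) α
  have key' : contour R₂ (fun u => contour R₁ fun w => (u - w) / (1 - u - w) *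
      (weight α t 1 0 w * weight α t (j + 1) b u -
        α * (weight α t 1 1 w * weight α t (j + 1) b u))) = -contour R₂ (weight α t j b) := by
    rw [← contour_neg]
    refine contour_congr hR₂ fun u hu => ?_
    obtain ⟨u0, u1, -⟩ := ne_of_max_lt_norm hα (w := u) (by rwa [hu])
    have e : contour R₁ (fun w => (u - w) / (1 - u - w) *
        (weight α t 1 0 w * weight α t (j + 1) b u -
          α * (weight α t 1 1 w * weight α t (j + 1) b u))) =
        contour R₁ fun w => ((u - w) / (1 - u - w) * Complex.exp (t * (w - 1)) *
          weight α t (j + 1) b u) / (w - 1) := by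
      refine contour_congr hR₁ fun w hw => ?_
      obtain ⟨-, -, wα⟩ := ne_of_max_lt_norm hα (w := w) (by rwa [hw])
      linear_combination (u - w) / (1 - u - w) * weight α t (j + 1) b u * weight_one_sub α t wα
    rw [e, contour_div_sub (by simp; linarith)]
    · have eu := weight_succ_mul α t j b u0 u1
      simp only [sub_self, mul_zero, Complex.exp_zero, mul_one]
      rw [div_mul_eq_mul_div, eu, show 1 - u - 1 = -u by ring, div_neg, mul_div_cancel_left₀ _ u0]
    · intro w hw
      have hne : 1 - u - w ≠ 0 := by
        intro h0
        have e' : u = 1 - w := by linear_combination -h0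
        have := norm_sub_le (1 : ℂ) w
        rw [← e', hu, norm_one] at this
        linarith
      exact ((differentiableAt_kernel_right hne).mul (by fun_prop)).mul_const _
  rw [Qker_eq, Qker_eq]
  linear_combination (α : ℂ) ^ 2 * key + (α : ℂ) ^ 2 * key'

lemma contour_weight_one_sub {α R : ℝ} (hα : 0 ≤ α) (hR : max 1 α < R) (t : ℝ) :
    contour R (weight α t 1 0) - α * contour R (weight α t 1 1) = 1 := by
  have hpos : (1 : ℝ) ≤ max 1 α := le_max_left _ _
  have hc := continuous_weight_circleMap hα hR t
  rw [← contour_const_mul, ← contour_sub (hc _ _) ((hc _ _).const_mul _),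
    contour_congr (by linarith) (g := fun w => Complex.exp (t * (w - 1)) / (w - 1)),
    contour_div_sub (by simp; linarith)]
  · simp
  · intro w _; fun_prop
  · intro w hw
    obtain ⟨-, -, wα⟩ := ne_of_max_lt_norm hα (w := w) (by rwa [hw])
    exact weight_one_sub α t wα

end FunctionSpace
end HalfTASEP

namespace HalfTASEP
-- Kernels as forms and functionals on boundary values
section BoundaryForm

/-- Boundary values of functions on the two contours. -/
abbrev Bdry : Type := C(ℝ, ℂ) × C(ℝ, ℂ)

open Classical in
/-- A function as a continuous map (`0` if it is not continuous). -/
noncomputable def toCM {X : Type*} [TopologicalSpace X] (f : X → ℂ) : C(X, ℂ) :=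
  if h : Continuous f then ⟨f, h⟩ else 0

lemma toCM_apply {X : Type*} [TopologicalSpace X] {f : X → ℂ} (h : Continuous f) (x : X) :
    toCM f x = f x := by
  simp [toCM, h]

/-- The boundary values of the function `weight α t i a`. -/
noncomputable def weightVec (α R₁ R₂ t : ℝ) (i : ℕ) (a : ℤ) : Bdry :=
  (toCM fun θ => weight α t i a (circleMap 0 R₁ θ), toCM fun θ => weight α t i a (circleMap 0 R₂ θ))

/-- `f ↦ ∫₀^{2π} c θ * f θ dθ`. -/
noncomputable def integralAgainst (c : C(ℝ, ℂ)) : C(ℝ, ℂ) →ₗ[ℂ] ℂ where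
  toFun f := ∫ θ in (0 : ℝ)..2 * Real.pi, c θ * f θ
  map_add' f g := by
    rw [← intervalIntegral.integral_add ((by fun_prop : Continuous fun θ => c θ *
      f θ).intervalIntegrable _ _) ((by fun_prop : Continuous fun θ => c θ *
      g θ).intervalIntegrable _ _)]
    simp [mul_add]
  map_smul' r f := by
    rw [RingHom.id_apply, smul_eq_mul, ← intervalIntegral.integral_const_mul]
    congr 1; funext θ; simp; ring

/-- `(f, g) ↦ ∫₀^{2π} ∫₀^{2π} κ (θ, φ) * f φ * g θ dφ dθ`. -/
noncomputable def integralForm (κ : C(ℝ × ℝ, ℂ)) : C(ℝ, ℂ) →ₗ[ℂ] C(ℝ, ℂ) →ₗ[ℂ] ℂ :=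
  have hc : ∀ f g : C(ℝ, ℂ), Continuous fun θ : ℝ =>
      ∫ φ in (0 : ℝ)..2 * Real.pi, κ (θ, φ) * f φ * g θ := fun f g =>
    intervalIntegral.continuous_parametric_intervalIntegral_of_continuous'
      (f := fun θ φ => κ (θ, φ) * f φ * g θ) (by unfold Function.uncurry; fun_prop) _ _
  have hi : ∀ (f g : C(ℝ, ℂ)) (θ : ℝ), Continuous fun φ : ℝ => κ (θ, φ) * f φ * g θ :=
    fun f g θ => by fun_prop
  LinearMap.mk₂ ℂ (fun f g => ∫ θ in (0 : ℝ)..2 * Real.pi, ∫ φ in (0 : ℝ)..2 * Real.pi,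
      κ (θ, φ) * f φ * g θ)
    (fun f f' g => by
      rw [← intervalIntegral.integral_add ((hc f g).intervalIntegrable _ _)
        ((hc f' g).intervalIntegrable _ _)]
      congr 1; funext θ
      rw [← intervalIntegral.integral_add ((hi f g θ).intervalIntegrable _ _)
        ((hi f' g θ).intervalIntegrable _ _)]
      congr 1; funext φ
      simp; ring)
    (fun r f g => by
      rw [smul_eq_mul, ← intervalIntegral.integral_const_mul]
      congr 1; funext θ
      rw [← intervalIntegral.integral_const_mul]
      congr 1; funext φ
      simp; ring)
    (fun f g g' => by
      rw [← intervalIntegral.integral_add ((hc f g).intervalIntegrable _ _)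
        ((hc f g').intervalIntegrable _ _)]
      congr 1; funext θ
      rw [← intervalIntegral.integral_add ((hi f g θ).intervalIntegrable _ _)
        ((hi f g' θ).intervalIntegrable _ _)]
      congr 1; funext φ
      simp; ring)
    (fun r f g => by
      rw [smul_eq_mul, ← intervalIntegral.integral_const_mul]
      congr 1; funext θ
      rw [← intervalIntegral.integral_const_mul]
      congr 1; funext φ
      simp; ring)

lemma integralForm_apply (κ : C(ℝ × ℝ, ℂ)) (f g : C(ℝ, ℂ)) : integralForm κ f g =
    ∫ θ in (0 : ℝ)..2 * Real.pi, ∫ φ in (0 : ℝ)..2 * Real.pi, κ (θ, φ) * f φ * g θ := rfl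

lemma integralAgainst_apply (c f : C(ℝ, ℂ)) :
    integralAgainst c f = ∫ θ in (0 : ℝ)..2 * Real.pi, c θ * f θ := rfl

/-- The kernel of the double contour integral, in the angles of `u` and `w`. -/
noncomputable def angleKernel (α R₁ R₂ : ℝ) : C(ℝ × ℝ, ℂ) :=
  toCM fun p => (α : ℂ) ^ 2 * circleDensity R₂ p.1 * circleDensity R₁ p.2 *
    ((circleMap 0 R₂ p.1 - circleMap 0 R₁ p.2) / (1 - circleMap 0 R₂ p.1 - circleMap 0 R₁ p.2))

/-- The skew form with `qForm f g = Q(f, g)` on boundary values, antisymmetrized. -/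
noncomputable def qForm (α R₁ R₂ : ℝ) : Bdry →ₗ[ℂ] Bdry →ₗ[ℂ] ℂ :=
  LinearMap.mk₂ ℂ (fun x y => (integralForm (angleKernel α R₁ R₂) x.1 y.2 -
      integralForm (angleKernel α R₁ R₂) y.1 x.2) / 2)
    (fun x x' y => by simp; ring) (fun c x y => by simp; ring)
    (fun x y y' => by simp; ring) (fun c x y => by simp; ring)

lemma qForm_apply (α R₁ R₂ : ℝ) (x y : Bdry) : qForm α R₁ R₂ x y =
    (integralForm (angleKernel α R₁ R₂) x.1 y.2 -
      integralForm (angleKernel α R₁ R₂) y.1 x.2) / 2 := rfl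

lemma qForm_skew (α R₁ R₂ : ℝ) (x y : Bdry) : qForm α R₁ R₂ x y = -qForm α R₁ R₂ y x := by
  rw [qForm_apply, qForm_apply]; ring

/-- The functional `f ↦ ∮ f(w) dw / (2 π i)` on the circle of radius `R`. -/
noncomputable def contourDual (R : ℝ) : Module.Dual ℂ Bdry :=
  (integralAgainst (toCM (circleDensity R))).comp (LinearMap.fst ℂ _ _)

/-- The functional `f ↦ ∮ f(w) (w - α) (w - 1)^e w^m dw / (2 π i)` on the circle of radius `R`. -/
noncomputable def momentDual (α R : ℝ) (e : ℕ) (m : ℤ) : Module.Dual ℂ Bdry :=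
  (integralAgainst (toCM fun θ => circleDensity R θ * ((circleMap 0 R θ - α) *
    (circleMap 0 R θ - 1) ^ e * circleMap 0 R θ ^ m))).comp (LinearMap.fst ℂ _ _)

section

variable {α R₁ R₂ : ℝ}

lemma weightVec_fst_apply (hα : 0 ≤ α) (h1 : max 1 α < R₁) (t : ℝ) (i : ℕ) (a : ℤ) (θ : ℝ) :
    (weightVec α R₁ R₂ t i a).1 θ = weight α t i a (circleMap 0 R₁ θ) :=
  toCM_apply (continuous_weight_circleMap hα h1 t i a) θ

lemma weightVec_snd_apply (hα : 0 ≤ α) (h2 : max 1 α < R₂) (t : ℝ) (i : ℕ) (a : ℤ) (θ : ℝ) :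
    (weightVec α R₁ R₂ t i a).2 θ = weight α t i a (circleMap 0 R₂ θ) :=
  toCM_apply (continuous_weight_circleMap hα h2 t i a) θ

lemma circleMap_ne {R : ℝ} (hα : 0 ≤ α) (hR : max 1 α < R) (θ : ℝ) :
    circleMap 0 R θ ≠ 0 ∧ circleMap 0 R θ ≠ 1 ∧ circleMap 0 R θ ≠ α :=
  ne_of_max_lt_norm hα (by rwa [norm_circleMap_zero (by linarith [le_max_left 1 α])])

lemma weightVec_sub_weightVec_succ (hα : 0 ≤ α) (h1 : max 1 α < R₁) (h2 : max 1 α < R₂) (t : ℝ)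
    (i : ℕ) (a : ℤ) : weightVec α R₁ R₂ t (i + 1) a - weightVec α R₁ R₂ t (i + 1) (a + 1) =
      weightVec α R₁ R₂ t i a := by
  refine Prod.ext (ContinuousMap.ext fun θ => ?_) (ContinuousMap.ext fun θ => ?_)
  · simp only [Prod.fst_sub, ContinuousMap.sub_apply, weightVec_fst_apply hα h1]
    exact weight_sub_weight_succ α t i a (circleMap_ne hα h1 θ).1 (circleMap_ne hα h1 θ).2.1
  · simp only [Prod.snd_sub, ContinuousMap.sub_apply, weightVec_snd_apply hα h2]
    exact weight_sub_weight_succ α t i a (circleMap_ne hα h2 θ).1 (circleMap_ne hα h2 θ).2.1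

lemma angleKernel_apply (h1 : max 1 α < R₁) (h2 : max 1 α < R₂) (h : 1 < |R₁ - R₂|) (p : ℝ × ℝ) :
    angleKernel α R₁ R₂ p = (α : ℂ) ^ 2 * circleDensity R₂ p.1 * circleDensity R₁ p.2 *
    ((circleMap 0 R₂ p.1 - circleMap 0 R₁ p.2) /
      (1 - circleMap 0 R₂ p.1 - circleMap 0 R₁ p.2)) := by
  have hpos : (1 : ℝ) ≤ max 1 α := le_max_left _ _
  exact toCM_apply ((by fun_prop : Continuous fun p : ℝ × ℝ => (α : ℂ) ^ 2 *
    circleDensity R₂ p.1 * circleDensity R₁ p.2).mul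
      (continuous_kernel_circleMap (by linarith) (by linarith) h)) p

lemma integralForm_weightVec (hα : 0 ≤ α) (h1 : max 1 α < R₁) (h2 : max 1 α < R₂)
    (h : 1 < |R₁ - R₂|) (t : ℝ) (i j : ℕ) (a b : ℤ) :
    integralForm (angleKernel α R₁ R₂) (weightVec α R₁ R₂ t i a).1 (weightVec α R₁ R₂ t j b).2 =
      Qker α t R₁ R₂ i j a b := by
  rw [Qker_eq, integralForm_apply]
  simp only [contour_eq_intervalIntegral, weightVec_fst_apply hα h1, weightVec_snd_apply hα h2,
    angleKernel_apply h1 h2 h, ← intervalIntegral.integral_const_mul]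
  congr 1; funext θ
  congr 1; funext φ
  ring

lemma qForm_weightVec (hα : 0 ≤ α) (h1 : max 1 α < R₁) (h2 : max 1 α < R₂)
    (h : 1 < |R₁ - R₂|) (t : ℝ) (i j : ℕ) (a b : ℤ) :
    qForm α R₁ R₂ (weightVec α R₁ R₂ t i a) (weightVec α R₁ R₂ t j b) =
      (Qker α t R₁ R₂ i j a b - Qker α t R₁ R₂ j i b a) / 2 := by
  rw [qForm_apply, integralForm_weightVec hα h1 h2 h, integralForm_weightVec hα h1 h2 h]

/-- Antisymmetrizing changes nothing where Q is already skew. A row shifted to position 0 still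
meets the other rows, at positions ≥ 1, in this range, and its pairing with itself is 0 for the
antisymmetrized form. -/
lemma qForm_weightVec_eq_Qker (hα : 0 ≤ α) (h1 : max 1 α < R₁) (h2 : max 1 α < R₂)
    (h : 1 < |R₁ - R₂|) (t : ℝ) (i j : ℕ) {a b : ℤ} (hab : 1 ≤ a + b) :
    qForm α R₁ R₂ (weightVec α R₁ R₂ t i a) (weightVec α R₁ R₂ t j b) =
      Qker α t R₁ R₂ i j a b := by
  rw [qForm_weightVec hα h1 h2 h, Qker_skew hα h1 h2 h t i j hab]
  ring

lemma contourDual_weightVec (hα : 0 ≤ α) (h1 : max 1 α < R₁) (t : ℝ) (i : ℕ) (a : ℤ) :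
    contourDual R₁ (weightVec α R₁ R₂ t i a) = contour R₁ (weight α t i a) := by
  rw [contour_eq_intervalIntegral]
  simp only [contourDual, LinearMap.comp_apply, LinearMap.fst_apply, integralAgainst_apply,
    weightVec_fst_apply hα h1, toCM_apply (continuous_circleDensity R₁)]

lemma contour_weight_eq_of_radii (hα : 0 ≤ α) (h1 : max 1 α < R₁) (h2 : max 1 α < R₂) (t : ℝ)
    (i : ℕ) (a : ℤ) : contour R₁ (weight α t i a) = contour R₂ (weight α t i a) := by
  have hpos : (1 : ℝ) ≤ max 1 α := le_max_left _ _
  wlog h : R₁ ≤ R₂ generalizing R₁ R₂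
  · exact (this h2 h1 (le_of_not_ge h)).symm
  rw [contour_eq_of_annulus (by linarith) h fun z hz _ =>
    differentiableAt_weight_of_norm hα t i a (by linarith)]

lemma qForm_succ_succ (hα : 0 ≤ α) (h1 : max 1 α < R₁) (h2 : max 1 α < R₂)
    (h : 1 < |R₁ - R₂|) (t : ℝ) (i j : ℕ) (a b : ℤ) :
    qForm α R₁ R₂ (weightVec α R₁ R₂ t (i + 1) a) (weightVec α R₁ R₂ t (j + 1) b) =
      qForm α R₁ R₂ (weightVec α R₁ R₂ t i a) (weightVec α R₁ R₂ t j b) -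
      (α : ℂ) ^ 2 * (contourDual R₁ (weightVec α R₁ R₂ t (i + 1) a) *
          contourDual R₁ (weightVec α R₁ R₂ t j b) -
        contourDual R₁ (weightVec α R₁ R₂ t i a) *
          contourDual R₁ (weightVec α R₁ R₂ t (j + 1) b)) := by
  simp only [qForm_weightVec hα h1 h2 h, contourDual_weightVec hα h1,
    Qker_succ_succ hα h1 h2 h, contour_weight_eq_of_radii hα h2 h1]
  ring

/-- The boundary values of `e^{t(w-1)} / (w-1)`. -/
noncomputable def wallVec (α R₁ R₂ t : ℝ) : Bdry :=
  weightVec α R₁ R₂ t 1 0 - (α : ℂ) • weightVec α R₁ R₂ t 1 1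

lemma contourDual_wallVec (hα : 0 ≤ α) (h1 : max 1 α < R₁) (t : ℝ) :
    contourDual R₁ (wallVec α R₁ R₂ t) = 1 := by
  rw [wallVec, map_sub, map_smul, contourDual_weightVec hα h1, contourDual_weightVec hα h1,
    smul_eq_mul, contour_weight_one_sub hα h1]

lemma qForm_wallVec (hα : 0 ≤ α) (h1 : max 1 α < R₁) (h2 : R₁ + 1 < R₂) (t : ℝ) (j : ℕ) {b : ℤ}
    (hb : 1 ≤ b) : qForm α R₁ R₂ (weightVec α R₁ R₂ t (j + 1) b) (wallVec α R₁ R₂ t) =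
      (α : ℂ) ^ 2 * contourDual R₁ (weightVec α R₁ R₂ t j b) := by
  have h2' : max 1 α < R₂ := by linarith
  have h : 1 < |R₁ - R₂| := by
    rw [abs_sub_comm]; exact lt_of_lt_of_le (by linarith) (le_abs_self _)
  have key := Qker_one_sub hα h1 h2 t j b
  rw [wallVec, map_sub, map_smul, smul_eq_mul, qForm_skew, qForm_skew _ _ _ _ (weightVec _ _ _ _ 1 1),
    qForm_weightVec_eq_Qker hα h1 h2' h t _ _ (by omega),
    qForm_weightVec_eq_Qker hα h1 h2' h t _ _ (by omega), contourDual_weightVec hα h1,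
    contour_weight_eq_of_radii hα h1 h2']
  linear_combination -key

lemma continuous_moment {R : ℝ} (hα : 0 ≤ α) (hR : max 1 α < R) (e : ℕ) (m : ℤ) :
    Continuous fun θ => circleDensity R θ * ((circleMap 0 R θ - α) *
      (circleMap 0 R θ - 1) ^ e * circleMap 0 R θ ^ m) := by
  have : Continuous fun θ => circleMap 0 R θ ^ m :=
    (continuous_circleMap 0 R).zpow₀ m fun θ => Or.inl (circleMap_ne hα hR θ).1
  fun_prop

/-- The factor w - α of the functional cancels the denominator of the weight; this is how the α-free
kernel U becomes a functional on the same rows as Q and p. -/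
lemma momentDual_weightVec (hα : 0 ≤ α) (h1 : max 1 α < R₁) (e : ℕ) (m : ℤ) (t : ℝ) (i : ℕ)
    (a : ℤ) : momentDual α R₁ e m (weightVec α R₁ R₂ t i a) = contour R₁ fun w =>
      (w - 1) ^ ((e : ℤ) - i) * Complex.exp (t * (w - 1)) * w ^ (m + i - a) := by
  rw [contour_eq_intervalIntegral]
  simp only [momentDual, LinearMap.comp_apply, LinearMap.fst_apply, integralAgainst_apply,
    weightVec_fst_apply hα h1, toCM_apply (continuous_moment hα h1 e m)]
  congr 1; funext θ
  obtain ⟨h0, h1', hα'⟩ := circleMap_ne hα h1 θ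
  set w := circleMap 0 R₁ θ
  have e1 := sub_ne_zero.2 h1'
  have e2 := sub_ne_zero.2 hα'
  rw [show m + i - a = m + ((i : ℤ) - a) by ring, zpow_add₀ h0 m, zpow_sub₀ e1, zpow_natCast,
    zpow_natCast, weight]
  field_simp

lemma momentDual_succ (hα : 0 ≤ α) (h1 : max 1 α < R₁) (e : ℕ) (m : ℤ) (t : ℝ) (i : ℕ) (a : ℤ) :
    momentDual α R₁ (e + 1) m (weightVec α R₁ R₂ t (i + 1) a) =
      momentDual α R₁ e (m + 1) (weightVec α R₁ R₂ t i a) := by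
  rw [momentDual_weightVec hα h1, momentDual_weightVec hα h1]
  congr 1; funext w
  push_cast
  rw [show (e : ℤ) + 1 - (i + 1) = e - i by ring, show m + ((i : ℤ) + 1) - a = m + 1 + i - a by ring]

/-- For e ≥ 1 and m ≥ 0 all exponents of w - 1 and w are nonnegative and the integrand is entire. -/
lemma momentDual_wallVec (hα : 0 ≤ α) (h1 : max 1 α < R₁) {e : ℕ} (he : 1 ≤ e) {m : ℤ}
    (hm : 0 ≤ m) (t : ℝ) : momentDual α R₁ e m (wallVec α R₁ R₂ t) = 0 := by
  have hpos : (1 : ℝ) ≤ max 1 α := le_max_left _ _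
  have key : ∀ a : ℤ, a ≤ 1 → momentDual α R₁ e m (weightVec α R₁ R₂ t 1 a) = 0 := by
    intro a ha
    rw [momentDual_weightVec hα h1]
    refine contour_eq_zero_of_disc (by linarith) fun w _ => ?_
    obtain ⟨k, hk⟩ := Int.eq_ofNat_of_zero_le (show 0 ≤ m + (1 : ℕ) - a by push_cast; omega)
    obtain ⟨l, hl⟩ := Int.eq_ofNat_of_zero_le (show 0 ≤ (e : ℤ) - (1 : ℕ) by push_cast; omega)
    simp only [hk, hl, zpow_natCast]
    fun_prop
  rw [wallVec, map_sub, map_smul, key 0 (by omega), key 1 le_rfl]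
  simp

lemma contourDual_time_zero (hα : 0 ≤ α) (h1 : max 1 α < R₁) (i : ℕ) {a : ℤ} (ha : 1 ≤ a) :
    contourDual R₁ (weightVec α R₁ R₂ 0 i a) = 0 := by
  rw [contourDual_weightVec hα h1, contour_weight_zero hα h1 i ha]

lemma qForm_time_zero (hα : 0 ≤ α) (h1 : max 1 α < R₁) (h2 : R₁ + 1 < R₂) (i j : ℕ) {a b : ℤ}
    (ha : 1 ≤ a) (hb : 1 ≤ b) :
    qForm α R₁ R₂ (weightVec α R₁ R₂ 0 i a) (weightVec α R₁ R₂ 0 j b) = 0 := by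
  rw [qForm_weightVec_eq_Qker hα h1 (by linarith)
    (by rw [abs_sub_comm]; exact lt_of_lt_of_le (by linarith) (le_abs_self _)) 0 i j (by omega),
    Qker_time_zero hα h1 h2 i j ha hb]

/-! ### Time derivatives -/

lemma hasDerivAt_weight (α t : ℝ) (i : ℕ) (a : ℤ) (w : ℂ) :
    HasDerivAt (fun s : ℝ => weight α s i a w) ((w - 1) * weight α t i a w) t := by
  have h : HasDerivAt (fun s : ℝ => (s : ℂ) * (w - 1)) (w - 1) t := by
    simpa using (Complex.ofRealCLM.hasDerivAt (x := t)).mul_const (w - 1)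
  rw [show (fun s : ℝ => weight α s i a w) = fun s : ℝ => weight α 0 i a w *
      Complex.exp (s * (w - 1)) from funext fun s => weight_eq_mul_exp α s i a w,
    weight_eq_mul_exp α t i a w]
  exact (h.cexp.const_mul (weight α 0 i a w)).congr_deriv (by ring)

lemma continuous_weight_time {X : Type*} [TopologicalSpace X] {f g : X → ℝ} {R : ℝ} (hα : 0 ≤ α)
    (hR : max 1 α < R) (hf : Continuous f) (hg : Continuous g) (i : ℕ) (a : ℤ) :
    Continuous fun p => weight α (f p) i a (circleMap 0 R (g p)) := by
  have h0 : Continuous fun p => weight α 0 i a (circleMap 0 R (g p)) :=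
    Continuous.comp (g := fun θ => weight α 0 i a (circleMap 0 R θ))
      (continuous_weight_circleMap hα hR 0 i a) hg
  rw [show (fun p => weight α (f p) i a (circleMap 0 R (g p))) = fun p =>
      weight α 0 i a (circleMap 0 R (g p)) * Complex.exp (f p * (circleMap 0 R (g p) - 1)) from
    funext fun p => weight_eq_mul_exp α _ i a _]
  exact h0.mul (by fun_prop)

lemma hasDerivAt_integralAgainst (hα : 0 ≤ α) (h1 : max 1 α < R₁) (c : C(ℝ, ℂ)) (t : ℝ) (i : ℕ)
    (a : ℤ) : HasDerivAt (fun s => integralAgainst c (weightVec α R₁ R₂ s i a).1)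
      (integralAgainst c (weightVec α R₁ R₂ t i (a - 1) - weightVec α R₁ R₂ t i a).1) t := by
  have hcont := continuous_weight_time hα h1 (continuous_fst (X := ℝ) (Y := ℝ)) continuous_snd i a
  simp only [integralAgainst_apply, Prod.fst_sub, ContinuousMap.sub_apply,
    weightVec_fst_apply hα h1, weight_pred α t i a (circleMap_ne hα h1 _).1]
  refine hasDerivAt_intervalIntegral
    (F := fun s θ => c θ * weight α s i a (circleMap 0 R₁ θ))
    (F' := fun s θ => c θ * ((circleMap 0 R₁ θ - 1) * weight α s i a (circleMap 0 R₁ θ)))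
    (fun s => ?_) ?_ (fun s θ => (hasDerivAt_weight α s i a _).const_mul _) _ _ t
  · exact c.continuous.mul (continuous_weight_circleMap hα h1 s i a)
  · unfold Function.uncurry
    fun_prop

lemma hasDerivAt_iterated_integral {F F' : ℝ → ℝ → ℝ → ℂ}
    (hF : Continuous fun p : (ℝ × ℝ) × ℝ => F p.1.1 p.1.2 p.2)
    (hF' : Continuous fun p : (ℝ × ℝ) × ℝ => F' p.1.1 p.1.2 p.2)
    (hd : ∀ s θ φ, HasDerivAt (fun s => F s θ φ) (F' s θ φ) s) (t : ℝ) :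
    HasDerivAt (fun s => ∫ θ in (0 : ℝ)..2 * Real.pi, ∫ φ in (0 : ℝ)..2 * Real.pi, F s θ φ)
      (∫ θ in (0 : ℝ)..2 * Real.pi, ∫ φ in (0 : ℝ)..2 * Real.pi, F' t θ φ) t := by
  have outer : ∀ {G : ℝ → ℝ → ℝ → ℂ}, (Continuous fun p : (ℝ × ℝ) × ℝ => G p.1.1 p.1.2 p.2) →
      Continuous fun p : ℝ × ℝ => ∫ φ in (0 : ℝ)..2 * Real.pi, G p.1 p.2 φ := fun {G} h =>
    intervalIntegral.continuous_parametric_intervalIntegral_of_continuous'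
      (f := fun (p : ℝ × ℝ) φ => G p.1 p.2 φ) h _ _
  exact hasDerivAt_intervalIntegral
    (F := fun s θ => ∫ φ in (0 : ℝ)..2 * Real.pi, F s θ φ)
    (F' := fun s θ => ∫ φ in (0 : ℝ)..2 * Real.pi, F' s θ φ)
    (fun s => (outer hF).comp (Continuous.prodMk_right s)) (outer hF')
    (fun s θ => hasDerivAt_intervalIntegral (F := fun s φ => F s θ φ) (F' := fun s φ => F' s θ φ)
      (fun s => hF.comp (Continuous.prodMk_right (s, θ)))
      (hF'.comp (by fun_prop : Continuous fun p : ℝ × ℝ => ((p.1, θ), p.2)))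
      (fun s φ => hd s θ φ) _ _ s) _ _ t

lemma hasDerivAt_integralForm (hα : 0 ≤ α) (h1 : max 1 α < R₁) (h2 : max 1 α < R₂)
    (κ : C(ℝ × ℝ, ℂ)) (t : ℝ) (i j : ℕ) (a b : ℤ) :
    HasDerivAt (fun s => integralForm κ (weightVec α R₁ R₂ s i a).1 (weightVec α R₁ R₂ s j b).2)
      (integralForm κ (weightVec α R₁ R₂ t i (a - 1) - weightVec α R₁ R₂ t i a).1
          (weightVec α R₁ R₂ t j b).2 +
        integralForm κ (weightVec α R₁ R₂ t i a).1
          (weightVec α R₁ R₂ t j (b - 1) - weightVec α R₁ R₂ t j b).2) t := by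
  have cf : Continuous fun p : (ℝ × ℝ) × ℝ => weight α p.1.1 i a (circleMap 0 R₁ p.2) :=
    continuous_weight_time hα h1 (by fun_prop) continuous_snd i a
  have cg : Continuous fun p : (ℝ × ℝ) × ℝ => weight α p.1.1 j b (circleMap 0 R₂ p.1.2) :=
    continuous_weight_time hα h2 (by fun_prop) (by fun_prop) j b
  have ck : Continuous fun p : (ℝ × ℝ) × ℝ => κ (p.1.2, p.2) :=
    κ.continuous.comp (by fun_prop : Continuous fun p : (ℝ × ℝ) × ℝ => (p.1.2, p.2))
  have cw : Continuous fun p : (ℝ × ℝ) × ℝ => circleMap 0 R₁ p.2 + circleMap 0 R₂ p.1.2 - 2 := by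
    fun_prop
  have key := hasDerivAt_iterated_integral
    (F := fun s θ φ => κ (θ, φ) *
      (weight α s i a (circleMap 0 R₁ φ) * weight α s j b (circleMap 0 R₂ θ)))
    (F' := fun s θ φ => κ (θ, φ) * ((circleMap 0 R₁ φ + circleMap 0 R₂ θ - 2) *
      (weight α s i a (circleMap 0 R₁ φ) * weight α s j b (circleMap 0 R₂ θ))))
    (ck.mul (cf.mul cg)) (ck.mul (cw.mul (cf.mul cg)))
    (fun s θ φ => (((hasDerivAt_weight α s i a _).mul
      (hasDerivAt_weight α s j b _)).const_mul _).congr_deriv (by ring)) t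
  have hform : ∀ s, integralForm κ (weightVec α R₁ R₂ s i a).1 (weightVec α R₁ R₂ s j b).2 =
      ∫ θ in (0 : ℝ)..2 * Real.pi, ∫ φ in (0 : ℝ)..2 * Real.pi, κ (θ, φ) *
        (weight α s i a (circleMap 0 R₁ φ) * weight α s j b (circleMap 0 R₂ θ)) := fun s => by
    simp only [integralForm_apply, weightVec_fst_apply hα h1, weightVec_snd_apply hα h2, mul_assoc]
  rw [funext hform]
  refine key.congr_deriv ?_
  have hc : ∀ f g : C(ℝ, ℂ), Continuous fun θ : ℝ =>
      ∫ φ in (0 : ℝ)..2 * Real.pi, κ (θ, φ) * f φ * g θ := fun f g =>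
    intervalIntegral.continuous_parametric_intervalIntegral_of_continuous'
      (f := fun θ φ => κ (θ, φ) * f φ * g θ) (by unfold Function.uncurry; fun_prop) _ _
  have hs : ∀ (f g : C(ℝ, ℂ)) (θ : ℝ), Continuous fun φ : ℝ => κ (θ, φ) * f φ * g θ :=
    fun f g θ => by fun_prop
  rw [integralForm_apply, integralForm_apply, ← intervalIntegral.integral_add
    ((hc _ _).intervalIntegrable _ _) ((hc _ _).intervalIntegrable _ _)]
  congr 1; funext θ
  rw [← intervalIntegral.integral_add
    ((hs _ _ θ).intervalIntegrable _ _) ((hs _ _ θ).intervalIntegrable _ _)]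
  congr 1; funext φ
  simp only [Prod.fst_sub, Prod.snd_sub, ContinuousMap.sub_apply,
    weightVec_fst_apply hα h1, weightVec_snd_apply hα h2,
    weight_pred α t i a (circleMap_ne hα h1 _).1, weight_pred α t j b (circleMap_ne hα h2 _).1]
  ring

lemma hasDerivAt_qForm (hα : 0 ≤ α) (h1 : max 1 α < R₁) (h2 : max 1 α < R₂)
    (t : ℝ) (i j : ℕ) (a b : ℤ) :
    HasDerivAt (fun s => qForm α R₁ R₂ (weightVec α R₁ R₂ s i a) (weightVec α R₁ R₂ s j b))
      (qForm α R₁ R₂ (weightVec α R₁ R₂ t i (a - 1) - weightVec α R₁ R₂ t i a)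
          (weightVec α R₁ R₂ t j b) +
        qForm α R₁ R₂ (weightVec α R₁ R₂ t i a)
          (weightVec α R₁ R₂ t j (b - 1) - weightVec α R₁ R₂ t j b)) t := by
  simp only [qForm_apply]
  refine (((hasDerivAt_integralForm hα h1 h2 (angleKernel α R₁ R₂) t i j a b).sub
    (hasDerivAt_integralForm hα h1 h2 (angleKernel α R₁ R₂) t j i b a)).div_const 2).congr_deriv ?_
  ring

lemma hasDerivAt_contourDual (hα : 0 ≤ α) (h1 : max 1 α < R₁) (t : ℝ) (i : ℕ) (a : ℤ) :
    HasDerivAt (fun s => contourDual R₁ (weightVec α R₁ R₂ s i a))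
      (contourDual R₁ (weightVec α R₁ R₂ t i (a - 1) - weightVec α R₁ R₂ t i a)) t :=
  hasDerivAt_integralAgainst hα h1 _ t i a

lemma hasDerivAt_momentDual (hα : 0 ≤ α) (h1 : max 1 α < R₁) (e : ℕ) (m : ℤ) (t : ℝ) (i : ℕ)
    (a : ℤ) : HasDerivAt (fun s => momentDual α R₁ e m (weightVec α R₁ R₂ s i a))
      (momentDual α R₁ e m (weightVec α R₁ R₂ t i (a - 1) - weightVec α R₁ R₂ t i a)) t :=
  hasDerivAt_integralAgainst hα h1 _ t i a

end

end BoundaryForm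
end HalfTASEP

namespace HalfTASEP
-- Evolution and boundary identities of the Pfaffian
section Dynamics

variable {α R₁ R₂ : ℝ}

lemma pfSeq_update_zero {V : Type*} [AddCommGroup V] [Module ℂ V] (ω : V →ₗ[ℂ] V →ₗ[ℂ] ℂ) {n : ℕ}
    (u : ℕ → V) {k : ℕ} (hk : k < 2 * n) : pfSeq ω n (Function.update u k 0) = 0 := by
  rw [← zero_smul ℂ (0 : V), pfSeq_update_smul _ _ _ hk, zero_mul]

lemma pfSeq_update_sub {V : Type*} [AddCommGroup V] [Module ℂ V] (ω : V →ₗ[ℂ] V →ₗ[ℂ] ℂ) {n : ℕ}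
    (u : ℕ → V) {k : ℕ} (hk : k < 2 * n) (x y : V) : pfSeq ω n (Function.update u k (x - y)) =
      pfSeq ω n (Function.update u k x) - pfSeq ω n (Function.update u k y) := by
  rw [eq_sub_iff_add_eq, ← pfSeq_update_add _ _ _ hk, sub_add_cancel]

lemma rowSeq_update {F : Type*} [AddCommGroup F] [Module ℂ F] {N j : ℕ} (hj : j < N) (f : ℕ → F)
    (φ : ℕ → Module.Dual ℂ F) (v : F) :
    rowSeq N (Function.update f j v) φ = Function.update (rowSeq N f φ) j (v, 0) := by
  funext i
  by_cases hi : i = j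
  · subst hi; simp [rowSeq, hj]
  · simp [rowSeq, Function.update_of_ne hi]

/-- The rows `weightVec α R₁ R₂ t (i + 1) (a i)`. -/
noncomputable def rowVec (α R₁ R₂ t : ℝ) (a : ℕ → ℤ) : ℕ → Bdry :=
  fun i => weightVec α R₁ R₂ t (i + 1) (a i)

lemma rowVec_update (α R₁ R₂ t : ℝ) (a : ℕ → ℤ) (j : ℕ) (b : ℤ) :
    rowVec α R₁ R₂ t (Function.update a j b) =
      Function.update (rowVec α R₁ R₂ t a) j (weightVec α R₁ R₂ t (j + 1) b) := by
  funext i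
  by_cases hi : i = j
  · subst hi; simp [rowVec]
  · simp [rowVec, Function.update_of_ne hi]

lemma hasDerivAt_pfRow (hα : 0 ≤ α) (h1 : max 1 α < R₁) (h2 : max 1 α < R₂) {n N : ℕ}
    (hN : N ≤ 2 * n) {ψ : ℕ → Module.Dual ℂ Bdry} (t : ℝ)
    (hψ : ∀ k i a, HasDerivAt (fun s => ψ k (weightVec α R₁ R₂ s i a))
      (ψ k (weightVec α R₁ R₂ t i (a - 1) - weightVec α R₁ R₂ t i a)) t) (a : ℕ → ℤ) :
    HasDerivAt (fun s => pfRow (qForm α R₁ R₂) n N (rowVec α R₁ R₂ s a) ψ)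
      (∑ j ∈ Finset.range N,
        (pfRow (qForm α R₁ R₂) n N (rowVec α R₁ R₂ t (Function.update a j (a j - 1))) ψ -
          pfRow (qForm α R₁ R₂) n N (rowVec α R₁ R₂ t a) ψ)) t := by
  have key := hasDerivAt_pfSeq (ω := extForm (qForm α R₁ R₂)) (n := n)
    (u := fun s => rowSeq N (rowVec α R₁ R₂ s a) ψ) (t := t)
    -- The bordering functionals do not depend on time, so their derivative vectors are 0.
    (D := fun j => if j < N then
      (weightVec α R₁ R₂ t (j + 1) (a j - 1) - weightVec α R₁ R₂ t (j + 1) (a j), 0) else 0) (by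
    intro j k
    simp only [extForm_apply, rowSeq, rowVec]
    by_cases hj : j < N <;> by_cases hk : k < N
    · simpa [hj, hk] using hasDerivAt_qForm hα h1 h2 t (j + 1) (k + 1) (a j) (a k)
    · simpa [hj, hk] using hψ (k - N) (j + 1) (a j)
    · simpa [hj, hk] using (hψ (j - N) (k + 1) (a k)).fun_neg
    · simpa [hj, hk] using hasDerivAt_const t (0 : ℂ))
  refine key.congr_deriv ?_
  rw [← Finset.sum_subset (Finset.range_subset_range.2 hN)]
  · refine Finset.sum_congr rfl fun j hj => ?_
    have hj := Finset.mem_range.1 hj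
    rw [if_pos hj, ← sub_zero (0 : Module.Dual ℂ Bdry), ← Prod.mk_sub_mk,
      pfSeq_update_sub _ _ (by omega), ← rowSeq_update hj, ← rowSeq_update hj,
      ← rowVec_update, ← rowVec_update, Function.update_eq_self]
    rfl
  · intro j hj hjN
    rw [if_neg (by simpa using hjN), pfSeq_update_zero _ _ (Finset.mem_range.1 hj)]

/-- The two rows j + 1 differ by row j, so the difference is a Pfaffian with a repeated vector. A
blocked jump thus contributes nothing to the derivative. -/
lemma pfRow_update_of_eq (hα : 0 ≤ α) (h1 : max 1 α < R₁) (h2 : max 1 α < R₂) {n N : ℕ}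
    (hN : N ≤ 2 * n) (ψ : ℕ → Module.Dual ℂ Bdry) (t : ℝ) {a : ℕ → ℤ} {j : ℕ} (hj : j + 1 < N)
    (h : a (j + 1) = a j + 1) :
    pfRow (qForm α R₁ R₂) n N (rowVec α R₁ R₂ t (Function.update a (j + 1) (a (j + 1) - 1))) ψ =
      pfRow (qForm α R₁ R₂) n N (rowVec α R₁ R₂ t a) ψ := by
  conv_rhs => rw [← Function.update_eq_self (j + 1) a]
  rw [← sub_eq_zero, pfRow, pfRow, rowVec_update, rowVec_update, rowSeq_update hj, rowSeq_update hj,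
    ← pfSeq_update_sub _ _ (by omega), Prod.mk_sub_mk, h, add_sub_cancel_right,
    weightVec_sub_weightVec_succ hα h1 h2]
  refine pfSeq_eq_zero_of_eq _ (i := j) (j := j + 1) (by omega) (by omega) (by omega) ?_
  rw [Function.update_self, Function.update_of_ne (by omega), rowSeq_of_lt _ _ (by omega), sub_zero]
  rfl

/-- The functionals with values `Uker` on the rows, for the coordinates `d 0 < d 1 < ⋯` of the
initial configuration of `M` particles. -/
noncomputable def initDual (α R : ℝ) (M N : ℕ) (d : ℕ → ℤ) (k : ℕ) : Module.Dual ℂ Bdry :=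
  momentDual α R (N + k + 1 - M) (d k - k - N + M - 2)

/-- The functionals bordering the matrix `qForm (f i) (f j)`. -/
noncomputable def borderDual (α R : ℝ) (M N : ℕ) (d : ℕ → ℤ) : ℕ → Module.Dual ℂ Bdry :=
  if Even (N + M) then initDual α R M N d
  else consSeq ((α : ℂ) • contourDual R) (initDual α R M N d)

/-- The Pfaffian of the theorem, for the coordinates `a 0 < a 1 < ⋯ < a (N - 1)`. -/
noncomputable def transPf (α R₁ R₂ t : ℝ) (M N : ℕ) (d a : ℕ → ℤ) : ℂ :=
  pfRow (qForm α R₁ R₂) ((N + M + 1) / 2) N (rowVec α R₁ R₂ t a) (borderDual α R₁ M N d)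

lemma hasDerivAt_borderDual (hα : 0 ≤ α) (h1 : max 1 α < R₁) (t : ℝ) (M N : ℕ) (d : ℕ → ℤ)
    (k i : ℕ) (a : ℤ) : HasDerivAt (fun s => borderDual α R₁ M N d k (weightVec α R₁ R₂ s i a))
      (borderDual α R₁ M N d k (weightVec α R₁ R₂ t i (a - 1) - weightVec α R₁ R₂ t i a)) t := by
  unfold borderDual
  split_ifs
  · exact hasDerivAt_momentDual hα h1 _ _ t i a
  · cases k with
    | zero => exact (hasDerivAt_contourDual hα h1 t i a).const_mul (α : ℂ)
    | succ k => exact hasDerivAt_momentDual hα h1 _ _ t i a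

lemma initDual_succ (hα : 0 ≤ α) (h1 : max 1 α < R₁) {M N : ℕ} (hM : M ≤ N + 1) (d : ℕ → ℤ)
    (k : ℕ) (t : ℝ) (i : ℕ) (a : ℤ) :
    initDual α R₁ M (N + 1) d k (weightVec α R₁ R₂ t (i + 1) a) =
      initDual α R₁ M N d k (weightVec α R₁ R₂ t i a) := by
  unfold initDual
  rw [show N + 1 + k + 1 - M = (N + k + 1 - M) + 1 by omega, momentDual_succ hα h1]
  congr 2
  push_cast
  ring

/-- By linearity in row 0 the difference is a Pfaffian whose first row is `wallVec`, the situation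
of the two bordered shift lemmas with c = α and P = `contourDual R₁`. The bound on d makes the
exponents in `momentDual_wallVec` nonnegative. -/
lemma transPf_update_wall (hα : 0 ≤ α) (h1 : max 1 α < R₁) (h2 : R₁ + 1 < R₂) {M N : ℕ}
    (hM : M ≤ N + 1) {d : ℕ → ℤ} (hd : ∀ k < M, (N : ℤ) + 3 + k ≤ d k + M) (t : ℝ) {a : ℕ → ℤ}
    (ha0 : a 0 = 1) (ha : ∀ i, i < N → 1 ≤ a (i + 1)) :
    transPf α R₁ R₂ t M (N + 1) d (Function.update a 0 (a 0 - 1)) =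
      α * transPf α R₁ R₂ t M (N + 1) d a +
        (-1) ^ N * α * transPf α R₁ R₂ t M N d (fun i => a (i + 1)) := by
  have h2' : max 1 α < R₂ := by linarith
  have h : 1 < |R₁ - R₂| := by
    rw [abs_sub_comm]; exact lt_of_lt_of_le (by linarith) (le_abs_self _)
  set ψ := borderDual α R₁ M (N + 1) d with hψ
  have e1 : transPf α R₁ R₂ t M (N + 1) d (Function.update a 0 (a 0 - 1)) -
      α * transPf α R₁ R₂ t M (N + 1) d a =
      pfRow (qForm α R₁ R₂) ((N + 1 + M + 1) / 2) (N + 1) (consSeq (wallVec α R₁ R₂ t)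
        fun i => weightVec α R₁ R₂ t (i + 2) (a (i + 1))) ψ := by
    have e : consSeq (wallVec α R₁ R₂ t) (fun i => weightVec α R₁ R₂ t (i + 2) (a (i + 1))) =
        Function.update (rowVec α R₁ R₂ t a) 0 (wallVec α R₁ R₂ t) := by
      funext i
      cases i with
      | zero => simp [consSeq]
      | succ i => simp [consSeq, rowVec]
    conv_lhs => rw [← Function.update_eq_self 0 a]
    simp only [transPf, pfRow]
    rw [e, Function.update_idem, Function.update_self, rowVec_update, rowVec_update,
      rowSeq_update (by omega), rowSeq_update (by omega), rowSeq_update (by omega),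
      ← pfSeq_update_smul _ _ _ (by omega), ← pfSeq_update_sub _ _ (by omega), Prod.smul_mk,
      smul_zero, Prod.mk_sub_mk, sub_zero, ha0, sub_self, wallVec]
  rw [← sub_eq_iff_eq_add', e1]
  have hgh : ∀ i < N, qForm α R₁ R₂ (weightVec α R₁ R₂ t (i + 2) (a (i + 1))) (wallVec α R₁ R₂ t) =
      (α : ℂ) ^ 2 * contourDual R₁ (rowVec α R₁ R₂ t (fun i => a (i + 1)) i) := fun i hi =>
    qForm_wallVec hα h1 h2 t (i + 1) (ha i hi)
  have hgg : ∀ i < N, ∀ j < N, qForm α R₁ R₂ (weightVec α R₁ R₂ t (i + 2) (a (i + 1)))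
      (weightVec α R₁ R₂ t (j + 2) (a (j + 1))) =
      qForm α R₁ R₂ (rowVec α R₁ R₂ t (fun i => a (i + 1)) i)
        (rowVec α R₁ R₂ t (fun i => a (i + 1)) j) -
      (α : ℂ) ^ 2 * (contourDual R₁ (weightVec α R₁ R₂ t (i + 2) (a (i + 1))) *
          contourDual R₁ (rowVec α R₁ R₂ t (fun i => a (i + 1)) j) -
        contourDual R₁ (rowVec α R₁ R₂ t (fun i => a (i + 1)) i) *
          contourDual R₁ (weightVec α R₁ R₂ t (j + 2) (a (j + 1)))) := fun i _ j _ =>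
    qForm_succ_succ hα h1 h2' h t (i + 1) (j + 1) _ _
  have hφ : ∀ k < M, ∀ i < N, initDual α R₁ M (N + 1) d k
      (weightVec α R₁ R₂ t (i + 2) (a (i + 1))) =
      initDual α R₁ M N d k (rowVec α R₁ R₂ t (fun i => a (i + 1)) i) := fun k _ i _ =>
    initDual_succ hα h1 hM d k t (i + 1) _
  have hφh : ∀ k < M, initDual α R₁ M (N + 1) d k (wallVec α R₁ R₂ t) = 0 := fun k hk =>
    momentDual_wallVec hα h1 (by omega) (by have := hd k hk; push_cast; omega) t
  rw [hψ, transPf]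
  -- If N + M is even, the larger Pfaffian carries the border p and loses it together with the wall
  -- row; otherwise the wall row becomes the border of the smaller one.
  by_cases hpar : Even (N + M)
  · have hpar' : ¬ Even (N + 1 + M) := by
      rw [add_right_comm]; simpa [Nat.even_add_one] using hpar
    simp only [borderDual, if_neg hpar', if_pos hpar]
    obtain ⟨n, hn⟩ := hpar
    have hn' : 2 * n = N + M := by omega
    rw [show (N + 1 + M + 1) / 2 = n + 1 by omega, show (N + M + 1) / 2 = n by omega]
    exact pfRow_cons_cons_eq_of_shift (qForm_skew α R₁ R₂) hn' hgh hgg hφ hφh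
      (contourDual_wallVec hα h1 t)
  · have hpar' : Even (N + 1 + M) := by
      rw [add_right_comm]; simpa [Nat.even_add_one] using hpar
    simp only [borderDual, if_pos hpar', if_neg hpar]
    obtain ⟨n, hn⟩ := hpar'
    rw [show (N + 1 + M + 1) / 2 = n by omega, show (N + M + 1) / 2 = n by omega]
    exact pfRow_cons_eq_of_shift (qForm_skew α R₁ R₂) (by omega) hgh hgg hφ hφh

/-- The bordering functionals are mutually orthogonal and make up more than half of the vectors. -/
lemma transPf_of_lt {M N : ℕ} (h : N < M) (t : ℝ) (d a : ℕ → ℤ) :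
    transPf α R₁ R₂ t M N d a = 0 := by
  refine pfSeq_eq_zero_of_isotropic _ _ (Finset.univ.filter fun i => N ≤ (i : ℕ)) ?_ ?_
  · have e : (Finset.univ.filter fun i : Fin (2 * ((N + M + 1) / 2)) => N ≤ (i : ℕ)) =
        (Finset.univ.filter fun i : Fin (2 * ((N + M + 1) / 2)) => (i : ℕ) < N)ᶜ := by
      ext i; simp
    rw [e, Finset.card_compl, Fin.card_filter_val_lt, Fintype.card_fin]
    omega
  · intro i hi j hj
    rw [rowSeq_of_ge _ _ (by simpa using hi), rowSeq_of_ge _ _ (by simpa using hj)]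
    simp [extForm_apply]

lemma transPf_time_zero_of_gt (hα : 0 ≤ α) (h1 : max 1 α < R₁) (h2 : R₁ + 1 < R₂) {M N : ℕ}
    (h : M < N) (d : ℕ → ℤ) {a : ℕ → ℤ} (ha : ∀ i < N, 1 ≤ a i) :
    transPf α R₁ R₂ 0 M N d a = 0 := by
  -- The orthogonal vectors are the N rows and, in the odd case, the border p too; either way they
  -- exceed half of the total.
  set L := if Even (N + M) then N else N + 1 with hL
  refine pfSeq_eq_zero_of_isotropic _ _ (Finset.univ.filter fun i => (i : ℕ) < L) ?_ ?_
  · rw [Fin.card_filter_val_lt]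
    split_ifs at hL with hp
    · obtain ⟨n, hn⟩ := hp; omega
    · rw [Nat.not_even_iff_odd] at hp
      obtain ⟨n, hn⟩ := hp; omega
  · intro i hi j hj
    have hlast : ∀ l : ℕ, l < L → ¬ l < N → rowSeq N (rowVec α R₁ R₂ 0 a)
        (borderDual α R₁ M N d) l = (0, (α : ℂ) • contourDual R₁) := by
      intro l hl hlN
      split_ifs at hL with hp
      · omega
      · rw [rowSeq_of_ge _ _ (by omega), show l - N = 0 by omega, borderDual, if_neg hp]
        rfl
    have hi : (i : ℕ) < L := by simpa using hi
    have hj : (j : ℕ) < L := by simpa using hj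
    by_cases hiN : (i : ℕ) < N <;> by_cases hjN : (j : ℕ) < N
    · simp [rowSeq_of_lt _ _ hiN, rowSeq_of_lt _ _ hjN, extForm_apply, rowVec,
        qForm_time_zero hα h1 h2 _ _ (ha i hiN) (ha j hjN)]
    · simp [rowSeq_of_lt _ _ hiN, hlast _ hj hjN, extForm_apply, rowVec,
        contourDual_time_zero hα h1 _ (ha i hiN)]
    · simp [rowSeq_of_lt _ _ hjN, hlast _ hi hiN, extForm_apply, rowVec,
        contourDual_time_zero hα h1 _ (ha j hjN)]
    · simp [hlast _ hi hiN, hlast _ hj hjN, extForm_apply]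

end Dynamics
end HalfTASEP

namespace HalfTASEP
-- The Pfaffian at time zero
section InitialCondition

open Filter Topology

variable {α R₁ R₂ : ℝ}

lemma contour_moment_eq_zero {R : ℝ} (hR : 1 < R) (e : ℤ) {z : ℤ} (hz : 1 ≤ z) :
    contour R (fun w => (w - 1) ^ e * w ^ (-z - 1 - e)) = 0 := by
  have hne : ∀ w : ℂ, R ≤ ‖w‖ → w ≠ 0 ∧ w - 1 ≠ 0 := fun w hw =>
    ⟨fun h => by simp [h] at hw; linarith, fun h => by
      rw [sub_eq_zero.1 h, norm_one] at hw; linarith⟩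
  refine contour_eq_zero_of_decay (by linarith) (fun w hw => ?_) ?_
  · obtain ⟨h0, h1⟩ := hne w hw
    fun_prop (disch := first | exact Or.inl h0 | exact Or.inl h1)
  · have h1 : Tendsto (fun w : ℂ => (w / (w - 1)) ^ (-e) * w ^ (-z)) (Bornology.cobounded ℂ)
        (𝓝 ((1 : ℂ) ^ (-e) * 0)) :=
      ((tendsto_div_sub 1).zpow₀ (-e) (Or.inl one_ne_zero)).mul (tendsto_zpow_neg (by omega))
    rw [mul_zero] at h1
    refine h1.congr' ?_
    filter_upwards [Bornology.eventually_ne_cobounded (0 : ℂ),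
      Bornology.eventually_ne_cobounded (1 : ℂ)] with w h0 h2
    rw [show -z - 1 - e = -z + (-1) + -e by ring, zpow_add₀ h0, zpow_add₀ h0, zpow_neg_one,
      div_zpow, zpow_neg (w - 1) e]
    have := zpow_ne_zero e (sub_ne_zero.2 h2)
    field_simp

lemma momentDual_weightVec_time_zero (hα : 0 ≤ α) (h1 : max 1 α < R₁) (k i : ℕ) (d a : ℤ) :
    momentDual α R₁ (k + 1) (d - k - 2) (weightVec α R₁ R₂ 0 (i + 1) a) =
      contour R₁ fun w => (w - 1) ^ ((k : ℤ) - i) * w ^ (-(a - d) - 1 - ((k : ℤ) - i)) := by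
  rw [momentDual_weightVec hα h1]
  congr 1; funext w
  push_cast
  rw [zero_mul, Complex.exp_zero, mul_one,
    show (k : ℤ) + 1 - (i + 1) = k - i by ring,
    show d - k - 2 + (i + 1) - a = -(a - d) - 1 - (k - i) by ring]

/-- Rows pair only with functionals. Comparing the rightmost particles: if a N < d N, the last
functional kills all rows because its integrands are polynomials; if a N > d N, all functionals kill
the last row by decay at infinity; if they agree, the last row meets only the last functional, with
value 1. The peeling signs (-1)^N accumulate to (-1)^(N choose 2). -/
lemma pfRow_time_zero (hα : 0 ≤ α) (h1 : max 1 α < R₁) (h2 : R₁ + 1 < R₂) (N : ℕ) {a d : ℕ → ℤ}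
    (ha : ∀ i < N, 1 ≤ a i) (hda : ∀ i, i + 1 < N → a i < a (i + 1))
    (hdd : ∀ i, i + 1 < N → d i < d (i + 1)) :
    pfRow (qForm α R₁ R₂) N N (rowVec α R₁ R₂ 0 a)
        (fun k => momentDual α R₁ (k + 1) (d k - k - 2)) =
      if ∀ i < N, a i = d i then (-1) ^ N.choose 2 else 0 := by
  have hpos : (1 : ℝ) ≤ max 1 α := le_max_left _ _
  have hR : 1 < R₁ := by linarith
  induction N with
  | zero => simp [pfRow, pfSeq_eq]
  | succ N ih =>
    have hgap : ∀ {b : ℕ → ℤ}, (∀ i, i + 1 < N + 1 → b i < b (i + 1)) →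
        ∀ l ≤ N, b (N - l) + l ≤ b N := by
      intro b hb l
      induction l with
      | zero => simp
      | succ l ihl =>
        intro hl
        have e := hb (N - (l + 1)) (by omega)
        rw [show N - (l + 1) + 1 = N - l by omega] at e
        have := ihl (by omega)
        push_cast
        omega
    -- Strictly increasing integers spread by at least one per index; this compensates the
    -- index-dependent exponents k - i.
    have hgap' : ∀ {b : ℕ → ℤ}, (∀ i, i + 1 < N + 1 → b i < b (i + 1)) →
        ∀ i ≤ N, b i + N - i ≤ b N := by
      intro b hb i hi
      have := hgap hb (N - i) (by omega)
      rw [show N - (N - i) = i by omega] at this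
      omega
    have hq : ∀ i < N + 1, ∀ j < N + 1, qForm α R₁ R₂ (rowVec α R₁ R₂ 0 a i)
        (rowVec α R₁ R₂ 0 a j) = 0 := fun i hi j hj =>
      qForm_time_zero hα h1 h2 _ _ (ha i hi) (ha j hj)
    obtain hlt | heq | hgt := lt_trichotomy (a N) (d N)
    · rw [if_neg fun h => by have := h N (by omega); omega]
      refine pfSeq_eq_zero_of_row (extForm_skew (qForm_skew α R₁ R₂)) (k := N + 1 + N) (by omega) ?_
      intro j hj _
      rw [rowSeq_of_ge _ _ (by omega), Nat.add_sub_cancel_left]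
      by_cases hjN : j < N + 1
      · have := hgap' hda j (by omega)
        rw [rowSeq_of_lt _ _ hjN]
        simp only [extForm_apply, map_zero, LinearMap.zero_apply, add_zero, zero_sub, neg_eq_zero,
          rowVec]
        rw [momentDual_weightVec_time_zero hα h1]
        refine contour_eq_zero_of_disc (by linarith) fun w _ => ?_
        exact ((differentiableAt_fun_id.sub_const 1).zpow (Or.inr (by omega))).mul
          (differentiableAt_fun_id.zpow (Or.inr (by omega)))
      · rw [rowSeq_of_ge _ _ (by omega)]
        simp [extForm_apply]
    · have hφ : ∀ k < N, momentDual α R₁ (k + 1) (d k - k - 2) (rowVec α R₁ R₂ 0 a N) = 0 := by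
        intro k hk
        have := hgap' hdd k (by omega)
        rw [rowVec, momentDual_weightVec_time_zero hα h1]
        exact contour_moment_eq_zero hR _ (by omega)
      have hone : momentDual α R₁ (N + 1) (d N - N - 2) (rowVec α R₁ R₂ 0 a N) = 1 := by
        rw [rowVec, momentDual_weightVec_time_zero hα h1, heq]
        have := contour_div_sub (R := R₁) (c := 0) (by simp; linarith)
          (f := fun _ => 1) fun z _ => differentiableAt_const _
        simpa using this
      rw [pfRow_succ_of_isotropic (qForm_skew α R₁ R₂)
        (fun i hi => hq N (by omega) i (by omega)) hφ, hone,
        ih (fun i hi => ha i (by omega)) (fun i hi => hda i (by omega))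
          (fun i hi => hdd i (by omega)), Nat.choose_succ_succ' N 1, Nat.choose_one_right, pow_add]
      have hiff : (∀ i < N + 1, a i = d i) ↔ ∀ i < N, a i = d i :=
        ⟨fun h i hi => h i (by omega), fun h i hi => by
          obtain h' | rfl := Nat.lt_succ_iff_lt_or_eq.1 hi
          · exact h i h'
          · exact heq⟩
      rw [if_congr hiff rfl rfl]
      simp
    · rw [if_neg fun h => by have := h N (by omega); omega]
      refine pfSeq_eq_zero_of_row (extForm_skew (qForm_skew α R₁ R₂)) (k := N) (by omega) ?_
      intro j hj _
      rw [rowSeq_of_lt _ _ (by omega)]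
      by_cases hjN : j < N + 1
      · rw [rowSeq_of_lt _ _ hjN]
        simp [extForm_apply, hq N (by omega) j hjN]
      · have := hgap' hdd (j - (N + 1)) (by omega)
        rw [rowSeq_of_ge _ _ (by omega)]
        simp only [extForm_apply, map_zero, sub_zero, zero_add, rowVec]
        rw [momentDual_weightVec_time_zero hα h1]
        exact contour_moment_eq_zero hR _ (by omega)

lemma transPf_time_zero_self (hα : 0 ≤ α) (h1 : max 1 α < R₁) (h2 : R₁ + 1 < R₂) (N : ℕ)
    {a d : ℕ → ℤ} (ha : ∀ i < N, 1 ≤ a i) (hda : ∀ i, i + 1 < N → a i < a (i + 1))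
    (hdd : ∀ i, i + 1 < N → d i < d (i + 1)) :
    transPf α R₁ R₂ 0 N N d a = if ∀ i < N, a i = d i then (-1) ^ N.choose 2 else 0 := by
  rw [← pfRow_time_zero hα h1 h2 N ha hda hdd, transPf, borderDual, if_pos ⟨N, rfl⟩,
    show (N + N + 1) / 2 = N by omega]
  congr 1
  funext k
  rw [initDual, show N + k + 1 - N = k + 1 by omega, show d k - k - N + N - 2 = d k - k - 2 by ring]

end InitialCondition

/-! ### Configurations in coordinates -/

section Coordinates

/-- The configuration with sites `c 0, …, c (N - 1)`. -/
def coordSet (N : ℕ) (c : ℕ → ℕ+) : Config := (Finset.range N).image c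

variable {N : ℕ} {c : ℕ → ℕ+}

lemma mem_coordSet {s : ℕ+} : s ∈ coordSet N c ↔ ∃ j < N, c j = s := by
  simp [coordSet]

lemma injOn_coords (hc : ∀ i j, i < j → j < N → c i < c j) :
    Set.InjOn c (Finset.range N : Set ℕ) := by
  intro i hi j hj h
  simp only [Finset.coe_range, Set.mem_Iio] at hi hj
  obtain hlt | heq | hgt := lt_trichotomy i j
  · exact absurd h (hc i j hlt hj).ne
  · exact heq
  · exact absurd h (hc j i hgt hi).ne'

lemma sum_coordSet {A : Type*} [AddCommMonoid A] (hc : ∀ i j, i < j → j < N → c i < c j)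
    (g : ℕ+ → A) : ∑ s ∈ coordSet N c, g s = ∑ j ∈ Finset.range N, g (c j) :=
  Finset.sum_image (injOn_coords hc)

lemma card_coordSet (hc : ∀ i j, i < j → j < N → c i < c j) : (coordSet N c).card = N := by
  rw [coordSet, Finset.card_image_of_injOn (injOn_coords hc), Finset.card_range]

lemma pnat_sub_one_add_one {s : ℕ+} (h : s ≠ 1) : s - 1 + 1 = s := by
  have : (s : ℕ) ≠ 1 := fun e => h (PNat.coe_inj.1 e)
  have h1 : 1 < s := lt_of_le_of_ne one_le (Ne.symm h)
  exact PNat.sub_add_of_lt h1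

/-- Reindexing by the current site of the particle that jumped, so that the sum runs over particles
like the derivative of the Pfaffian. -/
lemma predSum_eq (α : ℝ) (f : Config → ℝ) (X : Config) :
    predSum α f X = (if 1 ∈ X then α * f (X.erase 1) else 0) +
      ∑ s ∈ X with s ≠ 1 ∧ s - 1 ∉ X, f (insert (s - 1) (X.erase s)) := by
  unfold predSum
  congr 1
  symm
  refine Finset.sum_bij (fun s _ => s - 1) ?_ ?_ ?_ ?_
  · intro s hs
    obtain ⟨hs, h1, h2⟩ := Finset.mem_filter.1 hs
    exact Finset.mem_filter.2 ⟨Finset.mem_image_of_mem _ hs, by rwa [pnat_sub_one_add_one h1], h2⟩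
  · intro s hs s' hs' h
    rw [← pnat_sub_one_add_one (Finset.mem_filter.1 hs).2.1, h,
      pnat_sub_one_add_one (Finset.mem_filter.1 hs').2.1]
  · intro s hs
    obtain ⟨-, h1, h2⟩ := Finset.mem_filter.1 hs
    refine ⟨s + 1, Finset.mem_filter.2 ⟨h1, ?_, by rwa [pnat_add_sub_one]⟩, pnat_add_sub_one s⟩
    exact (PNat.lt_add_left 1 s).ne'
  · intro s hs
    rw [hopBack, pnat_sub_one_add_one (Finset.mem_filter.1 hs).2.1]

/-- Free right neighbours count the right ends of the maximal blocks of particles, hence also their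
left ends. A block starting at site 1 has no predecessor site and is counted separately. -/
lemma exitRate_eq (α : ℝ) (X : Config) :
    exitRate α X = (if 1 ∈ X then 1 else α) +
      ((X.filter fun s => s ≠ 1 ∧ s - 1 ∉ X).card : ℝ) := by
  have e1 : (X.filter fun s => s + 1 ∈ X).card = (X.filter fun s => s ≠ 1 ∧ s - 1 ∈ X).card := by
    refine Finset.card_bij (fun s _ => s + 1) ?_ ?_ ?_
    · intro s hs
      obtain ⟨h1, h2⟩ := Finset.mem_filter.1 hs
      exact Finset.mem_filter.2 ⟨h2, (PNat.lt_add_left 1 s).ne', by rwa [pnat_add_sub_one]⟩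
    · intro s _ s' _ h
      exact add_right_cancel h
    · intro s hs
      obtain ⟨h1, h2, h3⟩ := Finset.mem_filter.1 hs
      exact ⟨s - 1, Finset.mem_filter.2 ⟨h3, by rwa [pnat_sub_one_add_one h2]⟩,
        pnat_sub_one_add_one h2⟩
  have e2 := Finset.card_filter_add_card_filter_not (s := X) (fun s => s + 1 ∈ X)
  have e3 := Finset.card_filter_add_card_filter_not (s := X) (fun s => s ≠ 1)
  have e4 := Finset.card_filter_add_card_filter_not (s := X.filter fun s => s ≠ 1)
    (fun s => s - 1 ∈ X)
  rw [Finset.filter_filter, Finset.filter_filter] at e4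
  have e5 : (X.filter fun s => ¬ s ≠ 1).card = if 1 ∈ X then 1 else 0 := by
    simp only [ne_eq, not_not, Finset.filter_eq']
    split_ifs <;> simp
  have e6 : (X.filter fun s => s + 1 ∉ X).card =
      (if 1 ∈ X then 1 else 0) + (X.filter fun s => s ≠ 1 ∧ s - 1 ∉ X).card := by
    omega
  unfold exitRate jumpSum
  rw [Finset.sum_const, nsmul_one, e6]
  split_ifs <;> push_cast <;> ring

lemma erase_one_coordSet (hc : ∀ i j, i < j → j < N + 1 → c i < c j) (h : c 0 = 1) :
    (coordSet (N + 1) c).erase 1 = coordSet N fun i => c (i + 1) := by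
  ext s
  rw [Finset.mem_erase, mem_coordSet, mem_coordSet]
  constructor
  · rintro ⟨hs, j, hj, rfl⟩
    obtain ⟨i, rfl⟩ : ∃ i, j = i + 1 := Nat.exists_eq_succ_of_ne_zero fun e => hs (by rw [e, h])
    exact ⟨i, by omega, rfl⟩
  · rintro ⟨j, hj, rfl⟩
    refine ⟨?_, j + 1, by omega, rfl⟩
    rw [← h]
    exact (hc 0 (j + 1) (by omega) (by omega)).ne'

lemma insert_erase_coordSet (hc : ∀ i j, i < j → j < N → c i < c j) {j : ℕ} (hj : j < N) (s : ℕ+) :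
    insert s ((coordSet N c).erase (c j)) = coordSet N (Function.update c j s) := by
  ext r
  rw [Finset.mem_insert, Finset.mem_erase, mem_coordSet, mem_coordSet]
  constructor
  · rintro (rfl | ⟨hr, i, hi, rfl⟩)
    · exact ⟨j, hj, Function.update_self ..⟩
    · exact ⟨i, hi, Function.update_of_ne (fun e => hr (by rw [e])) ..⟩
  · rintro ⟨i, hi, rfl⟩
    by_cases hij : i = j
    · subst hij; simp
    · rw [Function.update_of_ne hij]
      exact Or.inr ⟨fun e => hij (injOn_coords hc (by simpa using hi) (by simpa using hj) e),
        i, hi, rfl⟩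

lemma exists_pred_of_mem (hc : ∀ i j, i < j → j < N → c i < c j) {j : ℕ} (hj : j < N)
    (h1 : c j ≠ 1) (h : c j - 1 ∈ coordSet N c) : ∃ i, j = i + 1 ∧ c j = c i + 1 := by
  obtain ⟨i, hi, hij⟩ := mem_coordSet.1 h
  have hs : c i + 1 = c j := by rw [hij, pnat_sub_one_add_one h1]
  have hlt : c i < c j := by rw [← hs]; exact PNat.lt_add_right _ _
  have hij' : i < j := by
    by_contra hcon
    obtain h' | h' := (not_lt.1 hcon).lt_or_eq
    · exact absurd (hc j i h' hi) hlt.asymm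
    · rw [h'] at hlt; exact lt_irrefl _ hlt
  refine ⟨i, ?_, hs.symm⟩
  by_contra hne
  have a1 := hc i (i + 1) (by omega) (by omega)
  have a2 := hc (i + 1) j (by omega) hj
  rw [← hs] at a2
  exact absurd (PNat.lt_add_one_iff.1 a2) (not_le.2 a1)

lemma strictMono_update (hc : ∀ i j, i < j → j < N → c i < c j) {j : ℕ} (hj : j < N)
    (h1 : c j ≠ 1) (h : c j - 1 ∉ coordSet N c) :
    ∀ i l, i < l → l < N →
      Function.update c j (c j - 1) i < Function.update c j (c j - 1) l := by
  have hs := pnat_sub_one_add_one h1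
  intro i l hil hl
  have h0 := hc i l hil hl
  by_cases hi : i = j
  · subst hi
    rw [Function.update_self, Function.update_of_ne (by omega)]
    exact lt_trans (by conv_rhs => rw [← hs]
                       exact PNat.lt_add_right _ _) h0
  · rw [Function.update_of_ne hi]
    by_cases hlj : l = j
    · subst hlj
      rw [Function.update_self]
      rw [← hs] at h0
      exact lt_of_le_of_ne (PNat.lt_add_one_iff.1 h0) fun e => h (mem_coordSet.2 ⟨i, by omega, e⟩)
    · rwa [Function.update_of_ne hlj]

lemma coordSet_inj {d : ℕ → ℕ+} (hc : ∀ i j, i < j → j < N → c i < c j)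
    (hd : ∀ i j, i < j → j < N → d i < d j) :
    coordSet N d = coordSet N c ↔ ∀ i < N, c i = d i := by
  constructor
  · intro h i hi
    have mono : ∀ {b : ℕ → ℕ+}, (∀ i j, i < j → j < N → b i < b j) →
        StrictMono fun i : Fin N => b i := fun hb i j hij => hb i j hij j.2
    have range : ∀ b : ℕ → ℕ+, Set.range (fun i : Fin N => b i) = coordSet N b := by
      intro b; ext s
      rw [Finset.mem_coe, mem_coordSet]
      exact ⟨fun ⟨i, hi⟩ => ⟨i, i.2, hi⟩, fun ⟨i, hi, e⟩ => ⟨⟨i, hi⟩, e⟩⟩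
    have := (StrictMono.range_inj (mono hc) (mono hd)).1 (by rw [range, range, h])
    exact congrFun this ⟨i, hi⟩
  · intro h
    exact Finset.image_congr fun i hi => (h i (by simpa using hi)).symm

end Coordinates
end HalfTASEP

namespace HalfTASEP
-- Induction on the height
section TransitionFormula

variable {α R₁ R₂ : ℝ}

lemma sum_coordSet_split {N : ℕ} {c : ℕ → ℕ+} (hc : ∀ i j, i < j → j < N → c i < c j) (A : ℂ)
    (g : ℕ+ → ℂ) (p : ℕ+ → Prop) [DecidablePred p] :
    ∑ j ∈ Finset.range N, ((if c j = 1 then A else 0) + (if p (c j) then g (c j) else 0)) =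
      (if 1 ∈ coordSet N c then A else 0) + ∑ s ∈ coordSet N c with p s, g s := by
  rw [← sum_coordSet hc (fun s => (if s = 1 then A else 0) + (if p s then g s else 0)),
    Finset.sum_add_distrib, Finset.sum_ite_eq', Finset.sum_filter]

lemma coe_update {c : ℕ → ℕ+} {j : ℕ} (h : c j ≠ 1) :
    (fun i => ((Function.update c j (c j - 1) i : ℕ) : ℤ)) =
      Function.update (fun i => ((c i : ℕ) : ℤ)) j (((c j : ℕ) : ℤ) - 1) := by
  funext i
  by_cases hi : i = j
  · subst hi
    have := congrArg (fun s : ℕ+ => ((s : ℕ) : ℤ)) (pnat_sub_one_add_one h)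
    simp only [PNat.add_coe, PNat.one_coe] at this
    push_cast at this
    simp only [Function.update_self]
    omega
  · simp [Function.update_of_ne hi]

/-- Allowing N = M - 1 gives the induction a place to land when a particle is removed from N = M.
The bound on d only weakens as N decreases, so it is inherited. -/
lemma transProb_coordSet (hα : 0 ≤ α) (h1 : max 1 α < R₁) (h2 : R₁ + 1 < R₂) {M : ℕ} {d : ℕ → ℕ+}
    (hd : ∀ i j, i < j → j < M → d i < d j) (K : ℕ) : ∀ (N : ℕ) (c : ℕ → ℕ+),
    height (coordSet N c) = K → (∀ i j, i < j → j < N → c i < c j) → M ≤ N + 1 →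
    (∀ k < M, (N : ℤ) + 2 + k ≤ (d k : ℕ) + M) → ∀ t : ℝ,
    (transProb α t (coordSet M d) (coordSet N c) : ℂ) = (-1) ^ N.choose 2 *
      Complex.exp (-(α * t)) * transPf α R₁ R₂ t M N (fun k => (d k : ℕ)) (fun i => (c i : ℕ)) := by
  induction K using Nat.strong_induction_on with
  | _ K ih =>
  intro N c hK hc hMN hcond
  have h2' : max 1 α < R₂ := by linarith
  -- Particles never leave, so with fewer particles than at the start both sides vanish.
  obtain hlt | hle := lt_or_ge N M
  · intro t
    rw [transPf_of_lt hlt, transProb_eq_zero_of_card (by rwa [card_coordSet hc, card_coordSet hd])]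
    simp
  set X := coordSet N c with hX
  set Y := coordSet M d with hY
  set b : ℕ → ℤ := fun k => (d k : ℕ) with hb
  set a : ℕ → ℤ := fun i => (c i : ℕ) with ha
  set σ : ℂ := (-1) ^ N.choose 2 with hσ
  have ha1 : ∀ i, 1 ≤ a i := fun i => by have := (c i).pos; simp only [ha]; omega
  -- Contribution of particle j to the derivative: the entrance identity at site 1, zero if blocked,
  -- and otherwise inflow minus outflow, with the smaller configurations known by induction. The α
  -- in α - 1 later cancels the derivative of e^{-αt}, leaving exit rate 1 for an occupied site 1.
  have hstep : ∀ t : ℝ, ∀ j < N, σ * Complex.exp (-(α * t)) *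
      (transPf α R₁ R₂ t M N b (Function.update a j (a j - 1)) - transPf α R₁ R₂ t M N b a) =
      (if c j = 1 then α * (transProb α t Y (X.erase 1) : ℂ) + (α - 1) *
        (σ * Complex.exp (-(α * t)) * transPf α R₁ R₂ t M N b a) else 0) +
      (if c j ≠ 1 ∧ c j - 1 ∉ X then (transProb α t Y (insert (c j - 1) (X.erase (c j))) : ℂ) -
        σ * Complex.exp (-(α * t)) * transPf α R₁ R₂ t M N b a else 0) := by
    intro t j hj
    by_cases hone : c j = 1
    · have hj0 : j = 0 := by
        by_contra hne
        have := hc 0 j (by omega) hj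
        rw [hone] at this
        exact not_lt_one this
      subst hj0
      obtain ⟨n, rfl⟩ : ∃ n, N = n + 1 := Nat.exists_eq_succ_of_ne_zero (by omega)
      have hmem : (1 : ℕ+) ∈ X := mem_coordSet.2 ⟨0, hj, hone⟩
      have herase := erase_one_coordSet hc hone
      have hind := ih (height (X.erase 1)) (by have := height_erase_one hmem; omega) n
        (fun i => c (i + 1)) (by rw [← herase]) (fun i j hij hj => hc _ _ (by omega) (by omega)) hle
        (fun k hk => by have := hcond k hk; push_cast at this; omega) t
      rw [← herase] at hind
      rw [if_pos hone, if_neg (by simp [hone]), add_zero, hind, transPf_update_wall hα h1 h2 hle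
        (fun k hk => by have := hcond k hk; simp only [hb]; push_cast at this; omega) t
        (by simp [ha, hone])
        (fun i _ => ha1 _), hσ, Nat.choose_succ_succ' n 1, Nat.choose_one_right, pow_add]
      -- Passing from n + 1 to n particles changes the binomial sign by (-1)^n, which cancels the
      -- sign in the entrance identity.
      have : ((-1 : ℂ) ^ n) * (-1) ^ n = 1 := by rw [← mul_pow]; simp
      linear_combination ((-1) ^ n.choose 2 * Complex.exp (-(α * t)) * α *
        transPf α R₁ R₂ t M n b fun i => a (i + 1)) * this
    · by_cases hmem : c j - 1 ∈ X
      · obtain ⟨i, rfl, hi⟩ := exists_pred_of_mem hc hj hone hmem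
        rw [if_neg hone, if_neg (by simp [hmem]), add_zero, transPf, transPf,
          pfRow_update_of_eq hα h1 h2' (by omega) _ t hj (by simp [ha, hi]), sub_self, mul_zero]
      · have hmemj : c j ∈ X := mem_coordSet.2 ⟨j, hj, rfl⟩
        have hh := height_hopBack (x := X) (s := c j - 1) (by rwa [pnat_sub_one_add_one hone]) hmem
        rw [hopBack, pnat_sub_one_add_one hone] at hh
        rw [insert_erase_coordSet hc hj] at hh
        have hind := ih _ (by omega) N (Function.update c j (c j - 1)) rfl
          (strictMono_update hc hj hone hmem) hMN hcond t
        rw [coe_update hone] at hind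
        rw [if_neg hone, if_pos ⟨hone, hmem⟩, zero_add, insert_erase_coordSet hc hj, hind]
        ring
  have hderiv : ∀ t : ℝ, HasDerivAt (fun s : ℝ => (transProb α s Y X : ℂ) -
      σ * Complex.exp (-(α * s)) * transPf α R₁ R₂ s M N b a)
      ((-exitRate α X) • ((transProb α t Y X : ℂ) -
        σ * Complex.exp (-(α * t)) * transPf α R₁ R₂ t M N b a)) t := by
    intro t
    have d1 := (hasDerivAt_transProb α t Y X).ofReal_comp
    have d2 : HasDerivAt (fun s : ℝ => Complex.exp (-(α * s)))
        (-α * Complex.exp (-(α * t))) t := by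
      have h : HasDerivAt (fun s : ℝ => -((α : ℂ) * (s : ℂ))) (-α) t := by
        simpa using ((Complex.ofRealCLM.hasDerivAt (x := t)).const_mul (α : ℂ)).fun_neg
      exact h.cexp.congr_deriv (by ring)
    have d3 := hasDerivAt_pfRow hα h1 h2' (n := (N + M + 1) / 2) (N := N) (by omega) t
      (fun k i a => hasDerivAt_borderDual hα h1 t M N b k i a) a
    refine (d1.sub ((d2.const_mul σ).mul d3)).congr_deriv ?_
    have hsum := (Finset.sum_congr rfl fun j hj => hstep t j (Finset.mem_range.1 hj)).trans
      (sum_coordSet_split hc _ (fun s => (transProb α t Y (insert (s - 1) (X.erase s)) : ℂ) -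
        σ * Complex.exp (-(α * t)) * transPf α R₁ R₂ t M N b a) fun s => s ≠ 1 ∧ s - 1 ∉ X)
    rw [← Finset.mul_sum, ← hX, Finset.sum_sub_distrib (s := X.filter _), Finset.sum_const,
      nsmul_eq_mul] at hsum
    have hpred : ((predSum α (transProb α t Y) X : ℝ) : ℂ) =
        (if 1 ∈ X then α * (transProb α t Y (X.erase 1) : ℂ) else 0) +
        ∑ s ∈ X with s ≠ 1 ∧ s - 1 ∉ X, (transProb α t Y (insert (s - 1) (X.erase s)) : ℂ) := by
      rw [predSum_eq]
      push_cast
      congr 1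
      split_ifs <;> simp
    have hexit : ((exitRate α X : ℝ) : ℂ) = (if 1 ∈ X then 1 else (α : ℂ)) +
        ((X.filter fun s => s ≠ 1 ∧ s - 1 ∉ X).card : ℂ) := by
      rw [exitRate_eq]
      push_cast
      congr 1
      split_ifs <;> simp
    simp only [transPf] at hsum ⊢
    rw [Complex.real_smul]
    push_cast
    rw [hsum, hpred, hexit]
    split_ifs <;> ring
  have hzero : (transProb α 0 Y X : ℂ) -
      σ * Complex.exp (-(α * (0 : ℝ))) * transPf α R₁ R₂ 0 M N b a = 0 := by
    rw [transProb_zero]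
    simp only [Complex.ofReal_zero, mul_zero, neg_zero, Complex.exp_zero, mul_one]
    obtain hlt | rfl := hle.lt_or_eq
    · rw [transPf_time_zero_of_gt hα h1 h2 hlt b fun i _ => ha1 i, if_neg]
      · simp
      · intro h
        have := congrArg Finset.card h
        rw [hY, hX, card_coordSet hc, card_coordSet hd] at this
        omega
    · rw [transPf_time_zero_self hα h1 h2 M (fun i _ => ha1 i)
        (fun i hi => by simpa [ha] using hc i (i + 1) (by omega) hi)
        (fun i hi => by simpa [hb] using hd i (i + 1) (by omega) hi),
        if_congr (coordSet_inj hc hd) rfl rfl]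
      have hiff : (∀ i < M, a i = b i) ↔ ∀ i < M, c i = d i := by simp [ha, hb]
      rw [if_congr hiff rfl rfl, hσ]
      split_ifs
      · rw [← mul_pow]; simp
      · simp
  intro t
  exact sub_eq_zero.1 (eq_zero_of_hasDerivAt_smul hderiv hzero t)

end TransitionFormula

/-! ### Identification with the matrices of the theorem -/

section BlockMatrices

variable {V : Type*} [AddCommGroup V] [Module ℂ V]

lemma blockEven_apply {ω : V →ₗ[ℂ] V →ₗ[ℂ] ℂ} (hω : ∀ x y, ω x y = -ω y x) {N M : ℕ}
    {Q : Matrix (Fin N) (Fin N) ℂ} {U : Matrix (Fin N) (Fin M) ℂ} {u : ℕ → V}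
    (hQ : ∀ i j : Fin N, Q i j = ω (u i) (u j))
    (hU : ∀ (i : Fin N) (k : Fin M), U i k = ω (u i) (u (N + k)))
    (h0 : ∀ k l : Fin M, ω (u (N + k)) (u (N + l)) = 0) (i j : Fin (N + M)) :
    blockEven Q U i j = ω (u i) (u j) := by
  induction i using Fin.addCases <;> induction j using Fin.addCases <;>
    simp [blockEven, hQ, hU, h0, hω (u (N + _)) (u (Fin.val _))]

/-- The integrand of U has poles only at 0 and 1, so its circle of radius r > 1 may be replaced by
the w-circle of Q. -/
lemma Uker_eq_momentDual {α R r : ℝ} {R₂ : ℝ} (hα : 0 ≤ α) (h1 : max 1 α < R) (hr : 1 < r) (t : ℝ)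
    {N M : ℕ} (hM : M ≤ N) (i k : ℕ) (a : ℤ) (d : ℕ → ℤ) :
    Uker t r N M ((i : ℤ) - k) (a - d k) =
      initDual α R M N d k (weightVec α R R₂ t (i + 1) a) := by
  have hR : 1 < R := by linarith [le_max_left 1 α]
  rw [initDual, momentDual_weightVec hα h1, Uker]
  have hf : ∀ w : ℂ, (w - 1) ^ ((N : ℤ) - M - (i - k)) * Complex.exp (t * (w - 1)) /
      w ^ (a - d k - (i - k) + N - M + 1) =
      (w - 1) ^ (((N + k + 1 - M : ℕ) : ℤ) - ((i + 1 : ℕ) : ℤ)) * Complex.exp (t * (w - 1)) *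
        w ^ (d k - k - N + M - 2 + ((i + 1 : ℕ) : ℤ) - a) := by
    intro w
    rw [div_eq_mul_inv, ← zpow_neg,
      show ((N + k + 1 - M : ℕ) : ℤ) - ((i + 1 : ℕ) : ℤ) = (N : ℤ) - M - (i - k) by omega,
      show -(a - d k - (i - k) + N - M + 1) = d k - k - N + M - 2 + ((i + 1 : ℕ) : ℤ) - a by
        push_cast; ring]
  simp only [hf]
  have hd : ∀ w : ℂ, 1 < ‖w‖ → DifferentiableAt ℂ (fun w : ℂ =>
      (w - 1) ^ (((N + k + 1 - M : ℕ) : ℤ) - ((i + 1 : ℕ) : ℤ)) * Complex.exp (t * (w - 1)) *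
        w ^ (d k - k - N + M - 2 + ((i + 1 : ℕ) : ℤ) - a)) w := by
    intro w hw
    have h0 : w ≠ 0 := fun h => by simp [h] at hw; linarith
    have h1 : w - 1 ≠ 0 := fun h => by simp [sub_eq_zero.1 h] at hw
    fun_prop (disch := first | exact Or.inl h0 | exact Or.inl h1)
  obtain h | h := le_total r R
  · exact (contour_eq_of_annulus (by linarith) h fun w hw _ => hd w (by linarith)).symm
  · exact contour_eq_of_annulus (by linarith) h fun w hw _ => hd w (by linarith)

/-- The sequence `x (N - 1), …, x 0`. -/
def revSeq {N : ℕ} (x : Fin N → ℕ+) (i : ℕ) : ℕ+ := if h : i < N then x (Fin.rev ⟨i, h⟩) else 1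

lemma revSeq_val {N : ℕ} (x : Fin N → ℕ+) (i : Fin N) : revSeq x i = x i.rev := by
  simp [revSeq]

lemma revSeq_lt {N : ℕ} {x : Fin N → ℕ+} (hx : StrictAnti x) (i j : ℕ) (hij : i < j) (hj : j < N) :
    revSeq x i < revSeq x j := by
  simp only [revSeq, hj, hij.trans hj, dite_true]
  exact hx (Fin.rev_lt_rev.2 hij)

lemma coordSet_revSeq {N : ℕ} (x : Fin N → ℕ+) : coordSet N (revSeq x) = ofCoords x := by
  ext s
  rw [mem_coordSet, ofCoords, Finset.mem_image]
  constructor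
  · rintro ⟨j, hj, rfl⟩
    exact ⟨Fin.rev ⟨j, hj⟩, Finset.mem_univ _, (revSeq_val x ⟨j, hj⟩).symm⟩
  · rintro ⟨i, -, rfl⟩
    exact ⟨i.rev, i.rev.2, by rw [revSeq_val, Fin.rev_rev]⟩

variable {α R₁ R₂ r : ℝ}

lemma one_lt_abs_sub_of_lt (h2 : R₁ + 1 < R₂) : 1 < |R₁ - R₂| := by
  rw [abs_sub_comm]; exact lt_of_lt_of_le (by linarith) (le_abs_self _)

lemma Qmat_apply_eq_qForm (hα : 0 ≤ α) (h1 : max 1 α < R₁) (h2 : R₁ + 1 < R₂) (t : ℝ) {N : ℕ}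
    (x : Fin N → ℕ+) (i j : Fin N) : Qmat α t R₁ R₂ x i j = qForm α R₁ R₂
      (rowVec α R₁ R₂ t (fun i => (revSeq x i : ℕ)) i)
      (rowVec α R₁ R₂ t (fun i => (revSeq x i : ℕ)) j) := by
  simp only [rowVec, revSeq_val]
  rw [qForm_weightVec_eq_Qker hα h1 (by linarith) (one_lt_abs_sub_of_lt h2) t _ _
    (by have := (x i.rev).pos; omega)]
  rfl

lemma pvec_eq_contourDual (hα : 0 ≤ α) (h1 : max 1 α < R₁) (t : ℝ) {N : ℕ}
    (x : Fin N → ℕ+) (i : Fin N) : pvec α t R₁ x i = ((α : ℂ) • contourDual R₁)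
      (rowVec α R₁ R₂ t (fun i => (revSeq x i : ℕ)) i) := by
  simp only [rowVec, revSeq_val, LinearMap.smul_apply, smul_eq_mul]
  rw [contourDual_weightVec hα h1]
  rfl

lemma Umat_apply_eq_initDual (hα : 0 ≤ α) (h1 : max 1 α < R₁) (hr : 1 < r) (t : ℝ) {N M : ℕ}
    (hM : M ≤ N) (x : Fin N → ℕ+) (y : Fin M → ℕ+) (i : Fin N) (k : Fin M) :
    Umat t r x y i k = initDual α R₁ M N (fun k => (revSeq y k : ℕ)) k
      (rowVec α R₁ R₂ t (fun i => (revSeq x i : ℕ)) i) := by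
  rw [rowVec, ← Uker_eq_momentDual hα h1 hr t hM, revSeq_val, revSeq_val]
  rfl

lemma pfaffian_blockEven (hα : 0 ≤ α) (h1 : max 1 α < R₁) (h2 : R₁ + 1 < R₂) (hr : 1 < r) (t : ℝ)
    {N M : ℕ} (hM : M ≤ N) (hpar : Even (N + M)) (x : Fin N → ℕ+) (y : Fin M → ℕ+) :
    pfaffian (blockEven (Qmat α t R₁ R₂ x) (Umat t r x y)) =
      transPf α R₁ R₂ t M N (fun k => (revSeq y k : ℕ)) (fun i => (revSeq x i : ℕ)) := by
  rw [transPf, borderDual, if_pos hpar]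
  refine pfaffian_eq_pfSeq _ (by obtain ⟨n, hn⟩ := hpar; omega) _ _
    (blockEven_apply (extForm_skew (qForm_skew α R₁ R₂)) ?_ ?_ ?_)
  · intro i j
    simp [Qmat_apply_eq_qForm hα h1 h2, rowSeq_of_lt, extForm_apply]
  · intro i k
    simp [Umat_apply_eq_initDual (R₂ := R₂) hα h1 hr t hM, rowSeq_of_lt, rowSeq_of_ge,
      extForm_apply]
  · intro k l
    simp [rowSeq_of_ge, extForm_apply]

/-- For M = 0 and N even the Pfaffian involves only the N rows; no functional enters, so d is
arbitrary. -/
lemma pfaffian_Qmat (hα : 0 ≤ α) (h1 : max 1 α < R₁) (h2 : R₁ + 1 < R₂) (t : ℝ)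
    {N : ℕ} (hpar : Even N) (x : Fin N → ℕ+) (d : ℕ → ℤ) :
    pfaffian (Qmat α t R₁ R₂ x) = transPf α R₁ R₂ t 0 N d (fun i => (revSeq x i : ℕ)) := by
  refine pfaffian_eq_pfSeq _ (by obtain ⟨n, hn⟩ := hpar; omega) _ _ fun i j => ?_
  simp [Qmat_apply_eq_qForm hα h1 h2, rowSeq_of_lt, extForm_apply]

lemma blockBorder_apply (hα : 0 ≤ α) (h1 : max 1 α < R₁) (h2 : R₁ + 1 < R₂) (t : ℝ)
    {N : ℕ} (x : Fin N → ℕ+) {ψ : ℕ → Module.Dual ℂ Bdry} (hψ : ψ 0 = (α : ℂ) • contourDual R₁)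
    (i j : Fin (N + 1)) : blockBorder (Qmat α t R₁ R₂ x) (pvec α t R₁ x) i j =
      extForm (qForm α R₁ R₂) (rowSeq N (rowVec α R₁ R₂ t (fun i => (revSeq x i : ℕ))) ψ i)
        (rowSeq N (rowVec α R₁ R₂ t (fun i => (revSeq x i : ℕ))) ψ j) := by
  refine blockEven_apply (extForm_skew (qForm_skew α R₁ R₂)) ?_ ?_ ?_ i j
  · intro i j
    simp [Qmat_apply_eq_qForm hα h1 h2, rowSeq_of_lt, extForm_apply]
  · intro i k
    simp [pvec_eq_contourDual (R₂ := R₂) hα h1, rowSeq_of_lt, rowSeq_of_ge, extForm_apply, hψ]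
  · intro k l
    simp [rowSeq_of_ge, extForm_apply]

lemma pfaffian_blockBorder (hα : 0 ≤ α) (h1 : max 1 α < R₁) (h2 : R₁ + 1 < R₂) (t : ℝ)
    {N : ℕ} (hpar : Odd N) (x : Fin N → ℕ+) (d : ℕ → ℤ) :
    pfaffian (blockBorder (Qmat α t R₁ R₂ x) (pvec α t R₁ x)) =
      transPf α R₁ R₂ t 0 N d (fun i => (revSeq x i : ℕ)) := by
  rw [transPf, borderDual, if_neg (by simpa using hpar)]
  exact pfaffian_eq_pfSeq _ (by obtain ⟨n, hn⟩ := hpar; omega) _ _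
    (blockBorder_apply hα h1 h2 t x rfl)

lemma pfaffian_blockOdd (hα : 0 ≤ α) (h1 : max 1 α < R₁) (h2 : R₁ + 1 < R₂) (hr : 1 < r) (t : ℝ)
    {N M : ℕ} (hM : M ≤ N) (hpar : Odd (N + M)) (x : Fin N → ℕ+) (y : Fin M → ℕ+) :
    pfaffian (blockOdd (Qmat α t R₁ R₂ x) (pvec α t R₁ x) (Umat t r x y)) =
      transPf α R₁ R₂ t M N (fun k => (revSeq y k : ℕ)) (fun i => (revSeq x i : ℕ)) := by
  rw [transPf, borderDual, if_neg (by simpa using hpar)]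
  refine pfaffian_eq_pfSeq _ (by obtain ⟨n, hn⟩ := hpar; omega) _ _
    (blockEven_apply (extForm_skew (qForm_skew α R₁ R₂)) (blockBorder_apply hα h1 h2 t x rfl) ?_ ?_)
  · intro i k
    have e : N + 1 + (k : ℕ) - N = k + 1 := by omega
    have hk : N ≤ N + 1 + (k : ℕ) := by omega
    induction i using Fin.lastCases with
    | last => simp [rowSeq_of_ge, hk, extForm_apply]
    | cast i =>
      simp [Umat_apply_eq_initDual (R₂ := R₂) hα h1 hr t hM, rowSeq_of_lt, rowSeq_of_ge, hk, e,
        extForm_apply, consSeq]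
  · intro k l
    have hk : ∀ k : ℕ, N ≤ N + 1 + k := by omega
    simp [rowSeq_of_ge, hk, extForm_apply]

lemma transProb_ofCoords (hα : 0 ≤ α) (h1 : max 1 α < R₁) (h2 : R₁ + 1 < R₂) (t : ℝ) {N M : ℕ}
    {x : Fin N → ℕ+} {y : Fin M → ℕ+} (hx : StrictAnti x) (hy : StrictAnti y) (hM : M ≤ N)
    (hyM : ∀ hM : 0 < M, N - M + 1 < (y ⟨M - 1, Nat.sub_lt hM Nat.one_pos⟩ : ℕ)) :
    (transProb α t (ofCoords y) (ofCoords x) : ℂ) = (-1) ^ N.choose 2 * Complex.exp (-(α * t)) *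
      transPf α R₁ R₂ t M N (fun k => (revSeq y k : ℕ)) (fun i => (revSeq x i : ℕ)) := by
  rw [← coordSet_revSeq, ← coordSet_revSeq]
  refine transProb_coordSet hα h1 h2 (revSeq_lt hy) _ N _ rfl (revSeq_lt hx) (by omega) ?_ t
  -- The hypothesis bounds the smallest coordinate of y, and each further coordinate gains at least
  -- one.
  intro k
  induction k with
  | zero =>
    intro hk
    have h := hyM hk
    have e : revSeq y 0 = y ⟨M - 1, Nat.sub_lt hk Nat.one_pos⟩ := by
      simp only [revSeq, hk, dite_true]
      congr 1
    rw [e]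
    omega
  | succ k ih =>
    intro hk
    have h := ih (by omega)
    have h' : (revSeq y k : ℕ) < revSeq y (k + 1) := revSeq_lt hy k (k + 1) (by omega) hk
    push_cast
    omega

end BlockMatrices
end HalfTASEP

theorem theorem3p5
    (α t : ℝ) (hα : 0 ≤ α) (ht : 0 ≤ t)
    -- the radii of the contours: `R₁`, `R₂` for the `w`- and `u`-contours, `r` for the contour of `U`
    (R₁ R₂ r : ℝ) (hR₁ : max 1 α < R₁) (hR₂ : max 1 α < R₂) (hR : 1 < |R₁ - R₂|) (hr : 1 < r)
    (N : ℕ) (x : Fin N → ℕ+) (hx : StrictAnti x) :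
    -- the matrix `Q` is skew-symmetric
    (HalfTASEP.Qmat α t R₁ R₂ x).transpose = -HalfTASEP.Qmat α t R₁ R₂ x ∧
    -- general initial condition `y`, with smallest coordinate `y_M > N - M + 1`
    (∀ (M : ℕ) (y : Fin M → ℕ+), M ≤ N → StrictAnti y →
      (∀ hM : 0 < M, N - M + 1 < (y ⟨M - 1, Nat.sub_lt hM Nat.one_pos⟩ : ℕ)) →
      (Even (N + M) →
        (HalfTASEP.transProb α t (HalfTASEP.ofCoords y) (HalfTASEP.ofCoords x) : ℂ) =
          (-1) ^ (N.choose 2) * Complex.exp (-(α * t)) *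
            HalfTASEP.pfaffian (HalfTASEP.blockEven (HalfTASEP.Qmat α t R₁ R₂ x)
              (HalfTASEP.Umat t r x y))) ∧
      (Odd (N + M) →
        (HalfTASEP.transProb α t (HalfTASEP.ofCoords y) (HalfTASEP.ofCoords x) : ℂ) =
          (-1) ^ (N.choose 2) * Complex.exp (-(α * t)) *
            HalfTASEP.pfaffian (HalfTASEP.blockOdd (HalfTASEP.Qmat α t R₁ R₂ x)
              (HalfTASEP.pvec α t R₁ x) (HalfTASEP.Umat t r x y)))) ∧
    -- empty initial condition
    (Even N →
      (HalfTASEP.transProb α t ∅ (HalfTASEP.ofCoords x) : ℂ) =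
        (-1) ^ (N.choose 2) * Complex.exp (-(α * t)) *
          HalfTASEP.pfaffian (HalfTASEP.Qmat α t R₁ R₂ x)) ∧
    (Odd N →
      (HalfTASEP.transProb α t ∅ (HalfTASEP.ofCoords x) : ℂ) =
        (-1) ^ (N.choose 2) * Complex.exp (-(α * t)) *
          HalfTASEP.pfaffian (HalfTASEP.blockBorder (HalfTASEP.Qmat α t R₁ R₂ x)
            (HalfTASEP.pvec α t R₁ x))) := by
  have hpos : ∀ i j : Fin N, 1 ≤ (((x i : ℕ) : ℤ) + ((x j : ℕ) : ℤ)) := fun i j => by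
    have := (x i).pos; omega
  refine ⟨Matrix.ext fun i j => HalfTASEP.Qker_skew hα hR₁ hR₂ hR t _ _ (hpos _ _), ?_⟩
  -- The residue at the wall needs the w-circle to be the smaller one. Neither Q at positive
  -- positions nor p changes when the radii are exchanged.
  wlog h2 : R₁ + 1 < R₂ generalizing R₁ R₂
  · have h2' : R₂ + 1 < R₁ := by
      rw [lt_abs] at hR
      obtain h | h := hR <;> linarith
    have eQ : HalfTASEP.Qmat α t R₁ R₂ x = HalfTASEP.Qmat α t R₂ R₁ x :=
      Matrix.ext fun i j => (HalfTASEP.Qker_comm_radii hα hR₂ h2' t _ _ (hpos _ _)).symm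
    have ep : HalfTASEP.pvec α t R₁ x = HalfTASEP.pvec α t R₂ x :=
      funext fun i => HalfTASEP.pker_eq_of_radii hα hR₁ hR₂ t _ _
    rw [eQ, ep]
    exact this R₂ R₁ hR₂ hR₁ (by rwa [abs_sub_comm]) h2'
  have hempty : HalfTASEP.ofCoords (Fin.elim0 : Fin 0 → ℕ+) = ∅ := by simp [HalfTASEP.ofCoords]
  have h0 := HalfTASEP.transProb_ofCoords hα hR₁ h2 t (y := Fin.elim0) hx
    (fun i => i.elim0) (Nat.zero_le N) (fun h => absurd h (lt_irrefl 0))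
  rw [hempty] at h0
  refine ⟨fun M y hM hy hyM => ⟨fun hpar => ?_, fun hpar => ?_⟩, fun hpar => ?_, fun hpar => ?_⟩
  · rw [HalfTASEP.transProb_ofCoords hα hR₁ h2 t hx hy hM hyM,
      HalfTASEP.pfaffian_blockEven hα hR₁ h2 hr t hM hpar]
  · rw [HalfTASEP.transProb_ofCoords hα hR₁ h2 t hx hy hM hyM,
      HalfTASEP.pfaffian_blockOdd hα hR₁ h2 hr t hM hpar]
  · rw [h0, HalfTASEP.pfaffian_Qmat hα hR₁ h2 t hpar]
  · rw [h0, HalfTASEP.pfaffian_blockBorder hα hR₁ h2 t hpar]
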